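/- An elementary cube is a product $[l_1,l_1+1]\times[l_2,l_2+1]\times[l_3,l_3+1]\subset\mathbb R^3$ with $l_i\in\mathbb Z$. Let $M\subset\mathbb R^3$ be a union of elementary cubes and $f(x_1,x_2,x_3)=x_1+x_2+x_3$. For $v\in\mathbb Z^3$ code each of the eight elementary cubes around $v$ by a triple of signs (the sign in place $i$ is $+$ if $x_i\ge v_i$ on the cube and $-$ otherwise), and put $t_{\pm\pm\pm}=1$ if the cube belongs to $M$ and $0$ otherwise. Let $N(v)$ be the union of those of the eight cubes that belong to $M$, and $N_vM^b=N(v)\cap\{f\le b\}$. A vertex $v\in M$ is *critical* if for all sufficiently small $\varepsilon>0$ the sets $X=N_vM^{f(v)-\varepsilon}$ and $Y=N_vM^{f(v)+\varepsilon}$ are not homeomorphic. A critical vertex is *nondegenerate of index* $i\in\{0,1,2\}$ if, for all sufficiently small $\varepsilon>0$, $Y$ is homeomorphic to $X$ with one handle $D^i\times D^{3-i}$ glued to the boundary of $X$ along an embedding of $\partial D^i\times D^{3-i}$ (and, if $i=0$, $X=\emptyset$); otherwise it is *degenerate*. Call $M$ *unstacked* if no two of its cubes with a common edge touch along that edge only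 (i.e. at least one of the two further cubes at the edge also belongs to $M$), and at no vertex do the cubes in $M$, or the cubes not in $M$, among the eight around it consist of exactly two opposite ones. *Preprocessing* a union $M_0$ of elementary cubes means: stretch $M_0$ by the factor $3$, subdivide it into elementary cubes, and remove every elementary cube that has a two-dimensional face in the boundary of the stretched body. Call a $2\times2\times2$ block of elementary cubes *stacked* in $M_0$ if $M_0$ contains all four cubes of one layer of the block and exactly two, diagonally opposite, cubes of the opposite layer. **Theorem.** (a) If $M_0$ has no stacked block, then preprocessing $M_0$ yields an unstacked body. (b) Let $M$ be unstacked. A vertex $v$ is critical if and only if the pair of matrices $$\begin{pmatrix}t_{---}&t_{+--}\\t_{-+-}&t_{++-}\end{pmatrix}\begin{pmatrix}t_{--+}&t_{+-+}\\t_{-++}&t_{+++}\end{pmatrix}$$ is one of the following fifteen: 1. $\begin{pmatrix}0&0\\0&0\end{pmatrix}\begin{pmatrix}0&0\\0&1\end{pmatrix}$; 2. $\begin{pmatrix}0&1\\1&1\end{pmatrix}\begin{pmatrix}1&1\\1&1\end{pmatrix}$; 3. $\begin{pmatrix}0&0\\0&0\end{pmatrix}\begin{pmatrix}0&1\\1&1\end{pmatrix}$;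 4. $\begin{pmatrix}0&0\\0&1\end{pmatrix}\begin{pmatrix}0&1\\0&1\end{pmatrix}$; 5. $\begin{pmatrix}0&0\\0&1\end{pmatrix}\begin{pmatrix}0&0\\1&1\end{pmatrix}$; 6. $\begin{pmatrix}0&0\\0&1\end{pmatrix}\begin{pmatrix}1&1\\1&1\end{pmatrix}$; 7. $\begin{pmatrix}0&1\\0&1\end{pmatrix}\begin{pmatrix}0&1\\1&1\end{pmatrix}$; 8. $\begin{pmatrix}0&0\\1&1\end{pmatrix}\begin{pmatrix}0&1\\1&1\end{pmatrix}$; 9. $\begin{pmatrix}0&1\\0&0\end{pmatrix}\begin{pmatrix}0&1\\1&1\end{pmatrix}$; 10. $\begin{pmatrix}0&0\\1&1\end{pmatrix}\begin{pmatrix}0&1\\0&1\end{pmatrix}$; 11. $\begin{pmatrix}0&0\\0&1\end{pmatrix}\begin{pmatrix}1&0\\1&1\end{pmatrix}$; 12. $\begin{pmatrix}0&0\\1&0\end{pmatrix}\begin{pmatrix}0&1\\1&1\end{pmatrix}$; 13. $\begin{pmatrix}0&0\\0&1\end{pmatrix}\begin{pmatrix}1&1\\0&1\end{pmatrix}$;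 14. $\begin{pmatrix}0&1\\0&1\end{pmatrix}\begin{pmatrix}0&0\\1&1\end{pmatrix}$; 15. $\begin{pmatrix}0&0\\0&1\end{pmatrix}\begin{pmatrix}0&1\\1&1\end{pmatrix}$. A vertex of type 1 is a nondegenerate critical point of index $0$, one of type 2 is nondegenerate of index $2$, and one of the types 3–14 is nondegenerate of index $1$. A vertex $v$ of type 15 is a degenerate critical point, a "monkey saddle": near $v$ the boundary of $M$ is a surface on which, in a suitable topological chart centred at $v$, $f-f(v)$ is the function $x^3-xy^2$; and for all sufficiently small $\varepsilon>0$, $N_vM^{f(v)+\varepsilon}$ is homeomorphic to $N_vM^{f(v)-\varepsilon}$ with two disjoint handles of index $1$ glued to its boundary. (c) Each of the fifteen types occurs at some vertex of a body obtained by preprocessing a bounded union of elementary cubes without stacked blocks. -/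

import Mathlib

open Filter Topology

namespace CubicalMorse

/-! An elementary cube `[c₀, c₀+1] × [c₁, c₁+1] × [c₂, c₂+1]` is coded by its lower corner
`c : Fin 3 → ℤ`; a body made of unit cubes is coded by the set `M` of its cubes. -/

/-- The closed elementary cube with lower corner `c`. -/
def cube (c : Fin 3 → ℤ) : Set (Fin 3 → ℝ) :=
  {x | ∀ i, (c i : ℝ) ≤ x i ∧ x i ≤ (c i : ℝ) + 1}

/-- The body formed by the cubes in `M`. -/
def body (M : Set (Fin 3 → ℤ)) : Set (Fin 3 → ℝ) :=
  ⋃ c ∈ M, cube c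

/-- The diagonal function `f = x₁ + x₂ + x₃`. -/
def diag (x : Fin 3 → ℝ) : ℝ := x 0 + x 1 + x 2

/-- The integer vertex `v` as a point of space. -/
def pt (v : Fin 3 → ℤ) : Fin 3 → ℝ := fun i => (v i : ℝ)

/-- A triple of signs, `true` for `+` and `false` for `-`. -/
abbrev Signs := Fin 3 → Bool

/-- The one of the eight elementary cubes around the vertex `v` in which the `i`-th coordinate is
greater than `v i` if the `i`-th sign is `+`, and less than `v i` if it is `-`. -/
def octant (v : Fin 3 → ℤ) (s : Signs) : Fin 3 → ℤ :=
  fun i => if s i then v i else v i - 1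

/-! ### Preprocessing -/

/-- The subdivision of the body stretched by the factor 3: every cube becomes 27 cubes. -/
def subdivide (M : Set (Fin 3 → ℤ)) : Set (Fin 3 → ℤ) :=
  {c | (fun i => c i / 3) ∈ M}

/-- Stretch by the factor 3 and remove all cubes which have a two-dimensional face in the boundary
of the stretched body. -/
def preprocess (M : Set (Fin 3 → ℤ)) : Set (Fin 3 → ℤ) :=
  {c | c ∈ subdivide M ∧ ∀ i, Function.update c i (c i + 1) ∈ subdivide M ∧
    Function.update c i (c i - 1) ∈ subdivide M}

/-- All cubes are unstacked at joint edges and joint vertices: two cubes of `M` with a common edge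
never touch along that edge only, and at no vertex the cubes of `M`, or the cubes not in `M`, are
just two opposite cubes that touch at that vertex only. -/
structure IsUnstacked (M : Set (Fin 3 → ℤ)) : Prop where
  edge : ∀ c ∈ M, ∀ d ∈ M, ∀ i j : Fin 3, i ≠ j → |c i - d i| = 1 → |c j - d j| = 1 →
    (∀ k, k ≠ i → k ≠ j → c k = d k) →
    Function.update c i (d i) ∈ M ∨ Function.update c j (d j) ∈ M
  vertex : ∀ (v : Fin 3 → ℤ) (s : Signs),
    ¬ ∀ s' : Signs, octant v s' ∈ M ↔ (s' = s ∨ s' = fun k => !(s k))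
  vertex_compl : ∀ (v : Fin 3 → ℤ) (s : Signs),
    ¬ ∀ s' : Signs, octant v s' ∉ M ↔ (s' = s ∨ s' = fun k => !(s k))

/-- Some `2 × 2 × 2` block of cubes consists of one full layer of four cubes in `M` and an opposite
layer of which exactly two diagonally opposite cubes are in `M`. -/
def HasStackedBlock (M : Set (Fin 3 → ℤ)) : Prop :=
  ∃ (v : Fin 3 → ℤ) (i : Fin 3) (s : Signs), ∀ s' : Signs,
    octant v s' ∈ M ↔ (s' i ≠ s i ∨ s' = s ∨ s' = fun k => if k = i then s k else !(s k))

/-! ### Critical points -/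

/-- `N(v)`: the union of those of the eight cubes around `v` that lie in `M`. -/
def nbhd (M : Set (Fin 3 → ℤ)) (v : Fin 3 → ℤ) : Set (Fin 3 → ℝ) :=
  ⋃ (s : Signs) (_ : octant v s ∈ M), cube (octant v s)

/-- `N_v M^b`: the part of `N(v)` where `f ≤ b`. -/
def sublevel (M : Set (Fin 3 → ℤ)) (v : Fin 3 → ℤ) (b : ℝ) : Set (Fin 3 → ℝ) :=
  {x | x ∈ nbhd M v ∧ diag x ≤ b}

/-- `v` is a vertex of the body such that, for all sufficiently small `ε > 0`, the sublevel sets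
at `f(v) - ε` and `f(v) + ε` near `v` are not homeomorphic. -/
def IsCritical (M : Set (Fin 3 → ℤ)) (v : Fin 3 → ℤ) : Prop :=
  pt v ∈ body M ∧ ∀ᶠ ε : ℝ in 𝓝[>] 0,
    IsEmpty (sublevel M v (diag (pt v) - ε) ≃ₜ sublevel M v (diag (pt v) + ε))

/-- The closed unit ball `D^m`. -/
abbrev Disk (m : ℕ) : Type := Metric.closedBall (0 : EuclideanSpace ℝ (Fin m)) 1

/-- `Y` is, up to homeomorphism, `X` with `n` disjoint handles `D^i × D^(3-i)` of index `i`
(`i ≤ 3`) glued along disjoint embeddings `φ` of `∂D^i × D^(3-i)` in the boundary of `X`.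
Here `h` and `g` are the canonical maps of `X` and of the handles to the adjunction space: they are
closed embeddings that cover it, and they overlap exactly in the image of `φ`. -/
def AttachesHandles (n i : ℕ) (X Y : Set (Fin 3 → ℝ)) : Prop :=
  ∃ (h : X → Y) (g : Fin n × (Disk i × Disk (3 - i)) → Y),
    IsClosedEmbedding h ∧ IsClosedEmbedding g ∧
    Set.range h ∪ Set.range g = Set.univ ∧
    (∀ p, g p ∈ Set.range h ↔ ‖(p.2.1 : EuclideanSpace ℝ (Fin i))‖ = 1) ∧
    (∀ x, h x ∈ Set.range g → (x : Fin 3 → ℝ) ∈ frontier X)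

/-- `v` is a nondegenerate critical point of index `i ∈ {0, 1, 2}`: passing the level of `v`
amounts, near `v`, to gluing one handle of index `i`, and for `i = 0` nothing is there before. -/
def IsNondegenerate (M : Set (Fin 3 → ℤ)) (v : Fin 3 → ℤ) (i : ℕ) : Prop :=
  IsCritical M v ∧ i ≤ 2 ∧ ∀ᶠ ε : ℝ in 𝓝[>] 0,
    AttachesHandles 1 i (sublevel M v (diag (pt v) - ε)) (sublevel M v (diag (pt v) + ε)) ∧
    (i = 0 → sublevel M v (diag (pt v) - ε) = ∅)

/-- A critical point that is not nondegenerate of any index. -/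
def IsDegenerate (M : Set (Fin 3 → ℤ)) (v : Fin 3 → ℤ) : Prop :=
  IsCritical M v ∧ ∀ i, ¬ IsNondegenerate M v i

/-- Near `v` the boundary of the body is a surface on which `f - f(v)` is, in a suitable local
topological chart centred at `v`, the function `x³ - xy²`. -/
def IsMonkeySaddle (M : Set (Fin 3 → ℤ)) (v : Fin 3 → ℤ) : Prop :=
  ∃ (hv : pt v ∈ frontier (body M)) (e : OpenPartialHomeomorph (frontier (body M)) (ℝ × ℝ)),
    (⟨pt v, hv⟩ : frontier (body M)) ∈ e.source ∧ e ⟨pt v, hv⟩ = 0 ∧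
    ∀ x ∈ e.source, diag (x : Fin 3 → ℝ) - diag (pt v) = (e x).1 ^ 3 - (e x).1 * (e x).2 ^ 2

/-! ### The table of local configurations -/

/-- The fifteen pairs of matrices
`(t₋₋₋ t₊₋₋ ; t₋₊₋ t₊₊₋)  (t₋₋₊ t₊₋₊ ; t₋₊₊ t₊₊₊)`. -/
def typeTable : Fin 15 → Matrix (Fin 2) (Fin 2) ℕ × Matrix (Fin 2) (Fin 2) ℕ :=
  ![(!![0, 0; 0, 0], !![0, 0; 0, 1]),
    (!![0, 1; 1, 1], !![1, 1; 1, 1]),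
    (!![0, 0; 0, 0], !![0, 1; 1, 1]),
    (!![0, 0; 0, 1], !![0, 1; 0, 1]),
    (!![0, 0; 0, 1], !![0, 0; 1, 1]),
    (!![0, 0; 0, 1], !![1, 1; 1, 1]),
    (!![0, 1; 0, 1], !![0, 1; 1, 1]),
    (!![0, 0; 1, 1], !![0, 1; 1, 1]),
    (!![0, 1; 0, 0], !![0, 1; 1, 1]),
    (!![0, 0; 1, 1], !![0, 1; 0, 1]),
    (!![0, 0; 0, 1], !![1, 0; 1, 1]),
    (!![0, 0; 1, 0], !![0, 1; 1, 1]),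
    (!![0, 0; 0, 1], !![1, 1; 0, 1]),
    (!![0, 1; 0, 1], !![0, 0; 1, 1]),
    (!![0, 0; 0, 1], !![0, 1; 1, 1])]

/-- The indices of the first fourteen types. -/
def typeIndex : Fin 14 → ℕ := ![0, 2, 1, 1, 1, 1, 1, 1, 1, 1, 1, 1, 1, 1]

/-- The entry `t` of the `k`-th row of the table at a triple of signs. -/
def entry (k : Fin 15) (s : Signs) : ℕ :=
  (if s 2 then (typeTable k).2 else (typeTable k).1)
    (if s 1 then 1 else 0) (if s 0 then 1 else 0)

/-- The cubes of `M` around `v` form the configuration in the `k`-th row of the table. -/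
def HasType (M : Set (Fin 3 → ℤ)) (v : Fin 3 → ℤ) (k : Fin 15) : Prop :=
  ∀ s : Signs, octant v s ∈ M ↔ entry k s = 1

end CubicalMorse

open CubicalMorse

/-!
# Critical points of the diagonal function on unstacked cubical bodies

Everything happens in the cube `[-1, 1]³` around a vertex, which is moved to the origin. A local
configuration is a set of the eight octant cells of this cube, coded by the bits of a number
`n < 256`, and the sublevel sets at the levels `±ε` are the sets `part (config n) (±ε)`, unions of
convex cells cut off by the plane `x₀ + x₁ + x₂ = ±ε`.

**Balls.** A compact convex set, and more generally a star body given by a continuous gauge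
(`IsStar`), is a ball, and it can be pushed radially onto a smaller star body with the same
centre, while everything stays fixed that is attached to it along their common boundary
(`IsStar.nonempty_homeomorph_push`). For cells this yields two moves that remove a cell without
changing the homeomorphism type: a cell is pushed through a face into its neighbour
(`nonempty_homeomorph_push_face`), or into the other three cells of a full layer
(`nonempty_homeomorph_push_edge`). A finite check of the 256 codes shows that these moves reduce
the upper sublevel set of every unstacked nonempty configuration, and the lower one of every such
configuration outside the table, to a single cell; only the full configuration `255` needs a
separate argument, by convexity. Hence above the vertex there is always a ball, and below it there
is a ball unless the vertex has one of the fifteen types.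

**Handles.** Below a vertex of type 1 there is nothing. Below one of type 2 only the lowest cell
is missing; the rays from the vertex exhibit it as a product of a triangle with an interval, that
is, as a handle of index 2 (`attachesHandles_two`). Below a vertex of the types 3 to 14 there are
two disjoint star bodies, and three of them for type 15 (`Splits`). A cylinder cut into `2 n + 1`
slabs shows that `n` handles of index 1 join `n + 1` disjoint star bodies to a ball
(`attachesHandles_chain`).

**Homeomorphy excluded.** Disconnected or empty sets are not balls, and the lower sublevel set of
type 2 is not a ball, because it winds around the diagonal: otherwise the identity of the circle
would have a continuous logarithm (`isEmpty_homeomorph_of_compl`). A single handle of index 1 or 2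
cannot join three pieces, as its attaching region is covered by two connected sets
(`not_attachesHandles_of_pieces`); so type 15 is degenerate.

**The monkey saddle.** At a vertex of type 15 the body is locally the set where at least two
coordinates are nonnegative. Its boundary is parametrized by the plane `L₀ + L₁ + L₂ = 0` through
the map `bend`, which makes the coordinate with the smallest `|Lᵢ|` zero and has the coordinate
sum `L₀ L₁ L₂ / 2`; in suitable linear coordinates of the plane this product is `x³ - x y²`.

**Preprocessing.** A small cube remains if its big cube and those big cubes are present that share
a face with the small cube. A small cube may therefore be moved to the middle third of its big
cube in any direction (`update_mem_preprocess`), which settles all edges and vertices except those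
where several big cubes meet in general position; there a violation at an edge is precisely a
stacked block and one at a vertex is impossible. The examples for the fifteen types lie in
`[0, 2]³` and are checked by evaluation.
-/

namespace CubicalMorse

/-! ### Gauges and star bodies -/

section Gauge

variable {E : Type*} [NormedAddCommGroup E] [NormedSpace ℝ E]

/-- A continuous, positively homogeneous function that is positive away from the origin. No
convexity is asked for, so that the minimum of two gauges is again a gauge. -/
structure IsGauge (g : E → ℝ) : Prop where
  continuous : Continuous g
  smul : ∀ (t : ℝ) (x : E), 0 ≤ t → g (t • x) = t * g x
  pos : ∀ x : E, x ≠ 0 → 0 < g x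

theorem IsGauge.zero {g : E → ℝ} (hg : IsGauge g) : g 0 = 0 := by
  simpa using hg.smul 0 0 le_rfl

theorem IsGauge.nonneg {g : E → ℝ} (hg : IsGauge g) (x : E) : 0 ≤ g x := by
  rcases eq_or_ne x 0 with rfl | hx
  · exact hg.zero.ge
  · exact (hg.pos x hx).le

theorem IsGauge.min {g h : E → ℝ} (hg : IsGauge g) (hh : IsGauge h) :
    IsGauge fun x => min (g x) (h x) where
  continuous := hg.continuous.min hh.continuous
  smul t x ht := by simp only [hg.smul t x ht, hh.smul t x ht, mul_min_of_nonneg _ _ ht]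
  pos x hx := lt_min (hg.pos x hx) (hh.pos x hx)

theorem isGauge_norm_comp {F : Type*} [NormedAddCommGroup F] [NormedSpace ℝ F] (L : E ≃L[ℝ] F) :
    IsGauge fun x => ‖L x‖ where
  continuous := L.continuous.norm
  smul t x ht := by simp [norm_smul, abs_of_nonneg ht]
  pos x hx := by simpa using hx

theorem IsGauge.exists_mul_norm_le [FiniteDimensional ℝ E] {g : E → ℝ} (hg : IsGauge g) :
    ∃ c : ℝ, 0 < c ∧ ∀ x, c * ‖x‖ ≤ g x := by
  have : ProperSpace E := FiniteDimensional.proper ℝ E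
  rcases (Metric.sphere (0 : E) 1).eq_empty_or_nonempty with he | hne
  · refine ⟨1, one_pos, fun x => ?_⟩
    have hx : x = 0 := by
      by_contra hx
      have : ‖x‖⁻¹ • x ∈ Metric.sphere (0 : E) 1 := by
        simp [norm_smul, inv_mul_cancel₀ (norm_ne_zero_iff.2 hx)]
      simp [he] at this
    simp [hx, hg.zero]
  · obtain ⟨y, hy, hmin⟩ :=
      (isCompact_sphere (0 : E) 1).exists_isMinOn hne hg.continuous.continuousOn
    have hy1 : ‖y‖ = 1 := by simpa using hy
    refine ⟨g y, hg.pos y (by rintro rfl; simp at hy1), fun x => ?_⟩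
    rcases eq_or_ne x 0 with rfl | hx
    · simp [hg.zero]
    have hx' : 0 < ‖x‖ := norm_pos_iff.2 hx
    have h1 : g y ≤ g (‖x‖⁻¹ • x) := hmin (by simp [norm_smul, inv_mul_cancel₀ hx'.ne'])
    rw [hg.smul _ _ (inv_nonneg.2 hx'.le)] at h1
    calc g y * ‖x‖ ≤ (‖x‖⁻¹ * g x) * ‖x‖ := by gcongr
      _ = g x := by field_simp

/-- The radial map that carries the level sets of the gauge `g` to those of the gauge `h`. -/
noncomputable def radial (g h : E → ℝ) (x : E) : E := (g x / h x) • x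

theorem gauge_radial {g h : E → ℝ} (hg : IsGauge g) (hh : IsGauge h) (x : E) :
    h (radial g h x) = g x := by
  rcases eq_or_ne x 0 with rfl | hx
  · simp [radial, hg.zero, hh.zero]
  · rw [radial, hh.smul _ _ (div_nonneg (hg.nonneg x) (hh.nonneg x)),
      div_mul_cancel₀ _ (hh.pos x hx).ne']

theorem radial_of_eq {g h : E → ℝ} (hh : IsGauge h) {x : E} (e : g x = h x) :
    radial g h x = x := by
  rcases eq_or_ne x 0 with rfl | hx
  · simp [radial]
  · simp [radial, e, div_self (hh.pos x hx).ne']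

theorem radial_radial {g h : E → ℝ} (hg : IsGauge g) (hh : IsGauge h) (x : E) :
    radial h g (radial g h x) = x := by
  rcases eq_or_ne x 0 with rfl | hx
  · simp [radial]
  · have h1 := gauge_radial hg hh x
    have h2 : g (radial g h x) = g x / h x * g x :=
      hg.smul _ _ (div_nonneg (hg.nonneg x) (hh.nonneg x))
    have := (hg.pos x hx).ne'
    have := (hh.pos x hx).ne'
    rw [radial, h1, h2, radial, smul_smul]
    rw [show g x / (g x / h x * g x) * (g x / h x) = 1 by field_simp, one_smul]

theorem continuous_radial [FiniteDimensional ℝ E] {g h : E → ℝ} (hg : IsGauge g)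
    (hh : IsGauge h) : Continuous (radial g h) := by
  rw [continuous_iff_continuousAt]
  intro x
  rcases eq_or_ne x 0 with rfl | hx
  · obtain ⟨c, hc, hle⟩ := hh.exists_mul_norm_le
    rw [ContinuousAt, show radial g h 0 = 0 by simp [radial]]
    rw [tendsto_zero_iff_norm_tendsto_zero]
    refine squeeze_zero (g := fun x => g x / c) (fun _ => norm_nonneg _) (fun y => ?_) ?_
    · rw [le_div_iff₀ hc, mul_comm, ← gauge_radial hg hh y]
      exact hle _
    · have : Tendsto (fun x => g x / c) (𝓝 0) (𝓝 (g 0 / c)) :=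
        (hg.continuous.tendsto 0).div_const c
      simpa [hg.zero] using this
  · exact (hg.continuous.continuousAt.div hh.continuous.continuousAt (hh.pos x hx).ne').smul
      continuousAt_id

/-- The radial homeomorphism between the level sets of two gauges. -/
noncomputable def radialHomeomorph [FiniteDimensional ℝ E] {g h : E → ℝ} (hg : IsGauge g)
    (hh : IsGauge h) : E ≃ₜ E where
  toFun := radial g h
  invFun := radial h g
  left_inv := radial_radial hg hh
  right_inv := radial_radial hh hg
  continuous_toFun := continuous_radial hg hh
  continuous_invFun := continuous_radial hh hg

/-- `K` is the star body with centre `o` and gauge `g`. -/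
structure IsStar (K : Set E) (o : E) (g : E → ℝ) : Prop where
  gauge : IsGauge g
  mem_iff : ∀ x, x ∈ K ↔ g (x - o) ≤ 1

theorem IsStar.union {K K' : Set E} {o : E} {g g' : E → ℝ} (hK : IsStar K o g)
    (hK' : IsStar K' o g') : IsStar (K ∪ K') o fun x => min (g x) (g' x) where
  gauge := hK.gauge.min hK'.gauge
  mem_iff x := by simp [hK.mem_iff, hK'.mem_iff]

/-- A convex compact set is a star body about each of its interior points. -/
theorem exists_isStar_of_convex {K : Set E} (hc : Convex ℝ K) (hk : IsCompact K) {o : E}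
    (ho : o ∈ interior K) : ∃ g, IsStar K o g := by
  set e : E ≃ₜ E := Homeomorph.addRight o
  set K₀ : Set E := e ⁻¹' K
  have hK₀ : IsCompact K₀ := e.isCompact_preimage.2 hk
  have hc₀ : Convex ℝ K₀ := hc.translate_preimage_left o
  have hn : K₀ ∈ 𝓝 (0 : E) := by
    apply e.continuous.continuousAt.preimage_mem_nhds
    simpa [e] using mem_interior_iff_mem_nhds.1 ho
  refine ⟨_root_.gauge K₀, ⟨continuous_gauge hc₀ hn, fun t x ht => ?_, fun x hx => ?_⟩, fun x => ?_⟩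
  · simpa using gauge_smul_of_nonneg (s := K₀) ht x
  · exact (gauge_pos (absorbent_nhds_zero hn)
      (NormedSpace.isVonNBounded_of_isBounded ℝ hK₀.isBounded)).2 hx
  · rw [gauge_le_one_iff_mem_closure hc₀ hn, hK₀.isClosed.closure_eq]
    simp [K₀, e]

/-- On a star body inside another one with the same centre, the gauges agree at the points that are
not interior to the larger body. -/
theorem IsStar.gauge_eq {K K' : Set E} {o : E} {g g' : E → ℝ} (hK : IsStar K o g)
    (hK' : IsStar K' o g') (hsub : K' ⊆ K) {x : E} (hx : x ∈ K') (hi : x ∉ interior K) :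
    g (x - o) = g' (x - o) := by
  have h1 : g (x - o) ≤ 1 := (hK.mem_iff x).1 (hsub hx)
  have h2 : ¬ g (x - o) < 1 := fun hlt => hi <| mem_interior.2
    ⟨{y | g (y - o) < 1}, fun y hy => (hK.mem_iff y).2 (le_of_lt hy),
      isOpen_lt (hK.gauge.continuous.comp (continuous_id.sub continuous_const)) continuous_const,
      hlt⟩
  have h3 : g' (x - o) ≤ 1 := (hK'.mem_iff x).1 hx
  have h4 : g (x - o) ≤ g' (x - o) := by
    rcases eq_or_ne (x - o) 0 with h0 | h0
    · rw [h0, hK.gauge.zero, hK'.gauge.zero]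
    have hp := hK'.gauge.pos _ h0
    have hm : (g' (x - o))⁻¹ • (x - o) + o ∈ K := hsub <| (hK'.mem_iff _).2 <| by
      rw [add_sub_cancel_right, hK'.gauge.smul _ _ (inv_nonneg.2 hp.le), inv_mul_cancel₀ hp.ne']
    have := (hK.mem_iff _).1 hm
    rw [add_sub_cancel_right, hK.gauge.smul _ _ (inv_nonneg.2 hp.le), inv_mul_le_iff₀ hp] at this
    simpa using this
  linarith

theorem IsStar.notMem_interior {K : Set E} {o : E} {g : E → ℝ} (hK : IsStar K o g) {x : E}
    (hx : g (x - o) = 1) : x ∉ interior K := by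
  intro hi
  have hc : Tendsto (fun t : ℝ => t • (x - o) + o) (𝓝[>] 1) (𝓝 x) := by
    have : Continuous fun t : ℝ => t • (x - o) + o := by fun_prop
    have h := (this.tendsto 1).mono_left (nhdsWithin_le_nhds (s := Set.Ioi 1))
    simpa using h
  have h1 := (hc.eventually (mem_interior_iff_mem_nhds.1 hi)).and self_mem_nhdsWithin
  obtain ⟨t, ht, ht1 : 1 < t⟩ := h1.exists
  have := (hK.mem_iff _).1 ht
  rw [add_sub_cancel_right, hK.gauge.smul _ _ (by linarith), hx] at this
  linarith

theorem IsStar.mem_frontier {K : Set E} {o : E} {g : E → ℝ} (hK : IsStar K o g) {x : E}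
    (hx : g (x - o) = 1) : x ∈ frontier K :=
  ⟨subset_closure ((hK.mem_iff x).2 hx.le), hK.notMem_interior hx⟩

theorem IsStar.isClosed {K : Set E} {o : E} {g : E → ℝ} (hK : IsStar K o g) : IsClosed K := by
  have : K = {x | g (x - o) ≤ 1} := Set.ext hK.mem_iff
  rw [this]
  exact isClosed_le (hK.gauge.continuous.comp (continuous_id.sub continuous_const))
    continuous_const

/-- A star body is carried to the unit ball of any norm by a homeomorphism of the whole space. -/
theorem IsStar.exists_homeomorph [FiniteDimensional ℝ E] {F : Type*} [NormedAddCommGroup F]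
    [NormedSpace ℝ F] (L : E ≃L[ℝ] F) {K : Set E} {o : E} {g : E → ℝ} (hK : IsStar K o g) :
    ∃ Θ : E ≃ₜ F, ∀ x, ‖Θ x‖ = g (x - o) :=
  ⟨((Homeomorph.subRight o).trans (radialHomeomorph hK.gauge (isGauge_norm_comp L))).trans
    L.toHomeomorph, fun x => gauge_radial hK.gauge (isGauge_norm_comp L) (x - o)⟩

theorem IsStar.nonempty_homeomorph_closedBall [FiniteDimensional ℝ E] {F : Type*}
    [NormedAddCommGroup F] [NormedSpace ℝ F] (L : E ≃L[ℝ] F) {K : Set E} {o : E} {g : E → ℝ}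
    (hK : IsStar K o g) : Nonempty (K ≃ₜ Metric.closedBall (0 : F) 1) := by
  obtain ⟨Θ, hΘ⟩ := hK.exists_homeomorph L
  exact ⟨Θ.subtype fun x => by rw [hK.mem_iff, mem_closedBall_zero_iff, hΘ]⟩

/-- If `Θ` carries `W` to `G ⊆ W` and fixes the points that `W` shares with a closed set `R`, then
`R ∪ W` and `R ∪ G` are homeomorphic. -/
theorem nonempty_homeomorph_union {X : Type*} [TopologicalSpace X] {R W G : Set X}
    (hR : IsClosed R) (hW : IsClosed W) (hG : IsClosed G) (hGW : G ⊆ W) (Θ : X ≃ₜ X)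
    (hΘ : ∀ x, x ∈ W ↔ Θ x ∈ G) (hfix : ∀ x ∈ R, x ∈ W → Θ x = x) :
    Nonempty ((R ∪ W : Set X) ≃ₜ (R ∪ G : Set X)) := by
  classical
  have hfix' : ∀ y ∈ R, y ∈ G → Θ.symm y = y := fun y hy hyG => by
    rw [Θ.symm_apply_eq]; exact (hfix y hy (hGW hyG)).symm
  let f : X → X := fun x => if x ∈ R then x else Θ x
  let k : X → X := fun y => if y ∈ R then y else Θ.symm y
  have fW : ∀ x ∈ W, f x = Θ x := fun x hx => by
    by_cases hxR : x ∈ R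
    · simp [f, hxR, hfix x hxR hx]
    · simp [f, hxR]
  have kG : ∀ y ∈ G, k y = Θ.symm y := fun y hy => by
    by_cases hyR : y ∈ R
    · simp [k, hyR, hfix' y hyR hy]
    · simp [k, hyR]
  have fR : ∀ x ∈ R, f x = x := fun x hx => by simp [f, hx]
  have kR : ∀ x ∈ R, k x = x := fun x hx => by simp [k, hx]
  have hf : ContinuousOn f (R ∪ W) :=
    (continuousOn_id.congr fR).union_of_isClosed (Θ.continuous.continuousOn.congr fW) hR hW
  have hk : ContinuousOn k (R ∪ G) :=
    (continuousOn_id.congr kR).union_of_isClosed (Θ.symm.continuous.continuousOn.congr kG) hR hG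
  have mf : ∀ x ∈ R ∪ W, f x ∈ R ∪ G := by
    rintro x (hx | hx)
    · rw [fR x hx]; exact Or.inl hx
    · rw [fW x hx]; exact Or.inr ((hΘ x).1 hx)
  have mk : ∀ x ∈ R ∪ G, k x ∈ R ∪ W := by
    rintro x (hx | hx)
    · rw [kR x hx]; exact Or.inl hx
    · rw [kG x hx]; exact Or.inr ((hΘ _).2 (by simpa using hx))
  refine ⟨⟨⟨fun x => ⟨f x, mf x x.2⟩, fun y => ⟨k y, mk y y.2⟩, ?_, ?_⟩, ?_, ?_⟩⟩
  · rintro ⟨x, hx | hx⟩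
    · simp [fR x hx, kR x hx]
    · simp [fW x hx, kG _ ((hΘ x).1 hx)]
  · rintro ⟨y, hy | hy⟩
    · simp [kR y hy, fR y hy]
    · have : Θ.symm y ∈ W := (hΘ _).2 (by simpa using hy)
      simp [kG y hy, fW _ this]
  · exact (continuousOn_iff_continuous_domRestrict.1 hf).subtype_mk _
  · exact (continuousOn_iff_continuous_domRestrict.1 hk).subtype_mk _

/-- A star body may be pushed into a smaller one with the same centre, leaving the rest of the body
in place, if the rest touches it only in non-interior points that belong to the smaller one. -/
theorem IsStar.nonempty_homeomorph_push [FiniteDimensional ℝ E] {R W G : Set E} {o : E}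
    {g h : E → ℝ} (hR : IsClosed R) (hW : IsStar W o g) (hG : IsStar G o h) (hGW : G ⊆ W)
    (hRW : ∀ x ∈ R, x ∈ W → x ∈ G ∧ x ∉ interior W) :
    Nonempty ((R ∪ W : Set E) ≃ₜ (R ∪ G : Set E)) := by
  refine nonempty_homeomorph_union hR hW.isClosed hG.isClosed hGW
    (((Homeomorph.subRight o).trans (radialHomeomorph hW.gauge hG.gauge)).trans
      (Homeomorph.addRight o)) (fun x => ?_) (fun x hx hxW => ?_)
  · rw [hW.mem_iff, hG.mem_iff]
    simp [radialHomeomorph, gauge_radial hW.gauge hG.gauge]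
  · have := hW.gauge_eq hG hGW (hRW x hx hxW).1 (hRW x hx hxW).2
    simp [radialHomeomorph, radial_of_eq hG.gauge this]

end Gauge

/-! ### Cells of a cubical neighbourhood -/

/-- The sign `±1` coded by a Boolean. -/
noncomputable def sgn (a : Bool) : ℝ := if a then 1 else -1

@[simp] theorem sgn_true : sgn true = 1 := rfl
@[simp] theorem sgn_false : sgn false = -1 := rfl

theorem sgn_mul_self_mul (a : Bool) (t : ℝ) : sgn a * (sgn a * t) = t := by cases a <;> simp

/-- The part of the cube `[-1, 1]³` below the level `b` in which the coordinates whose sign is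
prescribed by `p` have that sign. -/
def wedge (p : Fin 3 → Option Bool) (b : ℝ) : Set (Fin 3 → ℝ) :=
  {x | (∀ i, ∀ a, p i = some a → 0 ≤ sgn a * x i) ∧ (∀ i, |x i| ≤ 1) ∧ diag x ≤ b}

/-- The part of one of the eight unit cubes around the origin below the level `b`. -/
def cell (s : Signs) (b : ℝ) : Set (Fin 3 → ℝ) := wedge (fun i => some (s i)) b

/-- The part below the level `b` of the union of the unit cubes around the origin in `T`. -/
def part (T : Set Signs) (b : ℝ) : Set (Fin 3 → ℝ) := {x | ∃ s ∈ T, x ∈ cell s b}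

theorem mem_cell {s : Signs} {b : ℝ} {x : Fin 3 → ℝ} :
    x ∈ cell s b ↔ (∀ i, 0 ≤ sgn (s i) * x i) ∧ (∀ i, |x i| ≤ 1) ∧ diag x ≤ b := by
  simp [cell, wedge]

theorem continuous_diag : Continuous diag := by unfold diag; fun_prop

theorem isClosed_wedge (p : Fin 3 → Option Bool) (b : ℝ) : IsClosed (wedge p b) := by
  have : wedge p b = (⋂ i, ⋂ a, ⋂ _ : p i = some a, {x | 0 ≤ sgn a * x i}) ∩
      ((⋂ i, {x | |x i| ≤ 1}) ∩ {x | diag x ≤ b}) := by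
    ext x; simp [wedge]
  rw [this]
  refine IsClosed.inter ?_ (IsClosed.inter ?_ (isClosed_le continuous_diag continuous_const))
  · exact isClosed_iInter fun i => isClosed_iInter fun a => isClosed_iInter fun _ =>
      isClosed_le continuous_const (by fun_prop)
  · exact isClosed_iInter fun i => isClosed_le (by fun_prop) continuous_const

theorem isCompact_wedge (p : Fin 3 → Option Bool) (b : ℝ) : IsCompact (wedge p b) := by
  refine (isCompact_closedBall (0 : Fin 3 → ℝ) 1).of_isClosed_subset (isClosed_wedge p b) ?_
  intro x hx
  rw [mem_closedBall_zero_iff, pi_norm_le_iff_of_nonneg zero_le_one]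
  exact hx.2.1

theorem convex_wedge (p : Fin 3 → Option Bool) (b : ℝ) : Convex ℝ (wedge p b) := by
  intro x hx y hy α β hα hβ hαβ
  refine ⟨fun i a ha => ?_, fun i => ?_, ?_⟩
  · have h1 := mul_nonneg hα (hx.1 i a ha)
    have h2 := mul_nonneg hβ (hy.1 i a ha)
    simp only [Pi.add_apply, Pi.smul_apply, smul_eq_mul]
    linarith
  · have h1 := abs_le.1 (hx.2.1 i)
    have h2 := abs_le.1 (hy.2.1 i)
    simp only [Pi.add_apply, Pi.smul_apply, smul_eq_mul]
    rw [abs_le]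
    constructor <;> nlinarith
  · have h1 := hx.2.2
    have h2 := hy.2.2
    simp only [diag, Pi.add_apply, Pi.smul_apply, smul_eq_mul] at *
    calc _ = α * (x 0 + x 1 + x 2) + β * (y 0 + y 1 + y 2) := by ring
      _ ≤ α * b + β * b := by gcongr
      _ = b := by rw [← add_mul, hαβ, one_mul]

/-- The points `o` in the interior of the cell of `s`. -/
def IsInner (b : ℝ) (s : Signs) (o : Fin 3 → ℝ) : Prop :=
  (∀ i, 0 < sgn (s i) * o i) ∧ (∀ i, |o i| < 1) ∧ diag o < b

/-- Slightly below the level of the vertex every cell but the highest one has interior points. -/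
theorem exists_isInner_of_neg {b : ℝ} (hb : -(1 / 4) < b) {s : Signs} (hs : ∃ i, s i = false) :
    ∃ o, IsInner b s o := by
  refine ⟨fun i => if s i then 1 / 8 else -1 / 2, fun i => ?_, fun i => ?_, ?_⟩
  · cases h : s i <;> simp [h]; norm_num
  · cases h : s i <;> simp [h, abs_lt] <;> norm_num
  · obtain ⟨i, hi⟩ := hs
    have key : ∀ j, (if s j then (1 : ℝ) / 8 else -1 / 2) ≤ 1 / 8 := fun j => by
      split_ifs <;> norm_num
    have h0 := key 0
    have h1 := key 1
    have h2 := key 2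
    have h3 : (if s i then (1 : ℝ) / 8 else -1 / 2) = -1 / 2 := by simp [hi]
    simp only [diag]
    fin_cases i <;> simp only [Fin.zero_eta, Fin.mk_one, Fin.reduceFinMk] at h3 <;> linarith

theorem exists_isInner_of_pos {b : ℝ} (hb : 0 < b) (s : Signs) : ∃ o, IsInner b s o := by
  have hm : 0 < min b 1 := lt_min hb one_pos
  refine ⟨fun i => sgn (s i) * (min b 1 / 6), fun i => ?_, fun i => ?_, ?_⟩
  · rw [sgn_mul_self_mul]; positivity
  · rw [abs_mul, show |sgn (s i)| = 1 by cases s i <;> simp, one_mul, abs_of_pos (by positivity)]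
    linarith [min_le_right b 1]
  · have key : ∀ j, sgn (s j) * (min b 1 / 6) ≤ min b 1 / 6 := fun j => by
      cases s j <;> simp; linarith
    have h0 := key 0
    have h1 := key 1
    have h2 := key 2
    simp only [diag]
    linarith [min_le_left b 1]

theorem IsInner.mem_interior {b : ℝ} {s : Signs} {o : Fin 3 → ℝ} (ho : IsInner b s o)
    {p : Fin 3 → Option Bool} (hp : ∀ i a, p i = some a → s i = a) : o ∈ interior (wedge p b) := by
  refine _root_.mem_interior.2 ⟨{x | (∀ i, 0 < sgn (s i) * x i) ∧ (∀ i, |x i| < 1) ∧ diag x < b},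
    fun x hx => ⟨fun i a ha => hp i a ha ▸ (hx.1 i).le, fun i => (hx.2.1 i).le, hx.2.2.le⟩, ?_, ho⟩
  have : {x : Fin 3 → ℝ | (∀ i, 0 < sgn (s i) * x i) ∧ (∀ i, |x i| < 1) ∧ diag x < b} =
      (⋂ i, {x | 0 < sgn (s i) * x i}) ∩ ((⋂ i, {x | |x i| < 1}) ∩ {x | diag x < b}) := by
    ext x; simp
  rw [this]
  refine IsOpen.inter ?_ (IsOpen.inter ?_ (isOpen_lt continuous_diag continuous_const))
  · exact isOpen_iInter_of_finite fun i => isOpen_lt continuous_const (by fun_prop)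
  · exact isOpen_iInter_of_finite fun i => isOpen_lt (by fun_prop) continuous_const

theorem IsInner.exists_isStar {b : ℝ} {s : Signs} {o : Fin 3 → ℝ} (ho : IsInner b s o)
    {p : Fin 3 → Option Bool} (hp : ∀ i a, p i = some a → s i = a) :
    ∃ g, IsStar (wedge p b) o g :=
  exists_isStar_of_convex (convex_wedge p b) (isCompact_wedge p b) (ho.mem_interior hp)

/-- A wedge is the union of the cells whose signs extend the prescribed ones. -/
theorem mem_wedge_iff {p : Fin 3 → Option Bool} {b : ℝ} {x : Fin 3 → ℝ} :
    x ∈ wedge p b ↔ ∃ s : Signs, (∀ i a, p i = some a → s i = a) ∧ x ∈ cell s b := by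
  constructor
  · intro hx
    refine ⟨fun i => (p i).getD (decide (0 ≤ x i)), fun i a ha => by simp [ha],
      mem_cell.2 ⟨fun i => ?_, hx.2⟩⟩
    cases h : p i with
    | some a => simpa using hx.1 i a h
    | none =>
      by_cases h0 : 0 ≤ x i
      · simp [h0]
      · simpa [h0] using (not_le.1 h0).le
  · rintro ⟨s, hs, hx⟩
    rw [mem_cell] at hx
    exact ⟨fun i a ha => hs i a ha ▸ hx.1 i, hx.2⟩

theorem cell_subset_wedge {p : Fin 3 → Option Bool} {b : ℝ} {s : Signs}
    (hs : ∀ i a, p i = some a → s i = a) : cell s b ⊆ wedge p b :=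
  fun _ hx => mem_wedge_iff.2 ⟨s, hs, hx⟩

/-- The walls of a wedge on the coordinate planes do not meet its interior. -/
theorem notMem_interior_wedge {p : Fin 3 → Option Bool} {b : ℝ} {x : Fin 3 → ℝ} {i : Fin 3}
    {a : Bool} (hp : p i = some a) (hx : x i = 0) : x ∉ interior (wedge p b) := by
  intro hi
  have hc : Tendsto (fun t : ℝ => Function.update x i (-(sgn a * t))) (𝓝[>] 0) (𝓝 x) := by
    have : Continuous fun t : ℝ => Function.update x i (-(sgn a * t)) :=
      continuous_const.update i (by fun_prop)
    have h := (this.tendsto 0).mono_left (nhdsWithin_le_nhds (s := Set.Ioi 0))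
    rwa [mul_zero, neg_zero,
      show Function.update x i 0 = x by rw [← hx, Function.update_eq_self]] at h
  obtain ⟨t, ht, ht0 : 0 < t⟩ :=
    ((hc.eventually (mem_interior_iff_mem_nhds.1 hi)).and self_mem_nhdsWithin).exists
  have := ht.1 i a hp
  rw [Function.update_self, mul_neg, sgn_mul_self_mul] at this
  linarith

theorem eq_zero_of_mem_cell {s r : Signs} {b : ℝ} {x : Fin 3 → ℝ} (hs : x ∈ cell s b)
    (hr : x ∈ cell r b) {i : Fin 3} (h : r i ≠ s i) : x i = 0 := by
  have h1 := (mem_cell.1 hs).1 i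
  have h2 := (mem_cell.1 hr).1 i
  cases h3 : r i <;> cases h4 : s i <;> simp_all <;> linarith

theorem isClosed_part (T : Set Signs) (b : ℝ) : IsClosed (part T b) := by
  have : part T b = ⋃ s ∈ T, cell s b := by ext x; simp [part]
  rw [this]
  exact T.toFinite.isClosed_biUnion fun s _ => isClosed_wedge _ _

theorem isCompact_part (T : Set Signs) (b : ℝ) : IsCompact (part T b) := by
  have : part T b = ⋃ s ∈ T, cell s b := by ext x; simp [part]
  rw [this]
  exact T.toFinite.isCompact_biUnion fun s _ => isCompact_wedge _ _

/-- Below the level of the vertex two cells are disjoint if every sign they share is positive. -/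
theorem disjoint_cell {s r : Signs} {b : ℝ} (hb : b < 0) (h : ∀ i, s i = r i → s i = true)
    {x : Fin 3 → ℝ} (hs : x ∈ cell s b) : x ∉ cell r b := by
  intro hr
  have key : ∀ i, 0 ≤ x i := fun i => by
    by_cases hi : s i = r i
    · simpa [h i hi] using (mem_cell.1 hs).1 i
    · exact (eq_zero_of_mem_cell hs hr (Ne.symm hi)).ge
  have := (mem_cell.1 hs).2.2
  simp only [diag] at this
  linarith [key 0, key 1, key 2]

/-! ### Pushing cells into their neighbours -/

/-- A cell that meets the cells on its side of a coordinate plane in no point can be pushed into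
the neighbouring cell on the other side. -/
theorem nonempty_homeomorph_push_face {T : Set Signs} {b : ℝ} {s : Signs} {k : Fin 3}
    {o : Fin 3 → ℝ} (hs : s ∈ T) (hs' : Function.update s k (!s k) ∈ T)
    (ho : IsInner b (Function.update s k (!s k)) o)
    (h : ∀ r ∈ T, r ≠ s → r k = s k → ∀ x ∈ cell s b, x ∉ cell r b) :
    Nonempty (part T b ≃ₜ part (T \ {s}) b) := by
  set s' := Function.update s k (!s k) with hs'_def
  have hs'k : s' k = !s k := by simp [s']
  have hs'j : ∀ j, j ≠ k → s' j = s j := fun j hj => by simp [s', hj]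
  have hne : s' ≠ s := fun e => by simp [e] at hs'k
  set p : Fin 3 → Option Bool := Function.update (fun i => some (s i)) k none
  have hpk : p k = none := by simp [p]
  have hpj : ∀ j, j ≠ k → p j = some (s j) := fun j hj => by simp [p, hj]
  have hcompat : ∀ r : Signs, (∀ i a, p i = some a → r i = a) ↔ r = s ∨ r = s' := by
    intro r
    constructor
    · intro hr
      have hj : ∀ j, j ≠ k → r j = s j := fun j hj => hr j _ (hpj j hj)
      by_cases hk : r k = s k
      · left; funext j; by_cases e : j = k
        · rw [e, hk]
        · exact hj j e
      · right; funext j; by_cases e : j = k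
        · rw [e, hs'k]; cases h1 : r k <;> cases h2 : s k <;> simp_all
        · rw [hj j e, hs'j j e]
    · rintro (rfl | rfl) i a ha
      · by_cases e : i = k
        · rw [e, hpk] at ha; simp at ha
        · rw [hpj i e] at ha; simpa using ha
      · by_cases e : i = k
        · rw [e, hpk] at ha; simp at ha
        · rw [hpj i e] at ha; rw [hs'j i e]; simpa using ha
  have hWmem : ∀ x, x ∈ wedge p b ↔ x ∈ cell s b ∨ x ∈ cell s' b := fun x => by
    rw [mem_wedge_iff]
    constructor
    · rintro ⟨r, hr, hx⟩
      rcases (hcompat r).1 hr with rfl | rfl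
      exacts [Or.inl hx, Or.inr hx]
    · rintro (hx | hx)
      exacts [⟨s, (hcompat s).2 (Or.inl rfl), hx⟩, ⟨s', (hcompat s').2 (Or.inr rfl), hx⟩]
  set R := part (T \ {s, s'}) b
  have e1 : part T b = R ∪ wedge p b := by
    ext x
    rw [Set.mem_union, hWmem]
    constructor
    · rintro ⟨r, hr, hx⟩
      by_cases h1 : r = s
      · exact Or.inr (Or.inl (h1 ▸ hx))
      by_cases h2 : r = s'
      · exact Or.inr (Or.inr (h2 ▸ hx))
      exact Or.inl ⟨r, ⟨hr, by simp [h1, h2]⟩, hx⟩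
    · rintro (⟨r, hr, hx⟩ | hx | hx)
      exacts [⟨r, hr.1, hx⟩, ⟨s, hs, hx⟩, ⟨s', hs', hx⟩]
  have e2 : part (T \ {s}) b = R ∪ cell s' b := by
    ext x
    constructor
    · rintro ⟨r, hr, hx⟩
      by_cases h2 : r = s'
      · exact Or.inr (h2 ▸ hx)
      exact Or.inl ⟨r, ⟨hr.1, by simpa [h2] using hr.2⟩, hx⟩
    · rintro (⟨r, hr, hx⟩ | hx)
      · exact ⟨r, ⟨hr.1, fun e => hr.2 (Or.inl e)⟩, hx⟩
      · exact ⟨s', ⟨hs', hne⟩, hx⟩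
  obtain ⟨g, hg⟩ := ho.exists_isStar ((hcompat s').2 (Or.inr rfl))
  obtain ⟨g', hg'⟩ := ho.exists_isStar (p := fun i => some (s' i)) (fun i a ha => by simpa using ha)
  rw [e1, e2]
  refine IsStar.nonempty_homeomorph_push (isClosed_part _ _) hg hg'
    (fun x hx => (hWmem x).2 (Or.inr hx)) ?_
  rintro x ⟨r, hr, hxr⟩ hxW
  have hrs : r ≠ s := fun e => hr.2 (Or.inl e)
  have hrs' : r ≠ s' := fun e => hr.2 (Or.inr e)
  obtain ⟨i, hik, hi⟩ : ∃ i, i ≠ k ∧ r i ≠ s i := by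
    by_contra! hcon
    rcases (hcompat r).1 (fun i a ha => by
      by_cases e : i = k
      · rw [e, hpk] at ha; simp at ha
      · rw [hpj i e] at ha; rw [hcon i e]; simpa using ha) with e | e
    exacts [hrs e, hrs' e]
  have hx0 : x i = 0 := by
    rcases (hWmem x).1 hxW with hx | hx
    · exact eq_zero_of_mem_cell hx hxr hi
    · exact eq_zero_of_mem_cell hx hxr (by rwa [hs'j i hik])
  refine ⟨?_, notMem_interior_wedge (hpj i hik) hx0⟩
  rcases (hWmem x).1 hxW with hx | hx
  · have hrk : r k ≠ s k := fun e => h r hr.1 hrs e x hx hxr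
    have hxk : x k = 0 := eq_zero_of_mem_cell hx hxr hrk
    refine mem_cell.2 ⟨fun j => ?_, (mem_cell.1 hx).2⟩
    by_cases e : j = k
    · rw [e, hxk]; simp
    · rw [hs'j j e]; exact (mem_cell.1 hx).1 j
  · exact hx

/-- If the four cells on one side of a coordinate plane are present and the neighbour of one of them
across that plane is not, then this one can be pushed into the other three. -/
theorem nonempty_homeomorph_push_edge {T : Set Signs} {b : ℝ} {s c : Signs} {i j k : Fin 3}
    {o : Fin 3 → ℝ} (hij : i ≠ j) (hik : i ≠ k) (hjk : j ≠ k) (hall : ∀ l, l = i ∨ l = j ∨ l = k)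
    (hT : ∀ r : Signs, r i = s i → r ∈ T) (hs' : Function.update s i (!s i) ∉ T)
    (hci : c i = s i) (hcj : c j = !s j) (hck : c k = !s k) (ho : IsInner b c o) :
    Nonempty (part T b ≃ₜ part (T \ {s}) b) := by
  classical
  set p : Fin 3 → Option Bool := fun l => if l = i then some (s i) else none with hp
  set q : Fin 3 → Fin 3 → Option Bool :=
    fun m l => if l = i then some (s i) else if l = m then some (!s m) else none with hq
  have hpc : ∀ r : Signs, (∀ l a, p l = some a → r l = a) ↔ r i = s i := fun r => by
    constructor
    · intro h; exact h i _ (by simp [p])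
    · intro h l a ha
      by_cases e : l = i
      · subst e; simp only [p, if_true, Option.some.injEq] at ha; rw [h, ha]
      · simp [p, e] at ha
  have hqc : ∀ m, m ≠ i → ∀ r : Signs,
      (∀ l a, q m l = some a → r l = a) ↔ r i = s i ∧ r m ≠ s m := fun m hm r => by
    constructor
    · intro h
      refine ⟨h i _ (by simp [q]), ?_⟩
      rw [h m (!s m) (by simp [q, hm])]; simp
    · rintro ⟨h1, h2⟩ l a ha
      by_cases e : l = i
      · subst e; simp only [q, if_true, Option.some.injEq] at ha; rw [h1, ha]
      by_cases e' : l = m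
      · subst e'; simp only [q, e, if_true, if_false, Option.some.injEq] at ha
        rw [← ha]; cases h3 : r l <;> cases h4 : s l <;> simp_all
      · simp [q, e, e'] at ha
  set R := part {r | r ∈ T ∧ r i ≠ s i} b
  have e1 : part T b = R ∪ wedge p b := by
    ext x
    constructor
    · rintro ⟨r, hr, hx⟩
      by_cases h : r i = s i
      · exact Or.inr (cell_subset_wedge ((hpc r).2 h) hx)
      · exact Or.inl ⟨r, ⟨hr, h⟩, hx⟩
    · rintro (⟨r, hr, hx⟩ | hx)
      · exact ⟨r, hr.1, hx⟩
      · obtain ⟨r, hr, hx⟩ := mem_wedge_iff.1 hx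
        exact ⟨r, hT r ((hpc r).1 hr), hx⟩
  have e2 : part (T \ {s}) b = R ∪ (wedge (q j) b ∪ wedge (q k) b) := by
    ext x
    constructor
    · rintro ⟨r, hr, hx⟩
      by_cases h : r i = s i
      · by_cases hj : r j = s j
        · have hk : r k ≠ s k := fun hk => hr.2 <| by
            funext l; rcases hall l with rfl | rfl | rfl <;> assumption
          exact Or.inr (Or.inr (cell_subset_wedge ((hqc k hik.symm r).2 ⟨h, hk⟩) hx))
        · exact Or.inr (Or.inl (cell_subset_wedge ((hqc j hij.symm r).2 ⟨h, hj⟩) hx))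
      · exact Or.inl ⟨r, ⟨hr.1, h⟩, hx⟩
    · rintro (⟨r, hr, hx⟩ | hx | hx)
      · exact ⟨r, ⟨hr.1, fun e => hr.2 (congrFun e i)⟩, hx⟩
      · obtain ⟨r, hr, hx⟩ := mem_wedge_iff.1 hx
        have := (hqc j hij.symm r).1 hr
        exact ⟨r, ⟨hT r this.1, fun e => this.2 (congrFun e j)⟩, hx⟩
      · obtain ⟨r, hr, hx⟩ := mem_wedge_iff.1 hx
        have := (hqc k hik.symm r).1 hr
        exact ⟨r, ⟨hT r this.1, fun e => this.2 (congrFun e k)⟩, hx⟩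
  obtain ⟨g, hg⟩ := ho.exists_isStar ((hpc c).2 hci)
  obtain ⟨g₁, hg₁⟩ := ho.exists_isStar ((hqc j hij.symm c).2 ⟨hci, by simp [hcj]⟩)
  obtain ⟨g₂, hg₂⟩ := ho.exists_isStar ((hqc k hik.symm c).2 ⟨hci, by simp [hck]⟩)
  rw [e1, e2]
  refine IsStar.nonempty_homeomorph_push (isClosed_part _ _) hg (hg₁.union hg₂) ?_ ?_
  · rintro x (hx | hx)
    · obtain ⟨r, hr, hx⟩ := mem_wedge_iff.1 hx
      exact cell_subset_wedge ((hpc r).2 ((hqc j hij.symm r).1 hr).1) hx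
    · obtain ⟨r, hr, hx⟩ := mem_wedge_iff.1 hx
      exact cell_subset_wedge ((hpc r).2 ((hqc k hik.symm r).1 hr).1) hx
  rintro x ⟨r, ⟨hrT, hri⟩, hxr⟩ hxW
  have hx0 : x i = 0 := by
    obtain ⟨t, ht, hx⟩ := mem_wedge_iff.1 hxW
    exact eq_zero_of_mem_cell hx hxr (by rwa [(hpc t).1 ht])
  refine ⟨?_, notMem_interior_wedge (i := i) (a := s i) (by simp [p]) hx0⟩
  -- the reflection of `r` in the plane contains `x` too
  have hxr' : x ∈ cell (Function.update r i (s i)) b := by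
    refine mem_cell.2 ⟨fun l => ?_, (mem_cell.1 hxr).2⟩
    by_cases e : l = i
    · rw [e, hx0]; simp
    · simpa [e] using (mem_cell.1 hxr).1 l
  by_cases hj : r j = s j
  · have hk : r k ≠ s k := fun hk => hs' <| by
      convert hrT using 1
      funext l
      rcases hall l with rfl | rfl | rfl
      · cases h3 : r l <;> cases h4 : s l <;> simp_all
      · simp [hij.symm, hj]
      · simp [hik.symm, hk]
    exact Or.inr (cell_subset_wedge ((hqc k hik.symm _).2 ⟨by simp, by simpa [hik.symm] using hk⟩)
      hxr')
  · exact Or.inl (cell_subset_wedge ((hqc j hij.symm _).2 ⟨by simp, by simpa [hij.symm] using hj⟩)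
      hxr')

/-! ### Collapsing a configuration of cells to one cell -/

/-- The cell with number `i < 8`: its `j`-th sign is `+` if the `j`-th bit of `i` is `1`. -/
def signs (i : ℕ) : Signs := fun j => i.testBit j

/-- The number of a cell. -/
def number (s : Signs) : ℕ := (s 0).toNat + 2 * (s 1).toNat + 4 * (s 2).toNat

/-- The configuration of cells coded by the bits of `n < 256`. -/
def config (n : ℕ) : Set Signs := {s | n.testBit (number s) = true}

/-- The cell `i` of the configuration `n` may be pushed across the `k`-th coordinate plane. If `neg`
is set, cells that share positive signs only count as disjoint. -/
def canPushFace (neg : Bool) (n i k : ℕ) : Bool :=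
  n.testBit (i ^^^ 2 ^ k) && (List.range 8).all fun r =>
    !n.testBit r || r == i || (r.testBit k != i.testBit k) || (neg && (i ||| r) == 7)

/-- The cell `i` of the configuration `n` may be pushed into the three other cells on its side of
the `k`-th coordinate plane. -/
def canPushEdge (n i k : ℕ) : Bool :=
  !n.testBit (i ^^^ 2 ^ k) && (List.range 8).all fun r =>
    (r.testBit k != i.testBit k) || n.testBit r

/-- Some sequence of at most `m` pushes leads from the configuration `n` to a single cell. -/
def collapsible (neg : Bool) : ℕ → ℕ → Bool
  | 0, n => (List.range 8).any fun i => n == 2 ^ i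
  | m + 1, n => ((List.range 8).any fun i => n == 2 ^ i) ||
      (List.range 8).any fun i => n.testBit i && (List.range 3).any fun k =>
        (canPushFace neg n i k || canPushEdge n i k) && collapsible neg m (n ^^^ 2 ^ i)

theorem signs_number (s : Signs) : signs (number s) = s := by
  revert s; decide

theorem number_lt (s : Signs) : number s < 8 := by
  revert s; decide

theorem exists_signs_eq_false : ∀ i < 8, i ≠ 7 → ∃ j, signs i j = false := by
  decide

theorem exists_other_axes (k : Fin 3) : ∃ l m : Fin 3, k ≠ l ∧ k ≠ m ∧ l ≠ m ∧
    ∀ t, t = k ∨ t = l ∨ t = m := by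
  revert k; decide

theorem number_signs {i : ℕ} (hi : i < 8) : number (signs i) = i := by
  revert i; decide

theorem signs_mem_config {n i : ℕ} (hi : i < 8) : signs i ∈ config n ↔ n.testBit i = true := by
  rw [config, Set.mem_ofPred_eq, number_signs hi]

theorem eq_signs_iff {i : ℕ} (hi : i < 8) {s : Signs} : s = signs i ↔ number s = i :=
  ⟨fun h => h ▸ number_signs hi, fun h => h ▸ (signs_number s).symm⟩

theorem config_two_pow {i : ℕ} (hi : i < 8) : config (2 ^ i) = {signs i} := by
  ext s
  rw [config, Set.mem_ofPred_eq, Set.mem_singleton_iff, eq_signs_iff hi, Nat.testBit_two_pow,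
    decide_eq_true_iff, eq_comm]

theorem config_xor {n i : ℕ} (hi : i < 8) (h : n.testBit i = true) :
    config (n ^^^ 2 ^ i) = config n \ {signs i} := by
  ext s
  rw [Set.mem_sdiff, Set.mem_singleton_iff, eq_signs_iff hi, config, config, Set.mem_ofPred_eq,
    Set.mem_ofPred_eq, Nat.testBit_xor, Nat.testBit_two_pow]
  by_cases e : i = number s
  · simp [e.symm, h]
  · simp [e, Ne.symm e]

/-- In the codes, crossing the `k`-th coordinate plane is the flip of the `k`-th bit. -/
theorem signs_xor (i : ℕ) (k : Fin 3) :
    signs (i ^^^ 2 ^ (k : ℕ)) = Function.update (signs i) k (!signs i k) := by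
  funext j
  by_cases e : j = k
  · subst e; simp [signs, Nat.testBit_xor]
  · have : (k : ℕ) ≠ j := fun h => e (Fin.ext h.symm)
    simp [signs, Nat.testBit_xor, e, this]

theorem xor_two_pow_lt {i k : ℕ} (hi : i < 8) (hk : k < 3) : i ^^^ 2 ^ k < 8 :=
  Nat.xor_lt_two_pow (n := 3) hi (Nat.pow_lt_pow_right (by norm_num) hk)

theorem exists_config_eq (T : Set Signs) : ∃ n < 256, config n = T := by
  classical
  refine ⟨Nat.ofBits fun i : Fin 8 => decide (signs i ∈ T), Nat.ofBits_lt_two_pow _, ?_⟩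
  ext s
  rw [config, Set.mem_ofPred_eq, Nat.testBit_ofBits_lt _ _ (number_lt s)]
  simp [signs_number]

theorem part_singleton (s : Signs) (b : ℝ) : part {s} b = cell s b := by
  ext x; simp [part]

/-- The level `b` is close to that of the vertex, and below it only if the last cell, which lies
above the vertex, is absent. -/
def Admissible (neg : Bool) (b : ℝ) (n : ℕ) : Prop :=
  if neg then -(1 / 4) < b ∧ b < 0 ∧ n.testBit 7 = false else 0 < b

theorem Admissible.exists_isInner {neg : Bool} {b : ℝ} {n : ℕ} (h : Admissible neg b n) {i : ℕ}
    (hi : i < 8) (hn : n.testBit i = true) : ∃ o, IsInner b (signs i) o := by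
  cases neg with
  | false => exact exists_isInner_of_pos (by simpa [Admissible] using h) _
  | true =>
    obtain ⟨h1, -, h3⟩ : -(1 / 4) < b ∧ b < 0 ∧ n.testBit 7 = false := by
      simpa [Admissible] using h
    refine exists_isInner_of_neg h1 ?_
    have h7 : i ≠ 7 := fun e => by simp [e, h3] at hn
    exact exists_signs_eq_false i hi h7

theorem nonempty_homeomorph_of_canPushFace {neg : Bool} {b : ℝ} {n i : ℕ}
    (h : Admissible neg b n) (hi : i < 8) (hn : n.testBit i = true) {k : Fin 3}
    (hp : canPushFace neg n i k = true) :
    Nonempty (part (config n) b ≃ₜ part (config (n ^^^ 2 ^ i)) b) := by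
  rw [canPushFace, Bool.and_eq_true, List.all_eq_true] at hp
  obtain ⟨h1, h2⟩ := hp
  have hlt := xor_two_pow_lt hi k.2
  obtain ⟨o, ho⟩ := h.exists_isInner hlt h1
  rw [signs_xor] at ho
  rw [config_xor hi hn]
  refine nonempty_homeomorph_push_face (k := k) ((signs_mem_config hi).2 hn) ?_ ho ?_
  · rw [← signs_xor]
    exact (signs_mem_config hlt).2 h1
  · intro r hr hrs hrk x hx
    have h3 := h2 (number r) (List.mem_range.2 (number_lt r))
    have hr' : n.testBit (number r) = true := hr
    have hne : number r ≠ i := fun e => hrs ((eq_signs_iff hi).2 e)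
    have hk : (number r).testBit k = i.testBit k := by
      have := congrFun (signs_number r) k
      simp only [signs] at this hrk
      rw [this, hrk]
    simp only [hr', hk, Bool.not_true, Bool.false_or, bne_self_eq_false, Bool.or_false,
      Bool.or_eq_true, beq_iff_eq, hne, false_or, Bool.and_eq_true] at h3
    obtain ⟨rfl, h7⟩ := h3
    obtain ⟨-, hb, -⟩ : -(1 / 4) < b ∧ b < 0 ∧ n.testBit 7 = false := by
      simpa [Admissible] using h
    refine disjoint_cell hb (fun j hj => ?_) hx
    have h8 : (i ||| number r).testBit j = true := by
      rw [h7]; fin_cases j <;> rfl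
    have := congrFun (signs_number r) j
    rw [← hj] at this
    simp only [signs] at this ⊢
    rw [Nat.testBit_or, this, Bool.or_self] at h8
    exact h8

theorem nonempty_homeomorph_of_canPushEdge {neg : Bool} {b : ℝ} {n i : ℕ}
    (h : Admissible neg b n) (hi : i < 8) (hn : n.testBit i = true) {k : Fin 3}
    (hp : canPushEdge n i k = true) :
    Nonempty (part (config n) b ≃ₜ part (config (n ^^^ 2 ^ i)) b) := by
  rw [canPushEdge, Bool.and_eq_true, List.all_eq_true] at hp
  obtain ⟨h1, h2⟩ := hp
  have hT : ∀ r : Signs, r k = signs i k → r ∈ config n := fun r hr => by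
    have h3 := h2 (number r) (List.mem_range.2 (number_lt r))
    have := congrFun (signs_number r) k
    simp only [signs] at this hr
    rw [this, hr] at h3
    rw [config, Set.mem_ofPred_eq]
    simpa using h3
  obtain ⟨l, m, hkl, hkm, hlm, hall⟩ := exists_other_axes k
  set c : Signs := Function.update (Function.update (signs i) l (!signs i l)) m (!signs i m)
  have hck : c k = signs i k := by simp [c, hkl, hkm]
  obtain ⟨o, ho⟩ := h.exists_isInner (number_lt c) (hT c hck)
  rw [signs_number] at ho
  rw [config_xor hi hn]
  refine nonempty_homeomorph_push_edge hkl hkm hlm hall hT ?_ hck ?_ ?_ ho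
  · rw [← signs_xor, signs_mem_config (xor_two_pow_lt hi k.2)]
    simpa using h1
  · simp [c, hlm]
  · simp [c]

/-- A collapsible configuration is a ball. -/
theorem nonempty_homeomorph_of_collapsible {F : Type*} [NormedAddCommGroup F] [NormedSpace ℝ F]
    (L : (Fin 3 → ℝ) ≃L[ℝ] F) {neg : Bool} {b : ℝ} {m n : ℕ} (h : Admissible neg b n)
    (hc : collapsible neg m n = true) :
    Nonempty (part (config n) b ≃ₜ Metric.closedBall (0 : F) 1) := by
  have single : ∀ n, Admissible neg b n → ((List.range 8).any fun i => n == 2 ^ i) = true →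
      Nonempty (part (config n) b ≃ₜ Metric.closedBall (0 : F) 1) := by
    intro n h h1
    obtain ⟨i, hi, hn⟩ := List.any_eq_true.1 h1
    rw [List.mem_range] at hi
    rw [beq_iff_eq] at hn
    obtain ⟨o, ho⟩ := h.exists_isInner hi (by rw [hn]; simp)
    obtain ⟨g, hg⟩ := ho.exists_isStar (p := fun j => some (signs i j)) (by simp)
    rw [hn, config_two_pow hi, part_singleton]
    exact hg.nonempty_homeomorph_closedBall L
  induction m generalizing n with
  | zero => exact single n h hc
  | succ m ih =>
    rw [collapsible, Bool.or_eq_true] at hc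
    rcases hc with hc | hc
    · exact single n h hc
    obtain ⟨i, hi, hc⟩ := List.any_eq_true.1 hc
    rw [List.mem_range] at hi
    rw [Bool.and_eq_true] at hc
    obtain ⟨hn, hc⟩ := hc
    obtain ⟨k, hk, hc⟩ := List.any_eq_true.1 hc
    rw [List.mem_range] at hk
    rw [Bool.and_eq_true, Bool.or_eq_true] at hc
    have h' : Admissible neg b (n ^^^ 2 ^ i) := by
      cases neg with
      | false => exact h
      | true =>
        have h0 : -(1 / 4) < b ∧ b < 0 ∧ n.testBit 7 = false := by simpa [Admissible] using h
        have h7 : i ≠ 7 := fun e => by simp [e, h0.2.2] at hn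
        simpa [Admissible, Nat.testBit_xor, Nat.testBit_two_pow, h7, h0.2.2] using
          (⟨h0.1, h0.2.1⟩ : -(1 / 4) < b ∧ b < 0)
    obtain ⟨e'⟩ := ih h' hc.2
    rcases hc.1 with hp | hp
    · obtain ⟨e⟩ := nonempty_homeomorph_of_canPushFace h hi hn (k := ⟨k, hk⟩) hp
      exact ⟨e.trans e'⟩
    · obtain ⟨e⟩ := nonempty_homeomorph_of_canPushEdge h hi hn (k := ⟨k, hk⟩) hp
      exact ⟨e.trans e'⟩

/-- The configurations of the fifteen types. -/
def typeCode : Fin 15 → ℕ :=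
  ![128, 254, 224, 168, 200, 248, 234, 236, 226, 172, 216, 228, 184, 202, 232]

/-- The conditions of an unstacked body, at a vertex with the configuration `n`. -/
def unstacked (n : ℕ) : Bool :=
  ((List.range 8).all fun i => (List.range 3).all fun k => (List.range 3).all fun l =>
    k == l || !n.testBit i || !n.testBit (i ^^^ 2 ^ k ^^^ 2 ^ l) || n.testBit (i ^^^ 2 ^ k) ||
      n.testBit (i ^^^ 2 ^ l)) &&
  (List.range 8).all fun i => n != 2 ^ i + 2 ^ (7 - i) && n + 2 ^ i + 2 ^ (7 - i) != 255

/-- Above the level of the vertex every unstacked configuration collapses. The configuration `255`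
of all cells is an exception, because no single cell of it can be pushed; it is convex. -/
theorem collapsible_of_unstacked : ∀ n < 255, n ≠ 0 → unstacked n = true →
    collapsible false 7 n = true := by
  decide +kernel

/-- Below the level of the vertex the highest cell is empty, so `n` is reduced modulo `2 ^ 7`. The
unstacked configurations that do not collapse then are exactly those of the fifteen types. -/
theorem collapsible_of_unstacked_of_ne : ∀ n < 256, n ≠ 0 → unstacked n = true →
    (∀ k, n ≠ typeCode k) → collapsible true 7 (n % 128) = true := by
  decide +kernel

theorem typeCode_testBit : ∀ (k : Fin 15) (s : Signs),
    (typeCode k).testBit (number s) = true ↔ entry k s = 1 := by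
  decide +kernel

/-! ### Attaching handles -/

/-- Handles may be attached in any Hausdorff model `Z` of `Y`; as the pieces are compact, the maps
to `Z` only have to be continuous and injective. -/
theorem attachesHandles_of_homeomorph {Z : Type*} [TopologicalSpace Z] [T2Space Z] {n i : ℕ}
    {X Y : Set (Fin 3 → ℝ)} (hX : IsCompact X) (e : Y ≃ₜ Z) (h : X → Z)
    (g : Fin n × (Disk i × Disk (3 - i)) → Z) (hc : Continuous h) (hi : Function.Injective h)
    (gc : Continuous g) (gi : Function.Injective g)
    (cover : ∀ z, z ∈ Set.range h ∨ z ∈ Set.range g)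
    (overlap : ∀ p, g p ∈ Set.range h ↔ ‖(p.2.1 : EuclideanSpace ℝ (Fin i))‖ = 1)
    (bdry : ∀ x, h x ∈ Set.range g → (x : Fin 3 → ℝ) ∈ frontier X) :
    AttachesHandles n i X Y := by
  have : CompactSpace X := isCompact_iff_compactSpace.1 hX
  have hm : ∀ {α : Type} (k : α → Z) (z : Z), e.symm z ∈ Set.range (e.symm ∘ k) ↔ z ∈ Set.range k :=
    fun k z => by simp
  refine ⟨e.symm ∘ h, e.symm ∘ g, (e.symm.continuous.comp hc).isClosedEmbedding
    (e.symm.injective.comp hi), (e.symm.continuous.comp gc).isClosedEmbedding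
    (e.symm.injective.comp gi), ?_, fun p => ?_, fun x hx => ?_⟩
  · refine Set.eq_univ_of_forall fun y => ?_
    obtain ⟨z, rfl⟩ := e.symm.surjective y
    exact (cover z).imp (hm h z).2 (hm g z).2
  · exact (hm h (g p)).trans (overlap p)
  · exact bdry x ((hm g (h x)).1 hx)

/-- A ball is obtained from the empty set by attaching a handle of index `0`. -/
theorem attachesHandles_zero {Y : Set (Fin 3 → ℝ)}
    (hY : Nonempty (Y ≃ₜ Metric.closedBall (0 : EuclideanSpace ℝ (Fin 3)) 1)) :
    AttachesHandles 1 0 ∅ Y := by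
  obtain ⟨e⟩ := hY
  refine attachesHandles_of_homeomorph isCompact_empty e (fun x => x.2.elim)
    (fun p => (p.2.2 : Disk 3)) ?_ ?_ (by fun_prop) ?_ ?_ ?_ ?_
  · exact continuous_of_const fun x => x.2.elim
  · exact fun x => x.2.elim
  · rintro ⟨a, u, d⟩ ⟨a', u', d'⟩ h
    exact Prod.ext (Subsingleton.elim _ _) (Prod.ext (Subsingleton.elim _ _) h)
  · exact fun z => Or.inr ⟨(0, ⟨0, by simp⟩, z), rfl⟩
  · intro p
    constructor
    · rintro ⟨x, -⟩
      exact x.2.elim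
    · intro hp
      rw [Subsingleton.elim (p.2.1 : EuclideanSpace ℝ (Fin 0)) 0] at hp
      simp at hp
  · exact fun x => x.2.elim

theorem mem_frontier_iUnion {ι E : Type*} [Finite ι] [TopologicalSpace E] {K : ι → Set E}
    (hK : ∀ i, IsClosed (K i)) (hd : ∀ i j, i ≠ j → ∀ x ∈ K i, x ∉ K j) {i : ι} {x : E}
    (hx : x ∈ frontier (K i)) : x ∈ frontier (⋃ i, K i) := by
  have hxK : x ∈ K i := (hK i).frontier_subset hx
  refine ⟨subset_closure (Set.mem_iUnion.2 ⟨i, hxK⟩), fun hi => hx.2 ?_⟩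
  have hcl : IsClosed (⋃ j ∈ {j | j ≠ i}, K j) :=
    (Set.toFinite _).isClosed_biUnion fun j _ => hK j
  have hn : x ∈ (⋃ j ∈ {j | j ≠ i}, K j)ᶜ := by
    simp only [Set.mem_compl_iff, Set.mem_iUnion, not_exists]
    exact fun j hj => hd i j (Ne.symm hj) x hxK
  rw [mem_interior_iff_mem_nhds] at hi ⊢
  filter_upwards [hi, hcl.isOpen_compl.mem_nhds hn] with y hy hy'
  obtain ⟨j, hj⟩ := Set.mem_iUnion.1 hy
  by_cases e : j = i
  · exact e ▸ hj
  · exact absurd (Set.mem_biUnion (show j ∈ {j | j ≠ i} from e) hj) hy'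

theorem norm_euclideanSpace_one (u : EuclideanSpace ℝ (Fin 1)) : ‖u‖ = |u 0| := by
  rw [EuclideanSpace.norm_eq, Fin.sum_univ_one, Real.sqrt_sq_eq_abs, Real.norm_eq_abs, abs_abs]

theorem euclideanSpace_one_ext {u v : EuclideanSpace ℝ (Fin 1)} (h : u 0 = v 0) : u = v := by
  ext i; rwa [Subsingleton.elim i 0]

/-- The interval `[-1, 4 n + 1]` is cut into intervals of length `2` with the midpoints `4 i` and
`4 j + 2`. -/
theorem exists_slab {n : ℕ} {t : ℝ} (h0 : -1 ≤ t) (h1 : t ≤ 4 * n + 1) :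
    (∃ i : Fin (n + 1), |t - 4 * (i : ℕ)| ≤ 1) ∨ ∃ j : Fin n, |t - 4 * (j : ℕ) - 2| ≤ 1 := by
  induction n with
  | zero => exact Or.inl ⟨0, by rw [abs_le]; constructor <;> norm_num at * <;> linarith⟩
  | succ n ih =>
    rcases le_total t (4 * n + 1) with h | h
    · rcases ih h with ⟨i, hi⟩ | ⟨j, hj⟩
      · exact Or.inl ⟨i.castSucc, by simpa using hi⟩
      · exact Or.inr ⟨j.castSucc, by simpa using hj⟩
    · push_cast at h1
      rcases le_total t (4 * n + 3) with h' | h'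
      · exact Or.inr ⟨Fin.last n, by rw [abs_le, Fin.val_last]; constructor <;> linarith⟩
      · exact Or.inl ⟨Fin.last (n + 1), by
          rw [abs_le, Fin.val_last]; push_cast; constructor <;> linarith⟩

/-- The cylinder over the two-dimensional disc, as the unit ball of a product. -/
abbrev Cylinder : Type := Metric.closedBall (0 : ℝ × EuclideanSpace ℝ (Fin 2)) 1

theorem mem_cylinder {q : ℝ × EuclideanSpace ℝ (Fin 2)} :
    q ∈ Metric.closedBall (0 : ℝ × EuclideanSpace ℝ (Fin 2)) 1 ↔ |q.1| ≤ 1 ∧ ‖q.2‖ ≤ 1 := by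
  rw [mem_closedBall_zero_iff, Prod.norm_def, max_le_iff, Real.norm_eq_abs]

/-- A linear identification of space with the product that contains the cylinder. -/
noncomputable def toCylinder : (Fin 3 → ℝ) ≃L[ℝ] ℝ × EuclideanSpace ℝ (Fin 2) :=
  ContinuousLinearEquiv.ofFinrankEq (by simp)

/-- Attaching `n` handles of index `1` to `n + 1` disjoint star bodies, in a chain, yields a ball: a
long cylinder is cut into `2 n + 1` slabs, which are alternately star bodies and handles. -/
theorem attachesHandles_chain {n : ℕ} {Y : Set (Fin 3 → ℝ)} {K : Fin (n + 1) → Set (Fin 3 → ℝ)}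
    (hK : ∀ i, ∃ o g, IsStar (K i) o g) (hd : ∀ i j, i ≠ j → ∀ x ∈ K i, x ∉ K j)
    (hY : Nonempty (Y ≃ₜ Cylinder)) : AttachesHandles n 1 (⋃ i, K i) Y := by
  classical
  obtain ⟨e⟩ := hY
  choose o g hK using hK
  choose Θ hΘ using fun i => (hK i).exists_homeomorph toCylinder
  have hcl : ∀ i, IsClosed (K i) := fun i => (hK i).isClosed
  have hmem : ∀ i x, x ∈ K i ↔ |(Θ i x).1| ≤ 1 ∧ ‖(Θ i x).2‖ ≤ 1 := fun i x => by
    rw [(hK i).mem_iff, ← hΘ, ← mem_cylinder, mem_closedBall_zero_iff]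
  have hKc : ∀ i, IsCompact (K i) := fun i => by
    have : K i = Θ i ⁻¹' Metric.closedBall 0 1 := by
      ext x; rw [hmem, Set.mem_preimage, mem_cylinder]
    rw [this, (Θ i).isCompact_preimage]
    exact isCompact_closedBall _ _
  set N : ℝ := 2 * n + 1
  have hN : 0 < N := by positivity
  -- the long cylinder `[-1, 4 n + 1] × D²` is rescaled to the standard one
  let σ : ℝ × EuclideanSpace ℝ (Fin 2) → ℝ × EuclideanSpace ℝ (Fin 2) :=
    fun q => ((q.1 + 1) / N - 1, q.2)
  have σc : Continuous σ := by fun_prop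
  have σi : Function.Injective σ := by
    rintro ⟨a, d⟩ ⟨a', d'⟩ h
    simp only [σ, Prod.mk.injEq, sub_left_inj] at h
    rw [div_left_inj' hN.ne'] at h
    exact Prod.ext (by linarith [h.1]) h.2
  have σm : ∀ q : ℝ × EuclideanSpace ℝ (Fin 2), -1 ≤ q.1 → q.1 ≤ 4 * n + 1 → ‖q.2‖ ≤ 1 →
      σ q ∈ Metric.closedBall (0 : ℝ × EuclideanSpace ℝ (Fin 2)) 1 := fun q h0 h1 h2 => by
    rw [mem_cylinder]
    refine ⟨?_, h2⟩
    have h3 : 0 ≤ (q.1 + 1) / N := div_nonneg (by linarith) hN.le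
    have h4 : (q.1 + 1) / N ≤ 2 := by rw [div_le_iff₀ hN]; simp only [N]; linarith
    simp only [σ]
    rw [abs_le]; constructor <;> linarith
  have hFin : ∀ m (i : Fin m), ((i : ℕ) : ℝ) ≤ m - 1 := fun m i => by
    have : ((i : ℕ) : ℝ) + 1 ≤ m := by exact_mod_cast i.2
    linarith
  let P : Fin (n + 1) → (Fin 3 → ℝ) → ℝ × EuclideanSpace ℝ (Fin 2) :=
    fun i x => (4 * (i : ℕ) + (Θ i x).1, (Θ i x).2)
  have Pc : ∀ i, Continuous (P i) := fun i => by
    have := (Θ i).continuous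
    fun_prop
  let H : (Fin 3 → ℝ) → ℝ × EuclideanSpace ℝ (Fin 2) :=
    fun x => if hx : ∃ i, x ∈ K i then σ (P hx.choose x) else 0
  have HK : ∀ i, ∀ x ∈ K i, H x = σ (P i x) := fun i x hx => by
    have hex : ∃ i, x ∈ K i := ⟨i, hx⟩
    have : hex.choose = i := by
      by_contra hne
      exact hd _ _ hne x hex.choose_spec hx
    simp only [H, dif_pos hex, this]
  have Hc : ContinuousOn H (⋃ i, K i) :=
    (locallyFinite_of_finite K).continuousOn_iUnion hcl fun i =>
      ((σc.comp (Pc i)).continuousOn).congr (HK i)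
  have Hm : ∀ x ∈ ⋃ i, K i, H x ∈ Metric.closedBall (0 : ℝ × EuclideanSpace ℝ (Fin 2)) 1 := by
    intro x hx
    obtain ⟨i, hi⟩ := Set.mem_iUnion.1 hx
    rw [HK i x hi]
    have h1 := (hmem i x).1 hi
    have h2 := abs_le.1 h1.1
    have h3 := hFin _ i
    push_cast at h3
    have h4 : (0 : ℝ) ≤ (i : ℕ) := by positivity
    exact σm _ (by simp only [P]; linarith) (by simp only [P]; linarith) h1.2
  let G : Fin n × (Disk 1 × Disk 2) → ℝ × EuclideanSpace ℝ (Fin 2) :=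
    fun p => σ (4 * ((p.1 : ℕ) : ℝ) + 2 + (p.2.1 : EuclideanSpace ℝ (Fin 1)) 0, p.2.2)
  have hu : ∀ u : Disk 1, |(u : EuclideanSpace ℝ (Fin 1)) 0| ≤ 1 := fun u => by
    rw [← norm_euclideanSpace_one]; exact mem_closedBall_zero_iff.1 u.2
  have Gm : ∀ p, G p ∈ Metric.closedBall (0 : ℝ × EuclideanSpace ℝ (Fin 2)) 1 := fun p => by
    have h2 := abs_le.1 (hu p.2.1)
    have h3 := hFin _ p.1
    have h4 : (0 : ℝ) ≤ (p.1 : ℕ) := by positivity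
    exact σm _ (by dsimp only; linarith) (by dsimp only; linarith)
      (mem_closedBall_zero_iff.1 p.2.2.2)
  have Gc : Continuous G := by
    refine σc.comp ?_
    have : Continuous fun p : Fin n × (Disk 1 × Disk 2) => ((p.1 : ℕ) : ℝ) :=
      (continuous_of_discreteTopology (f := fun i : Fin n => ((i : ℕ) : ℝ))).comp continuous_fst
    fun_prop
  -- two of the integers that number the slabs coincide if the slabs overlap too much
  have hint : ∀ a b : ℕ, |(4 * a : ℝ) - 4 * b| < 4 → a = b := fun a b h => by
    have h' : |((a : ℤ) : ℝ) - ((b : ℤ) : ℝ)| < 1 := by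
      rw [← mul_sub, abs_mul, abs_of_pos (by norm_num : (0 : ℝ) < 4)] at h
      push_cast; linarith
    have : |(a : ℤ) - b| < 1 := by exact_mod_cast h'
    rw [Int.abs_lt_one_iff] at this
    omega
  -- where a handle meets a star body, both are at the end of their slabs
  have hGH : ∀ p i x, x ∈ K i → G p = σ (P i x) →
      |(p.2.1 : EuclideanSpace ℝ (Fin 1)) 0| = 1 ∧ |(Θ i x).1| = 1 := by
    intro p i x hx h
    have h1 := congrArg Prod.fst (σi h)
    simp only [P] at h1
    have h2 := abs_le.1 (hu p.2.1)
    have h3 := abs_le.1 ((hmem i x).1 hx).1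
    set u := (p.2.1 : EuclideanSpace ℝ (Fin 1)) 0
    set t := (Θ i x).1
    rcases lt_or_ge (p.1 : ℕ) (i : ℕ) with hlt | hge
    · have : ((p.1 : ℕ) : ℝ) + 1 ≤ (i : ℕ) := by exact_mod_cast hlt
      have hu1 : u = 1 := by linarith
      have ht1 : t = -1 := by linarith
      simp [hu1, ht1]
    · have : ((i : ℕ) : ℝ) ≤ (p.1 : ℕ) := by exact_mod_cast hge
      have hu1 : u = -1 := by linarith
      have ht1 : t = 1 := by linarith
      simp [hu1, ht1]
  refine attachesHandles_of_homeomorph (isCompact_iUnion hKc) e (fun x => ⟨H x, Hm x x.2⟩)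
    (fun p => ⟨G p, Gm p⟩) ?_ ?_ (Gc.subtype_mk _) ?_ ?_ ?_ ?_
  · exact (continuousOn_iff_continuous_domRestrict.1 Hc).subtype_mk _
  · rintro ⟨x, hx⟩ ⟨y, hy⟩ h
    obtain ⟨i, hi⟩ := Set.mem_iUnion.1 hx
    obtain ⟨j, hj⟩ := Set.mem_iUnion.1 hy
    have h' : H x = H y := congrArg Subtype.val h
    rw [HK i x hi, HK j y hj] at h'
    have h1 := σi h'
    simp only [P, Prod.mk.injEq] at h1
    have h2 := abs_le.1 ((hmem i x).1 hi).1
    have h3 := abs_le.1 ((hmem j y).1 hj).1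
    have hij : i = j := Fin.ext <| hint _ _ <| by rw [abs_lt]; constructor <;> linarith [h1.1]
    subst hij
    exact Subtype.ext ((Θ i).injective (Prod.ext (by linarith [h1.1]) h1.2))
  · rintro ⟨a, u, d⟩ ⟨a', u', d'⟩ h
    have h1 := σi (congrArg Subtype.val h)
    simp only [Prod.mk.injEq] at h1
    have h2 := abs_le.1 (hu u)
    have h3 := abs_le.1 (hu u')
    have haa : a = a' := Fin.ext <| hint _ _ <| by rw [abs_lt]; constructor <;> linarith [h1.1]
    subst haa
    have huu : u = u' := Subtype.ext (euclideanSpace_one_ext (by linarith [h1.1]))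
    rw [huu, Subtype.ext h1.2]
  · rintro ⟨⟨c, d⟩, hz⟩
    obtain ⟨hz1, hz2⟩ := mem_cylinder.1 hz
    have hz1 := abs_le.1 hz1
    dsimp only at hz1 hz2
    have hσ : σ ((c + 1) * N - 1, d) = (c, d) := by
      simp only [σ, sub_add_cancel, mul_div_cancel_right₀ _ hN.ne', add_sub_cancel_right]
    rcases exists_slab (n := n) (t := (c + 1) * N - 1) (by nlinarith) (by simp only [N]; nlinarith)
      with ⟨i, hi⟩ | ⟨j, hj⟩
    · left
      set x := (Θ i).symm ((c + 1) * N - 1 - 4 * (i : ℕ), d)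
      have hx : Θ i x = ((c + 1) * N - 1 - 4 * (i : ℕ), d) := (Θ i).apply_symm_apply _
      have hxK : x ∈ K i := by rw [hmem, hx]; exact ⟨hi, hz2⟩
      refine ⟨⟨x, Set.mem_iUnion.2 ⟨i, hxK⟩⟩, Subtype.ext ?_⟩
      simp only [HK i x hxK, P, hx]
      rw [← hσ]; congr 2; ring
    · right
      refine ⟨(j, ⟨!₂[(c + 1) * N - 1 - 4 * (j : ℕ) - 2], ?_⟩, ⟨d, ?_⟩), Subtype.ext ?_⟩
      · rw [mem_closedBall_zero_iff, norm_euclideanSpace_one]; simpa using hj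
      · rw [mem_closedBall_zero_iff]; exact hz2
      · have h1 : 4 * ((j : ℕ) : ℝ) + 2 +
            (!₂[(c + 1) * N - 1 - 4 * (j : ℕ) - 2] : EuclideanSpace ℝ (Fin 1)) 0 =
            (c + 1) * N - 1 := by
          simp only [Matrix.cons_val_zero]
          ring
        exact (congrArg (fun a => σ (a, d)) h1).trans hσ
  · intro p
    rw [norm_euclideanSpace_one]
    constructor
    · rintro ⟨⟨x, hx⟩, h⟩
      obtain ⟨i, hi⟩ := Set.mem_iUnion.1 hx
      have h' : H x = G p := congrArg Subtype.val h
      rw [HK i x hi] at h'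
      exact (hGH p i x hi h'.symm).1
    · intro h
      have hd2 : ‖(p.2.2 : EuclideanSpace ℝ (Fin 2))‖ ≤ 1 := mem_closedBall_zero_iff.1 p.2.2.2
      have hit : ∃ (i : Fin (n + 1)) (t : ℝ), |t| = 1 ∧ 4 * ((i : ℕ) : ℝ) + t =
          4 * ((p.1 : ℕ) : ℝ) + 2 + (p.2.1 : EuclideanSpace ℝ (Fin 1)) 0 := by
        rcases (abs_eq zero_le_one).1 h with h | h
        · exact ⟨p.1.succ, -1, by simp, by rw [h, Fin.val_succ]; push_cast; ring⟩
        · exact ⟨p.1.castSucc, 1, by simp, by rw [h, Fin.val_castSucc]; ring⟩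
      obtain ⟨i, t, ht, hit⟩ := hit
      set x := (Θ i).symm (t, p.2.2)
      have hx : Θ i x = (t, (p.2.2 : EuclideanSpace ℝ (Fin 2))) := (Θ i).apply_symm_apply _
      have hxK : x ∈ K i := by rw [hmem, hx]; exact ⟨ht.le, hd2⟩
      refine ⟨⟨x, Set.mem_iUnion.2 ⟨i, hxK⟩⟩, Subtype.ext ?_⟩
      simp only [HK i x hxK, P, hx, G, hit]
  · rintro ⟨x, hx⟩ ⟨p, h⟩
    obtain ⟨i, hi⟩ := Set.mem_iUnion.1 hx
    have h' : G p = H x := congrArg Subtype.val h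
    rw [HK i x hi] at h'
    refine mem_frontier_iUnion hcl hd (i := i) ((hK i).mem_frontier ?_)
    rw [← hΘ]
    refine le_antisymm ?_ ?_
    · rw [hΘ]; exact ((hK i).mem_iff x).1 hi
    · rw [← (hGH p i x hi h').2, ← Real.norm_eq_abs]
      exact norm_fst_le _

/-! ### The handle of index two -/

/-- Barycentric coordinates in the plane, with respect to a triangle around the origin. -/
noncomputable def bary (u : EuclideanSpace ℝ (Fin 2)) : Fin 3 → ℝ :=
  ![1 / 3 + u 0, 1 / 3 + u 1, 1 / 3 - u 0 - u 1]

/-- The gauge of the triangle in which the barycentric coordinates are nonnegative. -/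
noncomputable def triangleGauge (u : EuclideanSpace ℝ (Fin 2)) : ℝ :=
  max (-3 * u 0) (max (-3 * u 1) (3 * (u 0 + u 1)))

theorem isGauge_triangleGauge : IsGauge triangleGauge where
  continuous := by unfold triangleGauge; fun_prop
  smul t u ht := by
    simp only [triangleGauge, PiLp.smul_apply, smul_eq_mul, mul_max_of_nonneg _ _ ht]
    congr 1
    · ring
    · congr 1 <;> ring
  pos u hu := by
    by_contra! h
    simp only [triangleGauge, max_le_iff] at h
    refine hu ?_
    ext i
    fin_cases i
    · simp only [Fin.zero_eta, PiLp.zero_apply]; linarith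
    · simp only [Fin.mk_one, PiLp.zero_apply]; linarith

theorem triangleGauge_le_one_iff (u : EuclideanSpace ℝ (Fin 2)) :
    triangleGauge u ≤ 1 ↔ ∀ i, 0 ≤ bary u i := by
  simp only [triangleGauge, max_le_iff, Fin.forall_fin_succ, bary, Matrix.cons_val_zero,
    Matrix.cons_val_succ, IsEmpty.forall_iff, and_true]
  constructor <;> rintro ⟨h0, h1, h2⟩ <;> refine ⟨?_, ?_, ?_⟩ <;> linarith

theorem triangleGauge_lt_one_iff (u : EuclideanSpace ℝ (Fin 2)) :
    triangleGauge u < 1 ↔ ∀ i, 0 < bary u i := by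
  simp only [triangleGauge, max_lt_iff, Fin.forall_fin_succ, bary, Matrix.cons_val_zero,
    Matrix.cons_val_succ, IsEmpty.forall_iff, and_true]
  constructor <;> rintro ⟨h0, h1, h2⟩ <;> refine ⟨?_, ?_, ?_⟩ <;> linarith

theorem continuous_bary (i : Fin 3) : Continuous fun u => bary u i := by
  fin_cases i <;> simp [bary] <;> fun_prop

theorem bary_injective : Function.Injective bary := by
  intro u v h
  ext i
  fin_cases i
  · have := congrFun h 0
    simpa [bary] using this
  · have := congrFun h 1
    simpa [bary] using this

theorem bary_sum (u : EuclideanSpace ℝ (Fin 2)) : bary u 0 + bary u 1 + bary u 2 = 1 := by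
  simp [bary]
  ring

theorem bary_mk {l : Fin 3 → ℝ} (h : l 0 + l 1 + l 2 = 1) :
    bary !₂[l 0 - 1 / 3, l 1 - 1 / 3] = l := by
  ext i
  fin_cases i
  · simp [bary]
  · simp [bary]
  · simp [bary]; linarith

/-- The largest barycentric coordinate. -/
noncomputable def baryMax (u : EuclideanSpace ℝ (Fin 2)) : ℝ :=
  max (bary u 0) (max (bary u 1) (bary u 2))

theorem continuous_baryMax : Continuous baryMax :=
  (continuous_bary 0).max ((continuous_bary 1).max (continuous_bary 2))

theorem baryMax_pos (u : EuclideanSpace ℝ (Fin 2)) : 0 < baryMax u := by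
  by_contra! h
  simp only [baryMax, max_le_iff] at h
  linarith [bary_sum u]

theorem bary_le_baryMax (u : EuclideanSpace ℝ (Fin 2)) (i : Fin 3) : bary u i ≤ baryMax u := by
  fin_cases i <;> simp [baryMax]

theorem baryMax_le {u : EuclideanSpace ℝ (Fin 2)} {c : ℝ} (h : ∀ i, bary u i ≤ c) :
    baryMax u ≤ c := by
  simp [baryMax, h]

theorem mem_part_compl_iff {b : ℝ} {x : Fin 3 → ℝ} :
    x ∈ part {s | s ≠ fun _ => false} b ↔ x ∈ wedge (fun _ => none) b ∧ ∃ i, 0 ≤ x i := by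
  constructor
  · rintro ⟨s, hs, hx⟩
    obtain ⟨i, hi⟩ : ∃ i, s i = true := by
      by_contra! h
      exact hs (funext fun i => by simpa using h i)
    exact ⟨cell_subset_wedge (by simp) hx, i, by simpa [hi] using (mem_cell.1 hx).1 i⟩
  · rintro ⟨hx, i, hi⟩
    refine ⟨fun j => decide (0 ≤ x j), fun e => by simpa [hi] using congrFun e i,
      mem_cell.2 ⟨fun j => ?_, hx.2⟩⟩
    by_cases h : 0 ≤ x j
    · simp [h]
    · simpa [h] using (not_le.1 h).le

/-- If only the lowest cell is missing, then below the level of the vertex it is a handle of index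
`2` that completes the body to a ball: the rays from the vertex meet it in the segments `D¹`, and
the triangle of their directions is the disc `D²`. -/
theorem attachesHandles_two {ε : ℝ} (h0 : 0 < ε) (h1 : ε < 1 / 4) {Y : Set (Fin 3 → ℝ)}
    (hY : Nonempty (Y ≃ₜ Cylinder)) :
    AttachesHandles 1 2 (part {s | s ≠ fun _ => false} (-ε)) Y := by
  set X := part {s : Signs | s ≠ fun _ => false} (-ε) with hX
  set K := wedge (fun _ => none) (-ε) with hK
  have hKe : Nonempty (K ≃ₜ Cylinder) := by
    obtain ⟨o, ho⟩ := exists_isInner_of_neg (b := -ε) (by linarith) (s := fun _ => false) ⟨0, rfl⟩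
    obtain ⟨g, hg⟩ := ho.exists_isStar (p := fun _ => none) (by simp)
    exact hg.nonempty_homeomorph_closedBall toCylinder
  obtain ⟨eK⟩ := hKe
  obtain ⟨eY⟩ := hY
  let Θ : EuclideanSpace ℝ (Fin 2) ≃ₜ EuclideanSpace ℝ (Fin 2) :=
    radialHomeomorph (isGauge_norm_comp (ContinuousLinearEquiv.refl ℝ _)) isGauge_triangleGauge
  have hΘ : ∀ d, triangleGauge (Θ d) = ‖d‖ := fun d =>
    gauge_radial (isGauge_norm_comp (ContinuousLinearEquiv.refl ℝ _)) isGauge_triangleGauge d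
  -- the distance from the vertex, measured by `-diag`, at height `t` over the direction `u`
  let Q : EuclideanSpace ℝ (Fin 2) → ℝ → ℝ := fun u t => ε + (1 + t) / 2 * (1 / baryMax u - ε)
  have hmax : ∀ u, (∀ i, 0 ≤ bary u i) → 1 ≤ 1 / baryMax u := fun u hu => by
    rw [le_div_iff₀ (baryMax_pos u), one_mul]
    have := bary_sum u
    refine baryMax_le fun i => ?_
    have a0 := hu 0
    have a1 := hu 1
    have a2 := hu 2
    fin_cases i <;> simp <;> linarith
  have hQ0 : ∀ u t, (∀ i, 0 ≤ bary u i) → |t| ≤ 1 → ε ≤ Q u t := fun u t hu ht => by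
    have := hmax u hu
    have := abs_le.1 ht
    have : 0 ≤ (1 + t) / 2 * (1 / baryMax u - ε) := mul_nonneg (by linarith) (by linarith)
    simp only [Q]; linarith
  have hQ1 : ∀ u t, (∀ i, 0 ≤ bary u i) → |t| ≤ 1 → Q u t * baryMax u ≤ 1 := fun u t hu ht => by
    have h3 := hmax u hu
    have h4 := abs_le.1 ht
    rw [← le_div_iff₀ (baryMax_pos u)]
    have : (1 + t) / 2 * (1 / baryMax u - ε) ≤ 1 * (1 / baryMax u - ε) := by
      apply mul_le_mul_of_nonneg_right <;> linarith
    simp only [Q]; linarith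
  let G : EuclideanSpace ℝ (Fin 2) → ℝ → Fin 3 → ℝ := fun d t i => -(Q (Θ d) t * bary (Θ d) i)
  have hdG : ∀ d t, diag (G d t) = -Q (Θ d) t := fun d t => by
    have := bary_sum (Θ d)
    simp only [diag, G]
    linear_combination (-Q (Θ d) t) * this
  have hb : ∀ d : Disk 2, ∀ i, 0 ≤ bary (Θ d) i := fun d => by
    rw [← triangleGauge_le_one_iff, hΘ]; exact mem_closedBall_zero_iff.1 d.2
  have hu : ∀ u : Disk 1, |(u : EuclideanSpace ℝ (Fin 1)) 0| ≤ 1 := fun u => by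
    rw [← norm_euclideanSpace_one]; exact mem_closedBall_zero_iff.1 u.2
  have Gm : ∀ (d : Disk 2) (u : Disk 1), G d ((u : EuclideanSpace ℝ (Fin 1)) 0) ∈ K := fun d u => by
    have hq0 := hQ0 _ _ (hb d) (hu u)
    have hq1 := hQ1 _ _ (hb d) (hu u)
    refine ⟨by simp, fun i => ?_, by rw [hdG]; linarith⟩
    have h2 := bary_le_baryMax (Θ d) i
    have h3 := hb d i
    simp only [G]
    rw [abs_neg, abs_of_nonneg (mul_nonneg (by linarith) h3)]
    exact (mul_le_mul_of_nonneg_left h2 (by linarith)).trans hq1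
  have Gle : ∀ (d : Disk 2) (u : Disk 1) i, G d ((u : EuclideanSpace ℝ (Fin 1)) 0) i ≤ 0 :=
    fun d u i => by
      have hq0 := hQ0 _ _ (hb d) (hu u)
      have := mul_nonneg (h0.le.trans hq0) (hb d i)
      simp only [G]; linarith
  have hXK : ∀ x : X, (x : Fin 3 → ℝ) ∈ K := fun x => (mem_part_compl_iff.1 x.2).1
  let h : X → K := fun x => ⟨x, hXK x⟩
  have hrange : ∀ z : K, z ∈ Set.range h ↔ ∃ i, 0 ≤ (z : Fin 3 → ℝ) i := fun z => by
    constructor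
    · rintro ⟨x, rfl⟩
      exact (mem_part_compl_iff.1 x.2).2
    · intro hz
      exact ⟨⟨z, mem_part_compl_iff.2 ⟨z.2, hz⟩⟩, rfl⟩
  refine attachesHandles_of_homeomorph (isCompact_part _ _) (eY.trans eK.symm) h
    (fun p => ⟨G p.2.1 ((p.2.2 : EuclideanSpace ℝ (Fin 1)) 0), Gm p.2.1 p.2.2⟩) ?_ ?_ ?_ ?_ ?_ ?_ ?_
  · exact continuous_subtype_val.subtype_mk _
  · exact fun x y hxy => Subtype.ext (congrArg (fun z : K => (z : Fin 3 → ℝ)) hxy)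
  · refine Continuous.subtype_mk (continuous_pi fun i => ?_) _
    have c1 : Continuous fun p : Fin 1 × (Disk 2 × Disk 1) =>
        Θ (p.2.1 : EuclideanSpace ℝ (Fin 2)) := Θ.continuous.comp (by fun_prop)
    have c2 : Continuous fun p : Fin 1 × (Disk 2 × Disk 1) =>
        (p.2.2 : EuclideanSpace ℝ (Fin 1)) 0 := by fun_prop
    have c3 := (continuous_bary i).comp c1
    have c4 := continuous_baryMax.comp c1
    exact ((continuous_const.add (((continuous_const.add c2).div_const 2).mul
      ((continuous_const.div c4 fun p => (baryMax_pos _).ne').sub continuous_const))).mul c3).neg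
  · rintro ⟨a, d, u⟩ ⟨a', d', u'⟩ hp
    have hp' : G d ((u : EuclideanSpace ℝ (Fin 1)) 0) = G d' ((u' : EuclideanSpace ℝ (Fin 1)) 0) :=
      congrArg Subtype.val hp
    have e1 : Q (Θ d) ((u : EuclideanSpace ℝ (Fin 1)) 0) =
        Q (Θ d') ((u' : EuclideanSpace ℝ (Fin 1)) 0) := by
      have := congrArg diag hp'
      rw [hdG, hdG] at this
      linarith
    have hq0 := hQ0 _ _ (hb d) (hu u)
    have e2 : bary (Θ d) = bary (Θ d') := by
      funext i
      have := congrFun hp' i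
      simp only [G, ← e1, neg_inj] at this
      exact mul_left_cancel₀ (by linarith) this
    have e3 : (d : EuclideanSpace ℝ (Fin 2)) = d' := Θ.injective (bary_injective e2)
    have e4 : (u : EuclideanSpace ℝ (Fin 1)) = u' := by
      rw [← e3] at e1
      have h3 := hmax _ (hb d)
      simp only [Q, add_right_inj] at e1
      have := mul_right_cancel₀ (by linarith) e1
      exact euclideanSpace_one_ext (by linarith)
    rw [Subsingleton.elim a a', Subtype.ext e3, Subtype.ext e4]
  · intro z
    by_cases hz : ∃ i, 0 ≤ (z : Fin 3 → ℝ) i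
    · exact Or.inl ((hrange z).2 hz)
    right
    push Not at hz
    obtain ⟨x, hx⟩ := z
    dsimp only at hz
    set q := -diag x with hq
    have hqε : ε ≤ q := by have := hx.2.2; linarith
    have hq0 : 0 < q := by linarith
    set l : Fin 3 → ℝ := fun i => -x i / q with hl
    have hsum : l 0 + l 1 + l 2 = 1 := by
      simp only [l, ← add_div]
      rw [div_eq_one_iff_eq hq0.ne', hq, diag]; ring
    set u : EuclideanSpace ℝ (Fin 2) := !₂[l 0 - 1 / 3, l 1 - 1 / 3]
    have hbu : bary u = l := bary_mk hsum
    have hl0 : ∀ i, 0 ≤ bary u i := fun i => by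
      rw [hbu]; exact div_nonneg (by linarith [hz i]) hq0.le
    have hqm : q ≤ 1 / baryMax u := by
      rw [le_div_iff₀ (baryMax_pos u), mul_comm, ← le_div_iff₀ hq0]
      refine baryMax_le fun i => ?_
      rw [hbu]
      simp only [l]
      gcongr
      linarith [(abs_le.1 (hx.2.1 i)).1]
    have hm := hmax u hl0
    set t := 2 * ((q - ε) / (1 / baryMax u - ε)) - 1 with ht
    have hden : 0 < 1 / baryMax u - ε := by linarith
    have ht1 : |t| ≤ 1 := by
      have a1 : 0 ≤ (q - ε) / (1 / baryMax u - ε) := div_nonneg (by linarith) hden.le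
      have a2 : (q - ε) / (1 / baryMax u - ε) ≤ 1 := by rw [div_le_one hden]; linarith
      rw [abs_le]; constructor <;> linarith
    have hQt : Q u t = q := by
      simp only [Q, ht]
      rw [show (1 + (2 * ((q - ε) / (1 / baryMax u - ε)) - 1)) / 2 =
        (q - ε) / (1 / baryMax u - ε) by ring, div_mul_cancel₀ _ hden.ne']
      ring
    refine ⟨(0, ⟨Θ.symm u, ?_⟩, ⟨!₂[t], ?_⟩), Subtype.ext ?_⟩
    · rw [mem_closedBall_zero_iff, ← hΘ, Θ.apply_symm_apply, triangleGauge_le_one_iff]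
      exact hl0
    · rw [mem_closedBall_zero_iff, norm_euclideanSpace_one]; simpa using ht1
    · funext i
      change -(Q (Θ (Θ.symm u)) t * bary (Θ (Θ.symm u)) i) = x i
      rw [Θ.apply_symm_apply, hQt, hbu]
      simp only [l]
      field_simp
  · rintro ⟨a, d, u⟩
    have hq0 := hQ0 _ _ (hb d) (hu u)
    rw [hrange]
    have hn : ‖(d : EuclideanSpace ℝ (Fin 2))‖ ≤ 1 := mem_closedBall_zero_iff.1 d.2
    have : (∃ i, 0 ≤ G d ((u : EuclideanSpace ℝ (Fin 1)) 0) i) ↔ ¬ ∀ i, 0 < bary (Θ d) i := by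
      push Not
      refine exists_congr fun i => ?_
      have hq : 0 < Q (Θ d) ((u : EuclideanSpace ℝ (Fin 1)) 0) := by linarith
      simp only [G, neg_nonneg]
      constructor
      · intro h; by_contra! h'; linarith [mul_pos hq h']
      · intro h; exact mul_nonpos_of_nonneg_of_nonpos hq.le h
    refine this.trans ?_
    rw [← triangleGauge_lt_one_iff, hΘ, not_lt]
    exact ⟨fun h => le_antisymm hn h, fun h => h.ge⟩
  · rintro ⟨x, hx⟩ ⟨⟨a, d, u⟩, hp⟩
    have hxG : G d ((u : EuclideanSpace ℝ (Fin 1)) 0) = x := congrArg Subtype.val hp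
    have hx0 : ∀ i, x i ≤ 0 := fun i => hxG ▸ Gle d u i
    refine ⟨subset_closure hx, fun hi => ?_⟩
    have hc : Tendsto (fun (t : ℝ) (i : Fin 3) => x i - t) (𝓝[>] 0) (𝓝 x) := by
      have : Continuous fun (t : ℝ) (i : Fin 3) => x i - t := by fun_prop
      have h := (this.tendsto 0).mono_left (nhdsWithin_le_nhds (s := Set.Ioi 0))
      simpa using h
    obtain ⟨t, ht, ht0 : 0 < t⟩ :=
      ((hc.eventually (mem_interior_iff_mem_nhds.1 hi)).and self_mem_nhdsWithin).exists
    obtain ⟨-, i, hi⟩ := mem_part_compl_iff.1 ht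
    linarith [hx0 i]

/-! ### Telling sublevel sets apart -/

/-- A nowhere vanishing function on a convex set has a continuous logarithm. -/
theorem exists_continuous_log {E : Type*} [NormedAddCommGroup E] [NormedSpace ℝ E] {B : Set E}
    (hB : Convex ℝ B) {F : B → ℂ} (hF : Continuous F) (h0 : ∀ x, F x ≠ 0) :
    ∃ G : B → ℂ, Continuous G ∧ ∀ x, Complex.exp (G x) = F x := by
  rcases B.eq_empty_or_nonempty with rfl | ⟨b, hb⟩
  · exact ⟨F, hF, fun x => x.2.elim⟩
  have : ContractibleSpace B := hB.contractibleSpace ⟨b, hb⟩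
  have : LocallyPathConnectedSpace B := hB.locallyPathConnectedSpace
  obtain ⟨G, ⟨-, hG⟩, -⟩ := Complex.isCoveringMap_exp.existsUnique_continuousMap_lifts
    (⟨fun x => ⟨F x, h0 x⟩, hF.subtype_mk _⟩ : C(B, {z : ℂ // z ≠ 0})) ⟨b, hb⟩
    (Complex.log (F ⟨b, hb⟩)) (Subtype.ext (Complex.exp_log (h0 _)))
  exact ⟨G, G.continuous, fun x => congrArg Subtype.val (congrFun hG x)⟩

/-- The inclusion of the unit circle into the punctured plane has no continuous logarithm. -/
theorem not_exists_log_circle {s : Metric.sphere (0 : ℂ) 1 → ℂ} (hs : Continuous s)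
    (h : ∀ z, Complex.exp (s z) = z) : False := by
  have : PreconnectedSpace (Metric.sphere (0 : ℂ) 1) :=
    isPreconnected_iff_preconnectedSpace.1
      (isPreconnected_sphere (by rw [Complex.rank_real_complex]; norm_num) _ _)
  let D : Metric.sphere (0 : ℂ) 1 → ℂ := fun z => s z - s (-z)
  have hD : Continuous D := hs.sub (hs.comp continuous_neg)
  have hexp : ∀ z, Complex.exp (D z) = -1 := fun z => by
    have hz : (z : ℂ) ≠ 0 := by
      have := mem_sphere_zero_iff_norm.1 z.2
      rw [← norm_ne_zero_iff, this]
      exact one_ne_zero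
    simp only [D, Complex.exp_sub, h]
    rw [show ((-z : Metric.sphere (0 : ℂ) 1) : ℂ) = -z from rfl]
    field_simp
  have hodd : ∀ z, (D (-z)).im = -(D z).im := fun z => by simp [D]
  have hc : Continuous fun z => (D z).im := Complex.continuous_im.comp hD
  have z₀ : Metric.sphere (0 : ℂ) 1 := ⟨1, by simp⟩
  -- the imaginary part of `D` is odd, so it vanishes somewhere, and there `exp D` is positive
  obtain ⟨z, hz⟩ : (0 : ℝ) ∈ Set.range fun z => (D z).im := by
    rcases le_total (D z₀).im 0 with h1 | h1
    · exact mem_range_of_exists_le_of_exists_ge hc ⟨z₀, h1⟩ ⟨-z₀, by rw [hodd]; linarith⟩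
    · exact mem_range_of_exists_le_of_exists_ge hc ⟨-z₀, by rw [hodd]; linarith⟩ ⟨z₀, h1⟩
  have h1 := congrArg Complex.re (hexp z)
  simp only at hz
  rw [Complex.exp_re, hz, Real.cos_zero, mul_one] at h1
  have := Real.exp_pos (D z).re
  rw [h1] at this
  norm_num at this

/-- If only the lowest cell is missing, then the body below the level of the vertex winds around the
diagonal through the vertex, so it is not a ball. -/
theorem isEmpty_homeomorph_of_compl {ε : ℝ} (h0 : 0 < ε) (h1 : ε < 1 / 4) {E : Type*}
    [NormedAddCommGroup E] [NormedSpace ℝ E] {B : Set E} (hB : Convex ℝ B) :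
    IsEmpty (part {s | s ≠ fun _ => false} (-ε) ≃ₜ B) := by
  refine ⟨fun e => ?_⟩
  set X := part {s : Signs | s ≠ fun _ => false} (-ε)
  let F : (Fin 3 → ℝ) → ℂ := fun x => ⟨x 0 - x 1, x 0 + x 1 - 2 * x 2⟩
  have hFc : Continuous F := by
    have : F = fun x => ((x 0 - x 1 : ℝ) : ℂ) + ((x 0 + x 1 - 2 * x 2 : ℝ) : ℂ) * Complex.I := by
      funext x; apply Complex.ext <;> simp [F]
    rw [this]; fun_prop
  have hF0 : ∀ x ∈ X, F x ≠ 0 := fun x hx hF => by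
    obtain ⟨hx, i, hi⟩ := mem_part_compl_iff.1 hx
    have a := congrArg Complex.re hF
    have b := congrArg Complex.im hF
    simp only [F, Complex.zero_re, Complex.zero_im] at a b
    have hd := hx.2.2
    simp only [diag] at hd
    fin_cases i <;> simp only [Fin.zero_eta, Fin.mk_one, Fin.reduceFinMk] at hi <;> linarith
  -- a section of `F` over the circle, which stays in the body
  let l : Metric.sphere (0 : ℂ) 1 → Fin 3 → ℝ := fun z =>
    ![(z : ℂ).re / 2 + (z : ℂ).im / 6 - 1 / 10, -(z : ℂ).re / 2 + (z : ℂ).im / 6 - 1 / 10,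
      -(z : ℂ).im / 3 - 1 / 10]
  have hlc : Continuous l := by
    refine continuous_pi fun i => ?_
    fin_cases i <;> simp [l] <;> fun_prop
  have hlX : ∀ z, l z ∈ X := fun z => by
    have hz : (z : ℂ).re * (z : ℂ).re + (z : ℂ).im * (z : ℂ).im = 1 := by
      have := mem_sphere_zero_iff_norm.1 z.2
      rw [← Complex.normSq_apply, Complex.normSq_eq_norm_sq, this, one_pow]
    set a := (z : ℂ).re
    set b := (z : ℂ).im
    have ha : |a| ≤ 1 := abs_le.2 ⟨by nlinarith, by nlinarith⟩
    have hb : |b| ≤ 1 := abs_le.2 ⟨by nlinarith, by nlinarith⟩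
    rw [abs_le] at ha hb
    refine mem_part_compl_iff.2 ⟨⟨by simp, fun i => ?_, ?_⟩, ?_⟩
    · rw [abs_le]
      fin_cases i <;> simp [l] <;> constructor <;> linarith
    · simp [diag, l]
      linarith
    · by_contra! hcon
      have c0 := hcon 0
      have c1 := hcon 1
      have c2 := hcon 2
      simp [l] at c0 c1 c2
      have hb' : |b| < 6 / 10 := abs_lt.2 ⟨by linarith, by linarith⟩
      have ha' : |a| < 4 / 10 := abs_lt.2 ⟨by linarith, by linarith⟩
      have hb2 : b * b < 6 / 10 * (6 / 10) := by rw [← abs_mul_abs_self b]; gcongr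
      have ha2 : a * a < 4 / 10 * (4 / 10) := by rw [← abs_mul_abs_self a]; gcongr
      linarith
  have hFl : ∀ z, F (l z) = z := fun z => by
    apply Complex.ext <;> simp [F, l] <;> ring
  obtain ⟨G, hG, hGF⟩ := exists_continuous_log hB (F := fun y => F (e.symm y))
    (hFc.comp (continuous_subtype_val.comp e.symm.continuous)) (fun y => hF0 _ (e.symm y).2)
  refine not_exists_log_circle (s := fun z => G (e ⟨l z, hlX z⟩))
    (hG.comp (e.continuous.comp (hlc.subtype_mk _))) fun z => ?_
  rw [hGF, e.symm_apply_apply, hFl]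

/-- The number of the piece in which a point lies is a continuous function. -/
theorem exists_continuous_index {E : Type*} [TopologicalSpace E] {m : ℕ} {K : Fin m → Set E}
    (hK : ∀ i, IsClosed (K i)) (hd : ∀ i j, i ≠ j → ∀ x ∈ K i, x ∉ K j) :
    ∃ ι : (⋃ i, K i : Set E) → Fin m, Continuous ι ∧
      ∀ i (x : (⋃ i, K i : Set E)), (x : E) ∈ K i ↔ ι x = i := by
  choose ι hι using fun x : (⋃ i, K i : Set E) => Set.mem_iUnion.1 x.2
  have hiff : ∀ i (x : (⋃ i, K i : Set E)), (x : E) ∈ K i ↔ ι x = i := fun i x => by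
    constructor
    · intro hx
      by_contra hne
      exact hd _ _ hne x (hι x) hx
    · rintro rfl
      exact hι x
  refine ⟨ι, continuous_iff_isClosed.2 fun s _ => ?_, hiff⟩
  have : ι ⁻¹' s = ⋃ i ∈ s, Subtype.val ⁻¹' K i := by
    ext x
    simp only [Set.mem_preimage, Set.mem_iUnion, hiff, exists_prop, exists_eq_right']
  rw [this]
  exact s.toFinite.isClosed_biUnion fun i _ => (hK i).preimage continuous_subtype_val

theorem isEmpty_homeomorph_of_pieces {E Z : Type*} [TopologicalSpace E] [TopologicalSpace Z]
    [PreconnectedSpace Z] {m : ℕ} {K : Fin m → Set E} (hK : ∀ i, IsClosed (K i))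
    (hd : ∀ i j, i ≠ j → ∀ x ∈ K i, x ∉ K j) {i j : Fin m} (hij : i ≠ j) (hi : (K i).Nonempty)
    (hj : (K j).Nonempty) : IsEmpty ((⋃ i, K i : Set E) ≃ₜ Z) := by
  refine ⟨fun e => hij ?_⟩
  obtain ⟨ι, hι, hιK⟩ := exists_continuous_index hK hd
  have : PreconnectedSpace (⋃ i, K i : Set E) := by
    have := e.symm.surjective.denseRange.preconnectedSpace e.symm.continuous
    exact this
  obtain ⟨x, hx⟩ := hi
  obtain ⟨y, hy⟩ := hj
  rw [← (hιK i ⟨x, Set.mem_iUnion.2 ⟨i, hx⟩⟩).1 hx, ← (hιK j ⟨y, Set.mem_iUnion.2 ⟨j, hy⟩⟩).1 hy]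
  exact PreconnectedSpace.constant this hι

/-- A handle whose attaching region is covered by two connected sets cannot connect three pieces. -/
theorem not_attachesHandles_of_cover {i : ℕ} {Y : Set (Fin 3 → ℝ)} [PreconnectedSpace Y]
    {K : Fin 3 → Set (Fin 3 → ℝ)} (hK : ∀ i, IsClosed (K i))
    (hd : ∀ i j, i ≠ j → ∀ x ∈ K i, x ∉ K j) (hne : ∀ i, (K i).Nonempty)
    {A B : Set (Fin 1 × (Disk i × Disk (3 - i)))} (hA : IsPreconnected A) (hB : IsPreconnected B)
    (hAB : ∀ p, ‖(p.2.1 : EuclideanSpace ℝ (Fin i))‖ = 1 ↔ p ∈ A ∨ p ∈ B) :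
    ¬ AttachesHandles 1 i (⋃ i, K i) Y := by
  rintro ⟨h, g, hh, hg, hcov, hover, -⟩
  obtain ⟨ι, hι, hιK⟩ := exists_continuous_index hK hd
  have const : ∀ S : Set (Fin 1 × (Disk i × Disk (3 - i))), IsPreconnected S →
      (∀ p ∈ S, ‖(p.2.1 : EuclideanSpace ℝ (Fin i))‖ = 1) →
      ∃ k, ∀ p ∈ S, ∀ x, h x = g p → ι x = k := by
    intro S hS hS1
    have hpre : IsPreconnected (h ⁻¹' (g '' S)) := by
      rw [← hh.isInducing.isPreconnected_image, Set.image_preimage_eq_of_subset]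
      · exact hS.image _ hg.continuous.continuousOn
      · rintro _ ⟨p, hp, rfl⟩
        exact (hover p).2 (hS1 p hp)
    by_cases hex : ∃ x, x ∈ h ⁻¹' (g '' S)
    · obtain ⟨x, hx⟩ := hex
      exact ⟨ι x, fun p hp y hy => hpre.constant hι.continuousOn ⟨p, hp, hy.symm⟩ hx⟩
    · exact ⟨0, fun p hp y hy => absurd ⟨y, ⟨p, hp, hy.symm⟩⟩ hex⟩
  obtain ⟨a, ha⟩ := const A hA fun p hp => (hAB p).2 (Or.inl hp)
  obtain ⟨b, hb⟩ := const B hB fun p hp => (hAB p).2 (Or.inr hp)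
  obtain ⟨k, hka, hkb⟩ : ∃ k : Fin 3, k ≠ a ∧ k ≠ b :=
    (by decide : ∀ a b : Fin 3, ∃ k, k ≠ a ∧ k ≠ b) a b
  have hfree : ∀ x, ι x = k → h x ∉ Set.range g := by
    rintro x hx ⟨p, hp⟩
    rcases (hAB p).1 ((hover p).1 ⟨x, hp.symm⟩) with h1 | h1
    · exact hka (hx ▸ ha p h1 x hp.symm)
    · exact hkb (hx ▸ hb p h1 x hp.symm)
  -- the piece that the handle misses is open and closed
  have hC : IsClosed (h '' (ι ⁻¹' {k})) :=
    hh.isClosedMap _ ((isClosed_discrete _).preimage hι)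
  have hC' : IsClosed (h '' (ι ⁻¹' {k}ᶜ) ∪ Set.range g) :=
    (hh.isClosedMap _ ((isClosed_discrete _).preimage hι)).union hg.isClosed_range
  have hcompl : (h '' (ι ⁻¹' {k}))ᶜ = h '' (ι ⁻¹' {k}ᶜ) ∪ Set.range g := by
    ext y
    constructor
    · intro hy
      have : y ∈ Set.range h ∪ Set.range g := hcov ▸ Set.mem_univ y
      rcases this with ⟨x, rfl⟩ | hy'
      · exact Or.inl ⟨x, fun hx => hy ⟨x, hx, rfl⟩, rfl⟩
      · exact Or.inr hy'
    · rintro (⟨x, hx, rfl⟩ | hy) ⟨x', hx', e⟩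
      · exact hx (hh.injective e ▸ hx')
      · exact hfree x' hx' (e ▸ hy)
  have hclopen : IsClopen (h '' (ι ⁻¹' {k})) :=
    ⟨hC, by rw [← isClosed_compl_iff, hcompl]; exact hC'⟩
  obtain ⟨x, hx⟩ := hne k
  obtain ⟨y, hy⟩ := hne a
  have hX : ∀ i, ∀ x ∈ K i, x ∈ ⋃ i, K i := fun i x hx => Set.mem_iUnion.2 ⟨i, hx⟩
  have huniv := hclopen.eq_univ ⟨_, ⟨x, hX k x hx⟩, (hιK k _).1 hx, rfl⟩
  obtain ⟨z, hz, e⟩ : h ⟨y, hX a y hy⟩ ∈ h '' (ι ⁻¹' {k}) := huniv ▸ Set.mem_univ _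
  rw [hh.injective e] at hz
  exact hka (hz.symm.trans ((hιK a _).1 hy))

/-- The attaching region `∂Dⁱ × D³⁻ⁱ` consists of two discs for `i = 1` and is connected for `i =
2`, so a single such handle cannot connect three pieces. -/
theorem not_attachesHandles_of_pieces {i : ℕ} (hi : i = 1 ∨ i = 2) {Y : Set (Fin 3 → ℝ)}
    [PreconnectedSpace Y] {K : Fin 3 → Set (Fin 3 → ℝ)} (hK : ∀ i, IsClosed (K i))
    (hd : ∀ i j, i ≠ j → ∀ x ∈ K i, x ∉ K j) (hne : ∀ i, (K i).Nonempty) :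
    ¬ AttachesHandles 1 i (⋃ i, K i) Y := by
  have hdisk : ∀ m, PreconnectedSpace (Disk m) := fun m =>
    isPreconnected_iff_preconnectedSpace.1 (convex_closedBall _ _).isPreconnected
  rcases hi with rfl | rfl
  · have hmem : ∀ c : ℝ, |c| = 1 → (!₂[c] : EuclideanSpace ℝ (Fin 1)) ∈ Metric.closedBall 0 1 :=
      fun c hc => by rw [mem_closedBall_zero_iff, norm_euclideanSpace_one]; simpa using hc.le
    let q : ∀ c : ℝ, |c| = 1 → Disk (3 - 1) → Fin 1 × (Disk 1 × Disk (3 - 1)) :=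
      fun c hc d => (0, ⟨!₂[c], hmem c hc⟩, d)
    have hq : ∀ c hc, IsPreconnected (Set.range (q c hc)) := fun c hc => by
      have := hdisk (3 - 1)
      exact isPreconnected_range (by fun_prop)
    have hqr : ∀ c hc p, p ∈ Set.range (q c hc) ↔ (p.2.1 : EuclideanSpace ℝ (Fin 1)) 0 = c := by
      rintro c hc ⟨a, u, d⟩
      constructor
      · rintro ⟨d', e⟩
        rw [← e]
        simp [q]
      · intro hu
        refine ⟨d, Prod.ext (Subsingleton.elim _ _) (Prod.ext (Subtype.ext ?_) rfl)⟩
        exact euclideanSpace_one_ext (by simpa [q] using hu.symm)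
    refine not_attachesHandles_of_cover hK hd hne (hq 1 abs_one)
      (hq (-1) (by rw [abs_neg, abs_one])) fun p => ?_
    rw [hqr 1 abs_one, hqr (-1) (by rw [abs_neg, abs_one]), norm_euclideanSpace_one,
      abs_eq zero_le_one]
  · let S : Set (Fin 1 × (Disk 2 × Disk (3 - 2))) := {p | ‖(p.2.1 : EuclideanSpace ℝ (Fin 2))‖ = 1}
    have hS : IsPreconnected S := by
      have hsph : PreconnectedSpace (Metric.sphere (0 : EuclideanSpace ℝ (Fin 2)) 1) :=
        isPreconnected_iff_preconnectedSpace.1 (isPreconnected_sphere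
          (Module.lt_rank_of_lt_finrank (by simp)) _ _)
      have := hdisk (3 - 2)
      let q : Metric.sphere (0 : EuclideanSpace ℝ (Fin 2)) 1 × Disk (3 - 2) →
          Fin 1 × (Disk 2 × Disk (3 - 2)) :=
        fun r => (0, ⟨r.1, Metric.sphere_subset_closedBall r.1.2⟩, r.2)
      have hq : Continuous q := by fun_prop
      convert isPreconnected_range hq
      ext ⟨a, u, d⟩
      constructor
      · intro hp
        exact ⟨(⟨u, mem_sphere_zero_iff_norm.2 hp⟩, d), Prod.ext (Subsingleton.elim _ _) rfl⟩
      · rintro ⟨r, e⟩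
        rw [← e]
        exact mem_sphere_zero_iff_norm.1 r.1.2
    exact not_attachesHandles_of_cover hK hd hne hS hS fun p =>
      ⟨fun h => Or.inl h, fun h => h.elim id id⟩

/-! ### Critical configurations -/

/-- A configuration is star-shaped about its cell `c` if with every cell `s` it contains all the
cells of the box spanned by `s` and `c`. -/
def IsStarAbout (S : Set Signs) (c : Signs) : Prop :=
  c ∈ S ∧ ∀ s ∈ S, ∀ r : Signs, (∀ i, r i = s i ∨ r i = c i) → r ∈ S

/-- A configuration that is star-shaped about a cell is a union of wedges that contain this cell. -/
theorem IsStarAbout.exists_isStar {S : Set Signs} {c : Signs} (h : IsStarAbout S c) {b : ℝ}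
    {o : Fin 3 → ℝ} (ho : IsInner b c o) : ∃ g, IsStar (part S b) o g := by
  classical
  let p : Signs → Fin 3 → Option Bool := fun s i => if s i = c i then some (c i) else none
  have hp : ∀ s r : Signs, (∀ i a, p s i = some a → r i = a) ↔ ∀ i, r i = s i ∨ r i = c i := by
    intro s r
    refine forall_congr' fun i => ?_
    by_cases e : s i = c i
    · simp [p, e]
    · simp only [p, e, if_false, reduceCtorEq, IsEmpty.forall_iff, implies_true, true_iff]
      cases h1 : r i <;> cases h2 : s i <;> cases h3 : c i <;> simp_all
  have hstar : ∀ s, ∃ g, IsStar (wedge (p s) b) o g := fun s =>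
    ho.exists_isStar ((hp s c).2 fun i => Or.inr rfl)
  have key : ∀ t : Finset Signs, ∃ g, IsStar (⋃ s ∈ insert c t, wedge (p s) b) o g := by
    intro t
    induction t using Finset.induction_on with
    | empty => simpa using hstar c
    | insert s t _ ih =>
      obtain ⟨g, hg⟩ := ih
      obtain ⟨g', hg'⟩ := hstar s
      rw [Finset.insert_comm, Finset.set_biUnion_insert]
      exact ⟨_, hg'.union hg⟩
  obtain ⟨g, hg⟩ := key S.toFinite.toFinset
  refine ⟨g, ?_⟩
  convert hg using 1
  ext x
  simp only [Set.mem_iUnion, Finset.mem_insert, Set.Finite.mem_toFinset, exists_prop]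
  constructor
  · rintro ⟨s, hs, hx⟩
    exact ⟨s, Or.inr hs, cell_subset_wedge ((hp s s).2 fun i => Or.inl rfl) hx⟩
  · rintro ⟨s, hs, hx⟩
    obtain ⟨r, hr, hxr⟩ := mem_wedge_iff.1 hx
    refine ⟨r, h.2 s ?_ r ((hp s r).1 hr), hxr⟩
    rcases hs with rfl | hs
    exacts [h.1, hs]

theorem notMem_cell_of_neg {s : Signs} {b : ℝ} (hb : b < 0) (hs : ∀ i, s i = true)
    (x : Fin 3 → ℝ) : x ∉ cell s b :=
  fun hx => disjoint_cell hb (fun i _ => hs i) hx hx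

/-- The configuration `n` without its highest cell falls into the configurations `c i`, which have
no point in common below the level of the vertex and are star-shaped about their cells `d i`. -/
structure Splits {m : ℕ} (n : ℕ) (c d : Fin m → ℕ) : Prop where
  union : ∀ s : Signs, (n.testBit (number s) = true ∧ ∃ i, s i = false) ↔
    ∃ i, (c i).testBit (number s) = true
  center_lt : ∀ i, d i < 7
  center_mem : ∀ i, (c i).testBit (d i) = true
  star : ∀ i, ∀ s : Signs, (c i).testBit (number s) = true → ∀ r : Signs,
    (∀ l, r l = s l ∨ r l = signs (d i) l) → (c i).testBit (number r) = true
  disjoint : ∀ i j, i ≠ j → ∀ s : Signs, (c i).testBit (number s) = true → ∀ r : Signs,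
    (c j).testBit (number r) = true → ∀ l, s l = r l → s l = true

namespace Splits

variable {m n : ℕ} {c d : Fin m → ℕ} (h : Splits n c d) {b : ℝ}
include h

theorem part_eq (hb : b < 0) : part (config n) b = ⋃ i, part (config (c i)) b := by
  ext x
  rw [Set.mem_iUnion]
  constructor
  · rintro ⟨s, hs, hx⟩
    obtain ⟨i, hi⟩ := (h.union s).1 ⟨hs, by
      by_contra! hcon
      exact notMem_cell_of_neg hb (fun i => by simpa using hcon i) x hx⟩
    exact ⟨i, s, hi, hx⟩
  · rintro ⟨i, s, hs, hx⟩
    exact ⟨s, ((h.union s).2 ⟨i, hs⟩).1, hx⟩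

theorem exists_isInner (hb : -(1 / 4) < b) (i : Fin m) : ∃ o, IsInner b (signs (d i)) o :=
  exists_isInner_of_neg hb (exists_signs_eq_false _ ((h.center_lt i).trans (by norm_num))
    (h.center_lt i).ne)

theorem exists_isStar (hb : -(1 / 4) < b) (i : Fin m) :
    ∃ o g, IsStar (part (config (c i)) b) o g := by
  obtain ⟨o, ho⟩ := h.exists_isInner hb i
  have hs : IsStarAbout (config (c i)) (signs (d i)) :=
    ⟨(signs_mem_config ((h.center_lt i).trans (by norm_num))).2 (h.center_mem i), h.star i⟩
  exact ⟨o, hs.exists_isStar ho⟩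

theorem nonempty (hb : -(1 / 4) < b) (i : Fin m) : (part (config (c i)) b).Nonempty := by
  obtain ⟨o, ho⟩ := h.exists_isInner hb i
  exact ⟨o, signs (d i), (signs_mem_config ((h.center_lt i).trans (by norm_num))).2
    (h.center_mem i), interior_subset (ho.mem_interior (by simp))⟩

theorem notMem (hb : b < 0) (i j : Fin m) (hij : i ≠ j) (x : Fin 3 → ℝ)
    (hi : x ∈ part (config (c i)) b) : x ∉ part (config (c j)) b := by
  rintro ⟨r, hr, hxr⟩
  obtain ⟨s, hs, hxs⟩ := hi
  exact disjoint_cell hb (h.disjoint i j hij s hs r hr) hxs hxr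

end Splits

/-- The two pieces below the level of the vertex, and their centres, for the types 3 to 14. -/
def saddlePieces : Fin 12 → (Fin 2 → ℕ) × (Fin 2 → ℕ) :=
  ![(![32, 64], ![5, 6]), (![8, 32], ![3, 5]), (![8, 64], ![3, 6]), (![8, 112], ![3, 4]),
    (![42, 64], ![1, 6]), (![76, 32], ![2, 5]), (![34, 64], ![1, 6]), (![12, 32], ![2, 5]),
    (![8, 80], ![3, 4]), (![68, 32], ![2, 5]), (![8, 48], ![3, 4]), (![10, 64], ![1, 6])]

theorem splits_saddle (k : Fin 12) :
    Splits (typeCode (k.natAdd 2).castSucc) (saddlePieces k).1 (saddlePieces k).2 := by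
  constructor <;> revert k <;> decide +kernel

theorem splits_monkey : Splits (typeCode 14) ![8, 32, 64] ![3, 5, 6] := by
  constructor <;> decide +kernel

theorem config_typeCode_zero : config (typeCode 0) = {fun _ => true} := by
  ext s
  rw [config, Set.mem_ofPred_eq, Set.mem_singleton_iff]
  revert s
  decide +kernel

theorem config_typeCode_one : config (typeCode 1) = {s | s ≠ fun _ => false} := by
  ext s
  rw [config, Set.mem_ofPred_eq, Set.mem_ofPred_eq]
  revert s
  decide +kernel

theorem part_typeCode_zero {b : ℝ} (hb : b < 0) : part (config (typeCode 0)) b = ∅ := by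
  rw [config_typeCode_zero, part_singleton]
  exact Set.eq_empty_of_forall_notMem (notMem_cell_of_neg hb fun _ => rfl)

theorem unstacked_typeCode : ∀ k, unstacked (typeCode k) = true := by
  decide +kernel

theorem typeCode_lt : ∀ k, typeCode k < 255 := by
  decide

theorem typeCode_ne_zero : ∀ k, typeCode k ≠ 0 := by
  decide

/-- Above the level of the vertex an unstacked neighbourhood is a ball. -/
theorem nonempty_homeomorph_above {F : Type*} [NormedAddCommGroup F] [NormedSpace ℝ F]
    (L : (Fin 3 → ℝ) ≃L[ℝ] F) {n : ℕ} (hn : n < 256) (h0 : n ≠ 0) (hu : unstacked n = true) {ε : ℝ}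
    (hε : 0 < ε) : Nonempty (part (config n) ε ≃ₜ Metric.closedBall (0 : F) 1) := by
  rcases eq_or_ne n 255 with rfl | h255
  · have hall : IsStarAbout (config 255) fun _ => true := by
      have : ∀ s : Signs, s ∈ config 255 := fun s => by
        rw [config, Set.mem_ofPred_eq]; revert s; decide +kernel
      exact ⟨this _, fun _ _ r _ => this r⟩
    obtain ⟨o, ho⟩ := exists_isInner_of_pos hε fun _ => true
    obtain ⟨g, hg⟩ := hall.exists_isStar ho
    exact hg.nonempty_homeomorph_closedBall L
  · exact nonempty_homeomorph_of_collapsible L (neg := false) (by simpa [Admissible] using hε)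
      (collapsible_of_unstacked n (by omega) h0 hu)

/-- Below the level of the vertex an unstacked neighbourhood of none of the fifteen types is a
ball. -/
theorem nonempty_homeomorph_below {F : Type*} [NormedAddCommGroup F] [NormedSpace ℝ F]
    (L : (Fin 3 → ℝ) ≃L[ℝ] F) {n : ℕ} (hn : n < 256) (h0 : n ≠ 0) (hu : unstacked n = true)
    (hk : ∀ k, n ≠ typeCode k) {ε : ℝ} (hε : 0 < ε) (hε' : ε < 1 / 4) :
    Nonempty (part (config n) (-ε) ≃ₜ Metric.closedBall (0 : F) 1) := by
  have h7 : ∀ s : Signs, s ∈ config (n % 128) ↔ s ∈ config n ∧ ∃ i, s i = false := fun s => by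
    rw [config, config, Set.mem_ofPred_eq, Set.mem_ofPred_eq, show 128 = 2 ^ 7 by rfl,
      Nat.testBit_mod_two_pow, Bool.and_eq_true, decide_eq_true_iff, and_comm]
    exact and_congr_right fun _ =>
      (by decide : ∀ s : Signs, number s < 7 ↔ ∃ i, s i = false) s
  have hpart : part (config n) (-ε) = part (config (n % 128)) (-ε) := by
    ext x
    constructor
    · rintro ⟨s, hs, hx⟩
      refine ⟨s, (h7 s).2 ⟨hs, ?_⟩, hx⟩
      by_contra! hcon
      exact notMem_cell_of_neg (by linarith) (fun i => by simpa using hcon i) x hx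
    · rintro ⟨s, hs, hx⟩
      exact ⟨s, ((h7 s).1 hs).1, hx⟩
  rw [hpart]
  refine nonempty_homeomorph_of_collapsible L (neg := true) ?_
    (collapsible_of_unstacked_of_ne n hn h0 hu hk)
  have : (n % 128).testBit 7 = false := by
    rw [show 128 = 2 ^ 7 by rfl, Nat.testBit_mod_two_pow]; simp
  simp only [Admissible, if_true]
  exact ⟨by linarith, by linarith, this⟩

theorem preconnectedSpace_cylinder : PreconnectedSpace Cylinder :=
  isPreconnected_iff_preconnectedSpace.1 (convex_closedBall _ _).isPreconnected

theorem nonempty_homeomorph_above_typeCode {F : Type*} [NormedAddCommGroup F] [NormedSpace ℝ F]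
    (L : (Fin 3 → ℝ) ≃L[ℝ] F) (k : Fin 15) {ε : ℝ} (hε : 0 < ε) :
    Nonempty (part (config (typeCode k)) ε ≃ₜ Metric.closedBall (0 : F) 1) :=
  nonempty_homeomorph_above L ((typeCode_lt k).trans (by norm_num)) (typeCode_ne_zero k)
    (unstacked_typeCode k) hε

theorem Splits.isEmpty_homeomorph {m n : ℕ} {c d : Fin m → ℕ} (h : Splits n c d) {i j : Fin m}
    (hij : i ≠ j) {Z : Type*} [TopologicalSpace Z] [PreconnectedSpace Z] {ε : ℝ} (hε : 0 < ε)
    (hε' : ε < 1 / 4) : IsEmpty (part (config n) (-ε) ≃ₜ Z) := by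
  rw [h.part_eq (by linarith)]
  exact isEmpty_homeomorph_of_pieces (fun i => isClosed_part _ _)
    (h.notMem (by linarith)) hij (h.nonempty (by linarith) i) (h.nonempty (by linarith) j)

theorem exists_type_cases (k : Fin 15) :
    k = 0 ∨ k = 1 ∨ (∃ j : Fin 12, k = (j.natAdd 2).castSucc) ∨ k = 14 := by
  revert k; decide

/-- At a vertex of one of the fifteen types the sublevel sets are not homeomorphic. -/
theorem isEmpty_homeomorph_typeCode (k : Fin 15) {ε : ℝ} (hε : 0 < ε) (hε' : ε < 1 / 4) :
    IsEmpty (part (config (typeCode k)) (-ε) ≃ₜ part (config (typeCode k)) ε) := by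
  obtain ⟨e⟩ := nonempty_homeomorph_above_typeCode toCylinder k hε
  have := preconnectedSpace_cylinder
  suffices h : IsEmpty (part (config (typeCode k)) (-ε) ≃ₜ Cylinder) from
    ⟨fun f => h.elim (f.trans e)⟩
  rcases exists_type_cases k with rfl | rfl | ⟨j, rfl⟩ | rfl
  · rw [part_typeCode_zero (by linarith)]
    exact ⟨fun f => (f.symm ⟨0, by simp⟩).2.elim⟩
  · rw [config_typeCode_one]
    exact isEmpty_homeomorph_of_compl hε hε' (convex_closedBall _ _)
  · exact (splits_saddle j).isEmpty_homeomorph (i := 0) (j := 1) (by decide) hε hε'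
  · exact splits_monkey.isEmpty_homeomorph (i := 0) (j := 1) (by decide) hε hε'

/-- The types 1 to 14 attach one handle: to the empty set, along an annulus around the missing
lowest cell, or between two star bodies. -/
theorem attachesHandles_typeCode (k : Fin 14) {ε : ℝ} (hε : 0 < ε) (hε' : ε < 1 / 4) :
    AttachesHandles 1 (typeIndex k) (part (config (typeCode k.castSucc)) (-ε))
      (part (config (typeCode k.castSucc)) ε) := by
  have hk := (by decide : ∀ k : Fin 14, k = 0 ∨ k = 1 ∨ ∃ j : Fin 12, k = j.natAdd 2) k
  have hY := nonempty_homeomorph_above_typeCode toCylinder k.castSucc hε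
  rcases hk with rfl | rfl | ⟨j, rfl⟩
  · change AttachesHandles 1 0 (part (config (typeCode 0)) (-ε)) (part (config (typeCode 0)) ε)
    rw [part_typeCode_zero (by linarith)]
    exact attachesHandles_zero (nonempty_homeomorph_above_typeCode
      (ContinuousLinearEquiv.ofFinrankEq (by simp)) 0 hε)
  · change AttachesHandles 1 2 (part (config (typeCode 1)) (-ε)) (part (config (typeCode 1)) ε)
    change Nonempty (part (config (typeCode 1)) ε ≃ₜ Cylinder) at hY
    rw [config_typeCode_one] at hY ⊢
    exact attachesHandles_two hε hε' hY
  · have hidx := (by decide : ∀ j : Fin 12, typeIndex (j.natAdd 2) = 1) j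
    rw [hidx, (splits_saddle j).part_eq (by linarith)]
    exact attachesHandles_chain ((splits_saddle j).exists_isStar (by linarith))
      ((splits_saddle j).notMem (by linarith)) hY

theorem attachesHandles_monkey {ε : ℝ} (hε : 0 < ε) (hε' : ε < 1 / 4) :
    AttachesHandles 2 1 (part (config (typeCode 14)) (-ε)) (part (config (typeCode 14)) ε) := by
  rw [splits_monkey.part_eq (by linarith)]
  exact attachesHandles_chain (splits_monkey.exists_isStar (by linarith))
    (splits_monkey.notMem (by linarith)) (nonempty_homeomorph_above_typeCode toCylinder 14 hε)

theorem not_attachesHandles_monkey {i : ℕ} (hi : i = 1 ∨ i = 2) {ε : ℝ} (hε : 0 < ε)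
    (hε' : ε < 1 / 4) :
    ¬ AttachesHandles 1 i (part (config (typeCode 14)) (-ε)) (part (config (typeCode 14)) ε) := by
  obtain ⟨e⟩ := nonempty_homeomorph_above_typeCode toCylinder 14 hε
  have := preconnectedSpace_cylinder
  have : PreconnectedSpace (part (config (typeCode 14)) ε) :=
    e.symm.surjective.denseRange.preconnectedSpace e.symm.continuous
  rw [splits_monkey.part_eq (by linarith)]
  exact not_attachesHandles_of_pieces hi (fun i => isClosed_part _ _)
    (splits_monkey.notMem (by linarith)) (splits_monkey.nonempty (by linarith))

/-! ### The monkey saddle -/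

/-- The set of the points with at least two nonnegative coordinates. -/
def monkeyBody : Set (Fin 3 → ℝ) := {x | ∃ i j, i ≠ j ∧ 0 ≤ x i ∧ 0 ≤ x j}

/-- The surface of the points with at least two nonnegative, but at most one positive coordinate. -/
def monkeySurface : Set (Fin 3 → ℝ) :=
  {x | x ∈ monkeyBody ∧ ¬ ∃ i j, i ≠ j ∧ 0 < x i ∧ 0 < x j}

theorem isClosed_monkeyBody : IsClosed monkeyBody := by
  have : monkeyBody = ⋃ i, ⋃ j, ⋃ _ : i ≠ j, {x | 0 ≤ x i} ∩ {x | 0 ≤ x j} := by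
    ext x
    simp only [monkeyBody, Set.mem_ofPred_eq, Set.mem_iUnion, Set.mem_inter_iff, exists_prop]
  rw [this]
  refine isClosed_iUnion_of_finite fun i => isClosed_iUnion_of_finite fun j =>
    isClosed_iUnion_of_finite fun _ => ?_
  exact (isClosed_le continuous_const (continuous_apply i)).inter
    (isClosed_le continuous_const (continuous_apply j))

theorem frontier_monkeyBody : frontier monkeyBody = monkeySurface := by
  have hint : interior monkeyBody = {x | ∃ i j, i ≠ j ∧ 0 < x i ∧ 0 < x j} := by
    refine Set.Subset.antisymm (fun x hx => ?_) (interior_maximal ?_ ?_)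
    · have hc : Tendsto (fun (t : ℝ) (i : Fin 3) => x i - t) (𝓝[>] 0) (𝓝 x) := by
        have : Continuous fun (t : ℝ) (i : Fin 3) => x i - t := by fun_prop
        have h := (this.tendsto 0).mono_left (nhdsWithin_le_nhds (s := Set.Ioi 0))
        simpa using h
      obtain ⟨t, ⟨i, j, hij, hi, hj⟩, ht0 : 0 < t⟩ :=
        ((hc.eventually (mem_interior_iff_mem_nhds.1 hx)).and self_mem_nhdsWithin).exists
      exact ⟨i, j, hij, by linarith, by linarith⟩
    · rintro x ⟨i, j, hij, hi, hj⟩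
      exact ⟨i, j, hij, hi.le, hj.le⟩
    · have : {x : Fin 3 → ℝ | ∃ i j, i ≠ j ∧ 0 < x i ∧ 0 < x j} =
          ⋃ i, ⋃ j, ⋃ _ : i ≠ j, {x | 0 < x i} ∩ {x | 0 < x j} := by
        ext x
        simp only [Set.mem_ofPred_eq, Set.mem_iUnion, Set.mem_inter_iff, exists_prop]
      rw [this]
      refine isOpen_iUnion fun i => isOpen_iUnion fun j => isOpen_iUnion fun _ => ?_
      exact (isOpen_lt continuous_const (continuous_apply i)).inter
        (isOpen_lt continuous_const (continuous_apply j))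
  rw [isClosed_monkeyBody.frontier_eq, hint]
  rfl

/-- The largest of three numbers. -/
noncomputable def max3 (f : Fin 3 → ℝ) : ℝ := max (f 0) (max (f 1) (f 2))

/-- The smallest of three numbers. -/
noncomputable def min3 (f : Fin 3 → ℝ) : ℝ := min (f 0) (min (f 1) (f 2))

theorem eq_or_eq_or_eq {a b c : Fin 3} (hab : a ≠ b) (hac : a ≠ c) (hbc : b ≠ c) (i : Fin 3) :
    i = a ∨ i = b ∨ i = c := by
  omega

theorem max3_eq {f : Fin 3 → ℝ} {a : Fin 3} (h : ∀ i, f i ≤ f a) : max3 f = f a := by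
  refine le_antisymm (max_le (h 0) (max_le (h 1) (h 2))) ?_
  fin_cases a <;> simp [max3]

theorem min3_eq {f : Fin 3 → ℝ} {a : Fin 3} (h : ∀ i, f a ≤ f i) : min3 f = f a := by
  refine le_antisymm ?_ (le_min (h 0) (le_min (h 1) (h 2)))
  fin_cases a <;> simp [min3]

theorem add_eq_of_ne (f : Fin 3 → ℝ) {a b c : Fin 3} (hab : a ≠ b) (hac : a ≠ c) (hbc : b ≠ c) :
    f 0 + f 1 + f 2 = f a + f b + f c := by
  fin_cases a <;> fin_cases b <;> fin_cases c <;>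
    first
    | exact absurd rfl hab
    | exact absurd rfl hac
    | exact absurd rfl hbc
    | (simp only [Fin.zero_eta, Fin.mk_one, Fin.reduceFinMk] <;> ring)

theorem mul_eq_of_ne (f : Fin 3 → ℝ) {a b c : Fin 3} (hab : a ≠ b) (hac : a ≠ c) (hbc : b ≠ c) :
    f 0 * f 1 * f 2 = f a * f b * f c := by
  fin_cases a <;> fin_cases b <;> fin_cases c <;>
    first
    | exact absurd rfl hab
    | exact absurd rfl hac
    | exact absurd rfl hbc
    | (simp only [Fin.zero_eta, Fin.mk_one, Fin.reduceFinMk] <;> ring)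

theorem exists_sorted (f : Fin 3 → ℝ) :
    ∃ a b c : Fin 3, a ≠ b ∧ a ≠ c ∧ b ≠ c ∧ f b ≤ f a ∧ f c ≤ f b := by
  rcases le_total (f 0) (f 1) with h | h <;> rcases le_total (f 1) (f 2) with h' | h' <;>
    rcases le_total (f 0) (f 2) with h'' | h''
  · exact ⟨2, 1, 0, by decide, by decide, by decide, h', h⟩
  · exact ⟨2, 1, 0, by decide, by decide, by decide, h', h⟩
  · exact ⟨1, 2, 0, by decide, by decide, by decide, h', h''⟩
  · exact ⟨1, 0, 2, by decide, by decide, by decide, h, h''⟩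
  · exact ⟨2, 0, 1, by decide, by decide, by decide, h'', h⟩
  · exact ⟨0, 2, 1, by decide, by decide, by decide, h'', h'⟩
  · exact ⟨0, 1, 2, by decide, by decide, by decide, h, h'⟩
  · exact ⟨0, 1, 2, by decide, by decide, by decide, h, h'⟩

/-- `L` has the values `s (B + C)`, `-s B`, `-s C` with a sign `s` and `0 ≤ C ≤ B`. -/
structure IsSorted (L : Fin 3 → ℝ) (a b c : Fin 3) (s B C : ℝ) : Prop where
  hab : a ≠ b
  hac : a ≠ c
  hbc : b ≠ c
  sign : s = 1 ∨ s = -1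
  nonneg : 0 ≤ C
  le : C ≤ B
  eq_a : L a = s * (B + C)
  eq_b : L b = -(s * B)
  eq_c : L c = -(s * C)

theorem exists_isSorted {L : Fin 3 → ℝ} (h : L 0 + L 1 + L 2 = 0) :
    ∃ a b c s B C, IsSorted L a b c s B C := by
  obtain ⟨a, b, c, hab, hac, hbc, h1, h2⟩ := exists_sorted fun i => |L i|
  rw [add_eq_of_ne L hab hac hbc] at h
  rcases le_total 0 (L a) with ha | ha
  · rw [abs_of_nonneg ha] at h1
    have hb := abs_le.1 h1
    have hc := abs_le.1 (h2.trans h1)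
    rw [abs_of_nonpos (by linarith), abs_of_nonpos (by linarith)] at h2
    exact ⟨a, b, c, 1, -L b, -L c, hab, hac, hbc, Or.inl rfl, by linarith, by linarith,
      by linarith, by ring, by ring⟩
  · rw [abs_of_nonpos ha] at h1
    have hb := abs_le.1 h1
    have hc := abs_le.1 (h2.trans h1)
    rw [abs_of_nonneg (by linarith), abs_of_nonneg (by linarith)] at h2
    exact ⟨a, b, c, -1, L b, L c, hab, hac, hbc, Or.inr rfl, by linarith, by linarith,
      by linarith, by ring, by ring⟩

/-- The map of the plane `L₀ + L₁ + L₂ = 0` onto the surface: the coordinate that is smallest in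
absolute value becomes zero, and the sum of the coordinates becomes `L₀ L₁ L₂ / 2`. -/
noncomputable def bend (L : Fin 3 → ℝ) (i : Fin 3) : ℝ :=
  max3 (fun j => |L j|) * (L i * (|L i| - min3 fun j => |L j|)) / 4

namespace IsSorted

variable {L : Fin 3 → ℝ} {a b c : Fin 3} {s B C : ℝ} (h : IsSorted L a b c s B C)
include h

theorem abs_s : |s| = 1 := by rcases h.sign with rfl | rfl <;> simp
theorem sq_s : s * s = 1 := by rcases h.sign with rfl | rfl <;> norm_num
theorem B_nonneg : 0 ≤ B := h.nonneg.trans h.le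

theorem abs_a : |L a| = B + C := by
  rw [h.eq_a, abs_mul, h.abs_s, one_mul, abs_of_nonneg (add_nonneg h.B_nonneg h.nonneg)]
theorem abs_b : |L b| = B := by
  rw [h.eq_b, abs_neg, abs_mul, h.abs_s, one_mul, abs_of_nonneg h.B_nonneg]
theorem abs_c : |L c| = C := by
  rw [h.eq_c, abs_neg, abs_mul, h.abs_s, one_mul, abs_of_nonneg h.nonneg]

theorem max3_abs : max3 (fun j => |L j|) = B + C := by
  rw [max3_eq (a := a), h.abs_a]
  intro i
  have := h.nonneg
  have := h.B_nonneg
  rcases eq_or_eq_or_eq h.hab h.hac h.hbc i with rfl | rfl | rfl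
  · exact le_rfl
  · rw [h.abs_a, h.abs_b]; linarith
  · rw [h.abs_a, h.abs_c]; linarith

theorem min3_abs : min3 (fun j => |L j|) = C := by
  rw [min3_eq (a := c), h.abs_c]
  intro i
  have := h.B_nonneg
  rcases eq_or_eq_or_eq h.hab h.hac h.hbc i with rfl | rfl | rfl
  · rw [h.abs_a, h.abs_c]; linarith
  · rw [h.abs_b, h.abs_c]; exact h.le
  · exact le_rfl

theorem bend_a : bend L a = s * ((B + C) * (B + C) * B / 4) := by
  rw [bend, h.max3_abs, h.min3_abs, h.abs_a, h.eq_a]; ring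
theorem bend_b : bend L b = -(s * ((B + C) * B * (B - C) / 4)) := by
  rw [bend, h.max3_abs, h.min3_abs, h.abs_b, h.eq_b]; ring
theorem bend_c : bend L c = 0 := by
  rw [bend, h.max3_abs, h.min3_abs, h.abs_c]; ring

theorem bend_a_nonneg : 0 ≤ (B + C) * (B + C) * B / 4 := by
  have := h.nonneg
  have := h.B_nonneg
  positivity
theorem bend_b_nonneg : 0 ≤ (B + C) * B * (B - C) / 4 := by
  have := h.nonneg
  have := h.B_nonneg
  have := sub_nonneg.2 h.le
  positivity

theorem diag_bend : diag (bend L) = L 0 * L 1 * L 2 / 2 := by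
  rw [diag, add_eq_of_ne _ h.hab h.hac h.hbc, mul_eq_of_ne _ h.hab h.hac h.hbc, h.bend_a, h.bend_b,
    h.bend_c, h.eq_a, h.eq_b, h.eq_c]
  linear_combination (-(s * B * C * (B + C) / 2)) * h.sq_s

theorem bend_mem : bend L ∈ monkeySurface := by
  have ha := h.bend_a_nonneg
  have hb := h.bend_b_nonneg
  have eA := h.bend_a
  have eB := h.bend_b
  have eC := h.bend_c
  rcases h.sign with rfl | rfl
  · refine ⟨⟨a, c, h.hac, by rw [eA]; linarith, eC.ge⟩, ?_⟩
    rintro ⟨i, j, hij, hi, hj⟩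
    have key : ∀ i, 0 < bend L i → i = a := fun i hi => by
      rcases eq_or_eq_or_eq h.hab h.hac h.hbc i with rfl | rfl | rfl
      · rfl
      · linarith
      · linarith
    exact hij ((key i hi).trans (key j hj).symm)
  · refine ⟨⟨b, c, h.hbc, by rw [eB]; linarith, eC.ge⟩, ?_⟩
    rintro ⟨i, j, hij, hi, hj⟩
    have key : ∀ i, 0 < bend L i → i = b := fun i hi => by
      rcases eq_or_eq_or_eq h.hab h.hac h.hbc i with rfl | rfl | rfl
      · linarith
      · rfl
      · linarith
    exact hij ((key i hi).trans (key j hj).symm)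

theorem max3_bend : max3 (fun i => |bend L i|) = (B + C) * (B + C) * B / 4 := by
  have h1 := h.nonneg
  have h2 := h.B_nonneg
  have ha : |bend L a| = (B + C) * (B + C) * B / 4 := by
    rw [h.bend_a, abs_mul, h.abs_s, one_mul, abs_of_nonneg h.bend_a_nonneg]
  have hb : |bend L b| = (B + C) * B * (B - C) / 4 := by
    rw [h.bend_b, abs_neg, abs_mul, h.abs_s, one_mul, abs_of_nonneg h.bend_b_nonneg]
  rw [max3_eq (a := a), ha]
  intro i
  rcases eq_or_eq_or_eq h.hab h.hac h.hbc i with rfl | rfl | rfl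
  · exact le_rfl
  · rw [ha, hb]
    have : 0 ≤ (B + C) * B * (2 * C) := by positivity
    linarith
  · rw [ha, h.bend_c, abs_zero]; exact h.bend_a_nonneg

theorem sum_bend : |bend L 0| + |bend L 1| + |bend L 2| = (B + C) * B * B / 2 := by
  have ha : |bend L a| = (B + C) * (B + C) * B / 4 := by
    rw [h.bend_a, abs_mul, h.abs_s, one_mul, abs_of_nonneg h.bend_a_nonneg]
  have hb : |bend L b| = (B + C) * B * (B - C) / 4 := by
    rw [h.bend_b, abs_neg, abs_mul, h.abs_s, one_mul, abs_of_nonneg h.bend_b_nonneg]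
  rw [add_eq_of_ne (fun i => |bend L i|) h.hab h.hac h.hbc, ha, hb, h.bend_c, abs_zero]
  ring

end IsSorted

/-- The numbers `A` and `B` are determined by `A² B` and `A B²`, hence `B + C` and `B` by the
largest absolute value of a coordinate of `bend L` and the sum of the absolute values. -/
theorem eq_of_mul_eq {A B A' B' : ℝ} (hA : 0 ≤ A) (hB : 0 ≤ B) (hA' : 0 ≤ A') (hB' : 0 ≤ B')
    (h2 : A ≤ 2 * B) (h2' : A' ≤ 2 * B') (hBA : B ≤ A) (hBA' : B' ≤ A')
    (e1 : A * A * B = A' * A' * B') (e2 : A * B * B = A' * B' * B') : A = A' ∧ B = B' := by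
  have e3 : (A * B) ^ 3 = (A' * B') ^ 3 := by
    calc (A * B) ^ 3 = (A * A * B) * (A * B * B) := by ring
      _ = (A' * B') ^ 3 := by rw [e1, e2]; ring
  have e4 : A * B = A' * B' :=
    (pow_left_inj₀ (mul_nonneg hA hB) (mul_nonneg hA' hB') three_ne_zero).1 e3
  rcases eq_or_ne (A * B) 0 with h0 | h0
  · have z : ∀ x y : ℝ, 0 ≤ x → 0 ≤ y → x ≤ 2 * y → y ≤ x → x * y = 0 → x = 0 ∧ y = 0 := by
      intro x y hx hy h1 h2 h
      rcases mul_eq_zero.1 h with h | h <;> constructor <;> linarith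
    have z1 := z A B hA hB h2 hBA h0
    have z2 := z A' B' hA' hB' h2' hBA' (e4 ▸ h0)
    exact ⟨z1.1.trans z2.1.symm, z1.2.trans z2.2.symm⟩
  · constructor
    · refine mul_right_cancel₀ h0 ?_
      calc A * (A * B) = A * A * B := by ring
        _ = A' * (A' * B') := by rw [e1]; ring
        _ = A' * (A * B) := by rw [e4]
    · refine mul_left_cancel₀ h0 ?_
      rw [e2, e4]

/-- The only coincidence among the solutions of `t (|t| - m) = y` with `|t| ≥ m` is `t = ± m`. -/
theorem eq_or_eq_neg_of_mul_abs_sub_eq {m t u : ℝ} (hm : 0 ≤ m) (ht : m ≤ |t|) (hu : m ≤ |u|)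
    (h : t * (|t| - m) = u * (|u| - m)) : t = u ∨ (|t| = m ∧ t = -u) := by
  rcases le_total 0 t with h0 | h0 <;> rcases le_total 0 u with h1 | h1
  · rw [abs_of_nonneg h0] at *
    rw [abs_of_nonneg h1] at *
    left
    rcases lt_trichotomy t u with hlt | he | hlt
    · nlinarith
    · exact he
    · nlinarith
  · rw [abs_of_nonneg h0] at *
    rw [abs_of_nonpos h1] at *
    have a1 : 0 ≤ t * (t - m) := mul_nonneg h0 (by linarith)
    have a2 : u * (-u - m) ≤ 0 := mul_nonpos_of_nonpos_of_nonneg h1 (by linarith)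
    rcases mul_eq_zero.1 (le_antisymm (h ▸ a2) a1) with b1 | b1 <;>
      rcases mul_eq_zero.1 (le_antisymm a2 (h ▸ a1)) with b2 | b2
    · left; linarith
    · left; linarith
    · left; linarith
    · right; constructor <;> linarith
  · rw [abs_of_nonpos h0] at *
    rw [abs_of_nonneg h1] at *
    have a1 : 0 ≤ u * (u - m) := mul_nonneg h1 (by linarith)
    have a2 : t * (-t - m) ≤ 0 := mul_nonpos_of_nonpos_of_nonneg h0 (by linarith)
    rcases mul_eq_zero.1 (le_antisymm a2 (h ▸ a1)) with b1 | b1 <;>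
      rcases mul_eq_zero.1 (le_antisymm (h ▸ a2) a1) with b2 | b2
    · left; linarith
    · left; linarith
    · left; linarith
    · right; constructor <;> linarith
  · rw [abs_of_nonpos h0] at *
    rw [abs_of_nonpos h1] at *
    left
    rcases lt_trichotomy t u with hlt | he | hlt
    · nlinarith
    · exact he
    · nlinarith

/-- The largest and the smallest `|Lᵢ|` can be read off from `bend L`, and then every coordinate
`Lᵢ`, up to the sign where `|Lᵢ|` is smallest; this sign is fixed by the sum being zero. -/
theorem bend_injective {L L' : Fin 3 → ℝ} (hL : L 0 + L 1 + L 2 = 0)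
    (hL' : L' 0 + L' 1 + L' 2 = 0) (h : bend L = bend L') : L = L' := by
  obtain ⟨a, b, c, s, B, C, hs⟩ := exists_isSorted hL
  obtain ⟨a', b', c', s', B', C', hs'⟩ := exists_isSorted hL'
  have e1 := hs.max3_bend
  have e2 := hs.sum_bend
  rw [h] at e1 e2
  rw [hs'.max3_bend] at e1
  rw [hs'.sum_bend] at e2
  have := hs.nonneg
  have := hs'.nonneg
  have := hs.le
  have := hs'.le
  obtain ⟨eA, eB⟩ := eq_of_mul_eq (A := B + C) (B := B) (A' := B' + C') (B' := B') (by linarith)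
    (by linarith) (by linarith) (by linarith) (by linarith) (by linarith) (by linarith)
    (by linarith) (by linarith) (by linarith)
  have eC : C = C' := by linarith
  subst eB
  subst eC
  rcases eq_or_ne (B + C) 0 with h0 | h0
  · have hz : ∀ (M : Fin 3 → ℝ) (a b c : Fin 3) (s : ℝ), IsSorted M a b c s B C → M = 0 := by
      intro M a b c s hM
      have hB : B = 0 := by linarith
      have hC : C = 0 := by linarith
      funext i
      rcases eq_or_eq_or_eq hM.hab hM.hac hM.hbc i with rfl | rfl | rfl
      · rw [hM.eq_a, hB, hC]; simp
      · rw [hM.eq_b, hB]; simp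
      · rw [hM.eq_c, hC]; simp
    rw [hz _ _ _ _ _ hs, hz _ _ _ _ _ hs']
  have hge : ∀ (M : Fin 3 → ℝ) (a b c : Fin 3) (s : ℝ), IsSorted M a b c s B C →
      ∀ i, C ≤ |M i| := by
    intro M a b c s hM i
    rcases eq_or_eq_or_eq hM.hab hM.hac hM.hbc i with rfl | rfl | rfl
    · rw [hM.abs_a]; linarith
    · rw [hM.abs_b]; linarith
    · rw [hM.abs_c]
  have hcase : ∀ i, L i = L' i ∨ (|L i| = C ∧ L i = -L' i) := fun i => by
    have := congrFun h i
    rw [bend, bend, hs.max3_abs, hs.min3_abs, hs'.max3_abs, hs'.min3_abs] at this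
    refine eq_or_eq_neg_of_mul_abs_sub_eq hs.nonneg (hge L _ _ _ _ hs i) (hge L' _ _ _ _ hs' i) ?_
    exact mul_left_cancel₀ h0 (by linarith)
  -- two coordinates with opposite values leave nothing for the third
  have third : ∀ i j k, i ≠ j → i ≠ k → j ≠ k → |L i| = C → L i + L j = 0 → C = 0 := by
    intro i j k hij hik hjk hi hj
    rw [add_eq_of_ne L hij hik hjk] at hL
    have hk := hge L _ _ _ _ hs k
    rw [show L k = 0 by linarith, abs_zero] at hk
    linarith
  have two : ∀ i j k, i ≠ j → i ≠ k → j ≠ k → L i ≠ L' i → False := by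
    intro i j k hij hik hjk hne
    rcases hcase i with h1 | ⟨h1, h1'⟩
    · exact hne h1
    have hC : C = 0 → False := fun hC => by
      rw [hC, abs_eq_zero] at h1
      exact hne (by linarith)
    have t1 := third i j k hij hik hjk h1
    have t2 := third i k j hik hij hjk.symm h1
    rw [add_eq_of_ne L hij hik hjk] at hL
    rw [add_eq_of_ne L' hij hik hjk] at hL'
    rcases hcase j with h2 | ⟨h2, h2'⟩ <;> rcases hcase k with h3 | ⟨h3, h3'⟩
    · exact hne (by linarith)
    · exact hC (t2 (by linarith))
    · exact hC (t1 (by linarith))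
    · rcases abs_cases (L i) with ⟨x1, -⟩ | ⟨x1, -⟩ <;>
        rcases abs_cases (L j) with ⟨x2, -⟩ | ⟨x2, -⟩ <;>
        rcases abs_cases (L k) with ⟨x3, -⟩ | ⟨x3, -⟩ <;> exact hC (by linarith)
  funext i
  by_contra hne
  obtain ⟨j, k, hij, hik, hjk, -⟩ := exists_other_axes i
  exact two i j k hij hik hjk hne

theorem exists_cube_root {y : ℝ} (hy : 0 < y) : ∃ r : ℝ, 0 < r ∧ r * r * r = y := by
  refine ⟨y ^ (1 / 3 : ℝ), Real.rpow_pos_of_pos hy _, ?_⟩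
  rw [← Real.rpow_add hy, ← Real.rpow_add hy]
  norm_num

/-- The map `bend` is onto the surface: a preimage is found by extracting two cube roots. -/
theorem exists_bend_eq {x : Fin 3 → ℝ} (hx : x ∈ monkeySurface) :
    ∃ L : Fin 3 → ℝ, L 0 + L 1 + L 2 = 0 ∧ bend L = x := by
  obtain ⟨⟨p, q, hpq, hp, hq⟩, hpos⟩ := hx
  have hP : ∀ i j, i ≠ j → x i ≤ 0 ∨ x j ≤ 0 := fun i j hij => by
    by_contra! hcon
    exact hpos ⟨i, j, hij, hcon.1, hcon.2⟩
  have hN : ∀ i j, i ≠ j → 0 ≤ x i ∨ 0 ≤ x j := fun i j hij => by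
    by_cases h1 : i = p
    · exact Or.inl (h1 ▸ hp)
    by_cases h2 : i = q
    · exact Or.inl (h2 ▸ hq)
    right
    have : j = p ∨ j = q := by omega
    rcases this with rfl | rfl <;> assumption
  obtain ⟨a, b, c, hab, hac, hbc, h1, h2⟩ := exists_sorted fun i => |x i|
  have P1 := hP a b hab
  have P2 := hP a c hac
  have P3 := hP b c hbc
  have N1 := hN a b hab
  have N2 := hN a c hac
  have N3 := hN b c hbc
  -- one coordinate vanishes and the two others have opposite signs
  obtain ⟨s, hs, α, β, hβ, hβα, ea, eb, ec⟩ : ∃ s : ℝ, (s = 1 ∨ s = -1) ∧ ∃ α β : ℝ, 0 ≤ β ∧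
      β ≤ α ∧ x a = s * α ∧ x b = -(s * β) ∧ x c = 0 := by
    rcases abs_cases (x a) with ⟨x1, y1⟩ | ⟨x1, y1⟩
    · refine ⟨1, Or.inl rfl, x a, -x b, ?_⟩
      rcases abs_cases (x b) with ⟨x2, y2⟩ | ⟨x2, y2⟩ <;>
        rcases abs_cases (x c) with ⟨x3, y3⟩ | ⟨x3, y3⟩ <;> rw [x1, x2] at h1 <;>
        rw [x2, x3] at h2 <;> refine ⟨?_, ?_, ?_, ?_, ?_⟩ <;> grind
    · refine ⟨-1, Or.inr rfl, -x a, x b, ?_⟩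
      rcases abs_cases (x b) with ⟨x2, y2⟩ | ⟨x2, y2⟩ <;>
        rcases abs_cases (x c) with ⟨x3, y3⟩ | ⟨x3, y3⟩ <;> rw [x1, x2] at h1 <;>
        rw [x2, x3] at h2 <;> refine ⟨?_, ?_, ?_, ?_, ?_⟩ <;> grind
  rcases eq_or_ne α 0 with h0 | h0
  · refine ⟨0, by simp, ?_⟩
    funext i
    have hb0 : β = 0 := by linarith
    simp only [bend, Pi.zero_apply, zero_mul, mul_zero, zero_div]
    rcases eq_or_eq_or_eq hab hac hbc i with rfl | rfl | rfl
    · rw [ea, h0, mul_zero]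
    · rw [eb, hb0, mul_zero, neg_zero]
    · rw [ec]
  have hα : 0 < α := lt_of_le_of_ne (hβ.trans hβα) (Ne.symm h0)
  obtain ⟨r, hr, er⟩ := exists_cube_root (y := 4 * α) (by linarith)
  obtain ⟨w, hw, ew⟩ := exists_cube_root (y := 2 * (α + β)) (by linarith)
  -- with `A = B + C` one needs `A² B = r³` and `A B² = w³`
  set A := r * r / w with hA
  set B := w * w / r with hB
  have hAB : A * B = r * w := by rw [hA, hB]; field_simp
  have hA2 : A ≤ 2 * B := by
    rw [hA, hB, div_le_iff₀ hw]
    have : 2 * (w * w / r) * w = 2 * (w * w * w) / r := by ring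
    rw [this, le_div_iff₀ hr, er, ew]
    linarith
  have hBA : B ≤ A := by
    rw [hA, hB, div_le_div_iff₀ hr hw, er, ew]
    linarith
  have hBpos : 0 < B := by positivity
  let L : Fin 3 → ℝ := fun i => if i = a then s * A else if i = b then -(s * B) else -(s * (A - B))
  have hsort : IsSorted L a b c s B (A - B) :=
    ⟨hab, hac, hbc, hs, by linarith, by linarith, by simp [L], by simp [L, hab.symm],
      by simp [L, hac.symm, hbc.symm]⟩
  have e1 : A * A * B = 4 * α := by
    rw [mul_assoc, hAB, hA, ← er]; field_simp
  have e2 : A * B * B = 2 * (α + β) := by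
    rw [hAB, hB, ← ew]; field_simp
  refine ⟨L, ?_, ?_⟩
  · rw [add_eq_of_ne L hab hac hbc, hsort.eq_a, hsort.eq_b, hsort.eq_c]; ring
  · funext i
    rcases eq_or_eq_or_eq hab hac hbc i with rfl | rfl | rfl
    · rw [hsort.bend_a, ea]
      linear_combination (s / 4) * e1
    · rw [hsort.bend_b, eb]
      linear_combination (s / 4) * e1 - (s / 2) * e2
    · rw [hsort.bend_c, ec]

/-- The plane `L₀ + L₁ + L₂ = 0`, with the coordinates in which `L₀ L₁ L₂ / 2` is `x³ - x y²`. -/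
def tripod (p : ℝ × ℝ) : Fin 3 → ℝ := ![2 * p.1, p.2 - p.1, -p.1 - p.2]

theorem tripod_sum (p : ℝ × ℝ) : tripod p 0 + tripod p 1 + tripod p 2 = 0 := by
  simp [tripod]; ring

/-- The inverse of the chart of the monkey saddle. -/
noncomputable def monkeyMap (p : ℝ × ℝ) : Fin 3 → ℝ := bend (tripod p)

theorem continuous_monkeyMap : Continuous monkeyMap := by
  have h : ∀ i, Continuous fun p => tripod p i := fun i => by
    fin_cases i <;> simp [tripod] <;> fun_prop
  refine continuous_pi fun i => ?_
  exact ((((h 0).abs.max ((h 1).abs.max (h 2).abs)).mul ((h i).mul ((h i).abs.sub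
    ((h 0).abs.min ((h 1).abs.min (h 2).abs))))).div_const 4)

theorem diag_monkeyMap (p : ℝ × ℝ) : diag (monkeyMap p) = p.1 ^ 3 - p.1 * p.2 ^ 2 := by
  obtain ⟨a, b, c, s, B, C, h⟩ := exists_isSorted (tripod_sum p)
  rw [monkeyMap, h.diag_bend]
  simp [tripod]
  ring

theorem monkeyMap_injective : Function.Injective monkeyMap := by
  intro p q h
  have := bend_injective (tripod_sum p) (tripod_sum q) h
  have h0 := congrFun this 0
  have h1 := congrFun this 1
  simp [tripod] at h0 h1
  exact Prod.ext h0 (by linarith)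

theorem range_monkeyMap : Set.range monkeyMap = monkeySurface := by
  refine Set.Subset.antisymm ?_ fun x hx => ?_
  · rintro _ ⟨p, rfl⟩
    obtain ⟨a, b, c, s, B, C, h⟩ := exists_isSorted (tripod_sum p)
    exact h.bend_mem
  · obtain ⟨L, hL, rfl⟩ := exists_bend_eq hx
    refine ⟨(L 0 / 2, L 1 + L 0 / 2), congrArg bend ?_⟩
    funext i
    fin_cases i
    · simp [tripod]; ring
    · simp [tripod]
    · simp [tripod]; linarith

/-- The map is proper, since it grows at least like a cubic polynomial. -/
theorem norm_le_norm_monkeyMap (p : ℝ × ℝ) : (‖p‖ / 2) ^ 3 / 8 ≤ ‖monkeyMap p‖ := by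
  obtain ⟨a, b, c, s, B, C, h⟩ := exists_isSorted (tripod_sum p)
  have hC := h.nonneg
  have hB := h.B_nonneg
  have hCB := h.le
  have hle : ∀ i, |tripod p i| ≤ B + C := fun i => by
    rcases eq_or_eq_or_eq h.hab h.hac h.hbc i with rfl | rfl | rfl
    · exact h.abs_a.le
    · rw [h.abs_b]; linarith
    · rw [h.abs_c]; linarith
  have h0 := abs_le.1 (hle 0)
  have h1 := abs_le.1 (hle 1)
  simp [tripod] at h0 h1
  have hp : ‖p‖ ≤ 2 * (B + C) := by
    rw [Prod.norm_def, max_le_iff, Real.norm_eq_abs, Real.norm_eq_abs, abs_le, abs_le]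
    refine ⟨⟨?_, ?_⟩, ?_, ?_⟩ <;> linarith
  have hx : (B + C) * (B + C) * B / 4 ≤ ‖monkeyMap p‖ := by
    have := norm_le_pi_norm (monkeyMap p) a
    rwa [monkeyMap, h.bend_a, Real.norm_eq_abs, abs_mul, h.abs_s, one_mul,
      abs_of_nonneg h.bend_a_nonneg] at this
  refine le_trans ?_ hx
  have e1 : (‖p‖ / 2) ^ 3 ≤ (B + C) ^ 3 := by
    gcongr
    linarith
  have e2 : (B + C) ^ 3 ≤ (B + C) * (B + C) * (2 * B) := by
    rw [pow_succ, pow_two]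
    gcongr
    linarith
  linarith

theorem isClosedEmbedding_monkeyMap : IsClosedEmbedding monkeyMap := by
  refine .of_continuous_injective_isClosedMap continuous_monkeyMap monkeyMap_injective ?_
  refine (isProperMap_iff_tendsto_cocompact.2 ⟨continuous_monkeyMap, ?_⟩).isClosedMap
  rw [← Metric.cobounded_eq_cocompact (α := Fin 3 → ℝ), ← tendsto_norm_atTop_iff_cobounded]
  refine tendsto_atTop_mono norm_le_norm_monkeyMap ?_
  refine Tendsto.atTop_div_const (by norm_num) ((tendsto_pow_atTop three_ne_zero).comp ?_)
  exact (tendsto_norm_cocompact_atTop (E := ℝ × ℝ)).atTop_div_const (by norm_num)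

/-- If, close to `v`, a set is the body of the monkey saddle, then its frontier has the chart of the
monkey saddle at `v`. -/
theorem exists_monkey_chart {S : Set (Fin 3 → ℝ)} {v : Fin 3 → ℝ}
    (hS : ∀ x, ‖x - v‖ < 1 → (x ∈ S ↔ x - v ∈ monkeyBody)) :
    ∃ (hv : v ∈ frontier S) (e : OpenPartialHomeomorph (frontier S) (ℝ × ℝ)),
      (⟨v, hv⟩ : frontier S) ∈ e.source ∧ e ⟨v, hv⟩ = 0 ∧
      ∀ x ∈ e.source, diag (x : Fin 3 → ℝ) - diag v = (e x).1 ^ 3 - (e x).1 * (e x).2 ^ 2 := by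
  let O : Set (Fin 3 → ℝ) := {x | ‖x - v‖ < 1}
  have hO : IsOpen O := isOpen_lt (by fun_prop) continuous_const
  let τ : (Fin 3 → ℝ) ≃ₜ (Fin 3 → ℝ) := Homeomorph.subRight v
  have hloc : ∀ x ∈ O, x ∈ frontier S ↔ x - v ∈ Set.range monkeyMap := by
    intro x hx
    have e1 : S ∩ O = τ ⁻¹' monkeyBody ∩ O := by
      ext y
      exact and_congr_left fun hy => hS y hy
    have e2 : frontier S ∩ O = frontier (τ ⁻¹' monkeyBody) ∩ O := by
      rw [← frontier_inter_open_inter hO, e1, frontier_inter_open_inter hO]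
    rw [← τ.preimage_frontier, frontier_monkeyBody, ← range_monkeyMap] at e2
    have := Set.ext_iff.1 e2 x
    simpa [hx, τ] using this
  let W : Set (ℝ × ℝ) := {p | ‖monkeyMap p‖ < 1}
  have hW : IsOpen W := isOpen_lt continuous_monkeyMap.norm continuous_const
  have h0 : monkeyMap 0 = 0 := by
    funext i; simp only [monkeyMap, bend]; fin_cases i <;> simp [tripod]
  have hmO : ∀ p ∈ W, v + monkeyMap p ∈ O := fun p hp => by
    have : ‖monkeyMap p‖ < 1 := hp
    simpa [O] using this
  have hmem : ∀ p ∈ W, v + monkeyMap p ∈ frontier S := fun p hp =>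
    (hloc _ (hmO p hp)).2 (by simp)
  let κ : W → frontier S := fun p => ⟨v + monkeyMap p, hmem p p.2⟩
  have hκ : IsOpenEmbedding κ := by
    refine ⟨?_, ?_⟩
    · refine IsEmbedding.codRestrict ?_ _ _
      exact ((Homeomorph.addLeft v).isEmbedding.comp isClosedEmbedding_monkeyMap.isEmbedding).comp
        IsEmbedding.subtypeVal
    · have : Set.range κ = Subtype.val ⁻¹' O := by
        ext x
        constructor
        · rintro ⟨p, rfl⟩
          exact hmO p p.2
        · intro hx
          obtain ⟨p, hp⟩ := (hloc x hx).1 x.2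
          have hpW : p ∈ W := by
            change ‖monkeyMap p‖ < 1
            rw [hp]; exact hx
          exact ⟨⟨p, hpW⟩, Subtype.ext (by simp [κ, hp])⟩
      rw [this]
      exact hO.preimage continuous_subtype_val
  have h0W : (0 : ℝ × ℝ) ∈ W := by simp [W, h0]
  have : Nonempty W := ⟨⟨0, h0W⟩⟩
  let e₁ := hκ.toOpenPartialHomeomorph κ
  let e₂ := hW.isOpenEmbedding_subtypeVal.toOpenPartialHomeomorph (Subtype.val : W → ℝ × ℝ)
  have he : ∀ p : W, e₁.symm (κ p) = p := fun p => e₁.left_inv (x := p) (by simp [e₁])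
  have hsrc : (e₁.symm.trans e₂).source = Set.range κ := by
    simp [e₁, e₂]
  have hval : ∀ p : W, (e₁.symm.trans e₂) (κ p) = p := fun p => by
    rw [OpenPartialHomeomorph.trans_apply, he]; rfl
  have hv : v ∈ frontier S := by simpa [h0] using hmem 0 h0W
  have hκ0 : κ ⟨0, h0W⟩ = ⟨v, hv⟩ := Subtype.ext (by simp [κ, h0])
  refine ⟨hv, e₁.symm.trans e₂, ?_, ?_, ?_⟩
  · rw [hsrc, ← hκ0]; exact ⟨_, rfl⟩
  · rw [← hκ0, hval]
  · intro x hx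
    rw [hsrc] at hx
    obtain ⟨p, rfl⟩ := hx
    rw [hval, ← diag_monkeyMap]
    simp only [κ, diag, Pi.add_apply]
    ring

/-! ### Vertices of a body -/

theorem mem_cube_octant_iff {v : Fin 3 → ℤ} {s : Signs} {x : Fin 3 → ℝ} :
    x ∈ cube (octant v s) ↔ ∀ i, 0 ≤ sgn (s i) * (x i - v i) ∧ |x i - v i| ≤ 1 := by
  refine forall_congr' fun i => ?_
  rw [abs_le]
  cases h : s i
  · have e : ((octant v s i : ℤ) : ℝ) = v i - 1 := by simp [octant, h]
    have e' : sgn false = -1 := rfl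
    rw [e, e']
    constructor
    · rintro ⟨h1, h2⟩
      refine ⟨?_, ?_, ?_⟩ <;> linarith
    · rintro ⟨h1, h2, h3⟩
      constructor <;> linarith
  · have e : ((octant v s i : ℤ) : ℝ) = v i := by simp [octant, h]
    have e' : sgn true = 1 := rfl
    rw [e, e']
    constructor
    · rintro ⟨h1, h2⟩
      refine ⟨?_, ?_, ?_⟩ <;> linarith
    · rintro ⟨h1, h2, h3⟩
      constructor <;> linarith

/-- The sublevel sets at a vertex are translates of the model sets at the origin. -/
theorem sublevel_eq (M : Set (Fin 3 → ℤ)) (v : Fin 3 → ℤ) (b : ℝ) :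
    sublevel M v (diag (pt v) + b) =
      Homeomorph.subRight (pt v) ⁻¹' part {s | octant v s ∈ M} b := by
  ext x
  have hd : diag x ≤ diag (pt v) + b ↔ diag (x - pt v) ≤ b := by
    simp only [diag, Pi.sub_apply]
    constructor <;> intro h <;> linarith
  simp only [sublevel, nbhd, Set.mem_ofPred_eq, Set.mem_iUnion, exists_prop, mem_cube_octant_iff,
    part, Set.mem_preimage, Homeomorph.coe_subRight, mem_cell, hd, forall_and, Pi.sub_apply, pt]
  constructor
  · rintro ⟨⟨s, hs, hx⟩, hb⟩
    exact ⟨s, hs, hx.1, hx.2, hb⟩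
  · rintro ⟨s, hs, h1, h2, hb⟩
    exact ⟨⟨s, hs, h1, h2⟩, hb⟩

theorem nonempty_homeomorph_sublevel (M : Set (Fin 3 → ℤ)) (v : Fin 3 → ℤ) (b : ℝ) :
    Nonempty (sublevel M v (diag (pt v) + b) ≃ₜ part {s | octant v s ∈ M} b) := by
  rw [sublevel_eq]
  exact ⟨(Homeomorph.subRight (pt v)).subtype fun x => Iff.rfl⟩

theorem AttachesHandles.preimage {n i : ℕ} {X Y : Set (Fin 3 → ℝ)} (h : AttachesHandles n i X Y)
    (τ : (Fin 3 → ℝ) ≃ₜ (Fin 3 → ℝ)) : AttachesHandles n i (τ ⁻¹' X) (τ ⁻¹' Y) := by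
  obtain ⟨h, g, hh, hg, hcov, hover, hbdry⟩ := h
  let eX : (τ ⁻¹' X : Set _) ≃ₜ X := τ.subtype fun x => Iff.rfl
  let eY : (τ ⁻¹' Y : Set _) ≃ₜ Y := τ.subtype fun x => Iff.rfl
  have rh : Set.range (eY.symm ∘ h ∘ eX) = eY.symm '' Set.range h := by
    rw [Set.range_comp, Set.range_comp, eX.range_coe, Set.image_univ]
  have rg : Set.range (eY.symm ∘ g) = eY.symm '' Set.range g := Set.range_comp _ _
  refine ⟨eY.symm ∘ h ∘ eX, eY.symm ∘ g,
    eY.symm.isClosedEmbedding.comp (hh.comp eX.isClosedEmbedding),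
    eY.symm.isClosedEmbedding.comp hg, ?_, fun p => ?_, fun x hx => ?_⟩
  · rw [rh, rg, ← Set.image_union, hcov, Set.image_univ, eY.symm.range_coe]
  · rw [rh, Function.comp_apply, eY.symm.injective.mem_set_image, hover]
  · rw [rg, Function.comp_apply, Function.comp_apply, eY.symm.injective.mem_set_image] at hx
    rw [← τ.preimage_frontier]
    exact hbdry _ hx

theorem attachesHandles_sublevel_iff {n i : ℕ} (M : Set (Fin 3 → ℤ)) (v : Fin 3 → ℤ) (b c : ℝ) :
    AttachesHandles n i (sublevel M v (diag (pt v) + b)) (sublevel M v (diag (pt v) + c)) ↔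
      AttachesHandles n i (part {s | octant v s ∈ M} b) (part {s | octant v s ∈ M} c) := by
  rw [sublevel_eq, sublevel_eq]
  refine ⟨fun h => ?_, fun h => h.preimage _⟩
  have := h.preimage (Homeomorph.subRight (pt v)).symm
  simpa only [← Set.preimage_comp, Homeomorph.self_comp_symm, Set.preimage_id] using this

theorem pt_mem_cube_octant (v : Fin 3 → ℤ) (s : Signs) : pt v ∈ cube (octant v s) :=
  mem_cube_octant_iff.2 fun i => by simp [pt]

/-- A cube that comes closer to `v` than one unit is one of the eight cubes around `v`. -/
theorem exists_octant_of_mem_cube {v c : Fin 3 → ℤ} {x : Fin 3 → ℝ} (hx : x ∈ cube c)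
    (h : ‖x - pt v‖ < 1) : ∃ s, octant v s = c := by
  refine ⟨fun i => decide (c i = v i), funext fun i => ?_⟩
  have h1 : |x i - v i| < 1 := lt_of_le_of_lt (norm_le_pi_norm (x - pt v) i) h
  rw [abs_lt] at h1
  have h2 := hx i
  have h3 : c i < v i + 1 := by
    have : (c i : ℝ) < v i + 1 := by linarith
    exact_mod_cast this
  have h4 : v i - 2 < c i := by
    have : (v i : ℝ) - 2 < c i := by linarith
    exact_mod_cast this
  by_cases e : c i = v i
  · simp [octant, e]
  · simp only [octant, e, decide_false, Bool.false_eq_true, if_false]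
    omega

theorem pt_mem_body_iff {M : Set (Fin 3 → ℤ)} {v : Fin 3 → ℤ} :
    pt v ∈ body M ↔ ∃ s, octant v s ∈ M := by
  constructor
  · intro h
    obtain ⟨c, hc, hx⟩ := Set.mem_iUnion₂.1 h
    obtain ⟨s, rfl⟩ := exists_octant_of_mem_cube hx (v := v) (by simp)
    exact ⟨s, hc⟩
  · rintro ⟨s, hs⟩
    exact Set.mem_iUnion₂.2 ⟨_, hs, pt_mem_cube_octant v s⟩

/-- `n` codes the configuration of the cubes of `M` around `v`. -/
def HasConfig (M : Set (Fin 3 → ℤ)) (v : Fin 3 → ℤ) (n : ℕ) : Prop :=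
  n < 256 ∧ config n = {s | octant v s ∈ M}

theorem exists_hasConfig (M : Set (Fin 3 → ℤ)) (v : Fin 3 → ℤ) : ∃ n, HasConfig M v n :=
  exists_config_eq _

theorem isMonkeySaddle_of_hasConfig {M : Set (Fin 3 → ℤ)} {v : Fin 3 → ℤ}
    (h : HasConfig M v (typeCode 14)) : IsMonkeySaddle M v := by
  have hT : ∀ s : Signs, octant v s ∈ M ↔ ∃ i j, i ≠ j ∧ s i = true ∧ s j = true := fun s => by
    have h1 : s ∈ config (typeCode 14) ↔ octant v s ∈ M := by rw [h.2]; rfl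
    rw [← h1, config, Set.mem_ofPred_eq]
    exact (by decide +kernel : ∀ s : Signs, (typeCode 14).testBit (number s) = true ↔
      ∃ i j, i ≠ j ∧ s i = true ∧ s j = true) s
  refine exists_monkey_chart fun x hx => ?_
  constructor
  · intro hxM
    obtain ⟨c, hc, hxc⟩ := Set.mem_iUnion₂.1 hxM
    obtain ⟨s, rfl⟩ := exists_octant_of_mem_cube hxc hx
    obtain ⟨i, j, hij, hi, hj⟩ := (hT s).1 hc
    rw [mem_cube_octant_iff] at hxc
    exact ⟨i, j, hij, by simpa [hi, pt] using (hxc i).1, by simpa [hj, pt] using (hxc j).1⟩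
  · rintro ⟨i, j, hij, hi, hj⟩
    refine Set.mem_iUnion₂.2 ⟨octant v fun l => decide (0 ≤ (x - pt v) l),
      (hT _).2 ⟨i, j, hij, by simpa using hi, by simpa using hj⟩, mem_cube_octant_iff.2 fun l => ?_⟩
    refine ⟨?_, (norm_le_pi_norm (x - pt v) l).trans hx.le⟩
    by_cases hl : 0 ≤ x l - v l
    · simp [pt, hl]
    · have : x l - v l ≤ 0 := by linarith
      simpa [pt, hl] using this

namespace HasConfig

variable {M : Set (Fin 3 → ℤ)} {v : Fin 3 → ℤ} {n : ℕ} (h : HasConfig M v n)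
include h

theorem octant_mem_iff (s : Signs) : octant v s ∈ M ↔ n.testBit (number s) = true := by
  have : s ∈ config n ↔ octant v s ∈ M := by rw [h.2]; rfl
  exact this.symm

theorem hasType_iff (k : Fin 15) : HasType M v k ↔ n = typeCode k := by
  constructor
  · intro hk
    refine Nat.eq_of_testBit_eq fun i => ?_
    by_cases hi : i < 8
    · have := (h.octant_mem_iff (signs i)).symm.trans
        ((hk (signs i)).trans (typeCode_testBit k (signs i)).symm)
      rw [number_signs hi] at this
      exact Bool.eq_iff_iff.2 this
    · have h256 : (256 : ℕ) ≤ 2 ^ i :=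
        (by norm_num : (256 : ℕ) = 2 ^ 8) ▸ Nat.pow_le_pow_right (by norm_num) (not_lt.1 hi)
      rw [Nat.testBit_lt_two_pow (h.1.trans_le h256),
        Nat.testBit_lt_two_pow (((typeCode_lt k).trans (by norm_num)).trans_le h256)]
  · rintro rfl s
    rw [h.octant_mem_iff, typeCode_testBit]

theorem unstacked (hM : IsUnstacked M) : unstacked n = true := by
  have hmem : ∀ i < 8, octant v (signs i) ∈ M ↔ n.testBit i = true := fun i hi => by
    rw [h.octant_mem_iff, number_signs hi]
  rw [CubicalMorse.unstacked, Bool.and_eq_true, List.all_eq_true, List.all_eq_true]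
  constructor
  · intro i hi
    rw [List.mem_range] at hi
    rw [List.all_eq_true]
    intro k hk
    rw [List.mem_range] at hk
    rw [List.all_eq_true]
    intro l hl
    rw [List.mem_range] at hl
    by_cases hkl : k = l
    · simp [hkl]
    by_cases h1 : n.testBit i = true
    swap
    · simp [Bool.not_eq_true] at h1; simp [h1]
    by_cases h2 : n.testBit (i ^^^ 2 ^ k ^^^ 2 ^ l) = true
    swap
    · simp [Bool.not_eq_true] at h2; simp [h2]
    have hik := xor_two_pow_lt hi hk
    have hil := xor_two_pow_lt hi hl
    have hikl := xor_two_pow_lt hik hl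
    rw [← hmem i hi] at h1
    rw [← hmem _ hikl] at h2
    have hne : (⟨k, hk⟩ : Fin 3) ≠ ⟨l, hl⟩ := fun e => hkl (congrArg Fin.val e)
    have e1 : signs (i ^^^ 2 ^ k) = Function.update (signs i) ⟨k, hk⟩ (!signs i ⟨k, hk⟩) :=
      signs_xor i ⟨k, hk⟩
    have e2 : signs (i ^^^ 2 ^ l) = Function.update (signs i) ⟨l, hl⟩ (!signs i ⟨l, hl⟩) :=
      signs_xor i ⟨l, hl⟩
    have e3 : signs (i ^^^ 2 ^ k ^^^ 2 ^ l) = Function.update (signs (i ^^^ 2 ^ k)) ⟨l, hl⟩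
        (!signs (i ^^^ 2 ^ k) ⟨l, hl⟩) := signs_xor _ ⟨l, hl⟩
    have upd : ∀ (s t : Signs) (a : Fin 3), t a = (!s a) →
        |octant v s a - octant v t a| = 1 := fun s t a hta => by
      cases h : s a <;> simp [octant, hta, h]
    have upd' : ∀ (s : Signs) (t : Signs) (a : Fin 3), t a = (!s a) →
        octant v (Function.update s a (!s a)) = Function.update (octant v s) a (octant v t a) := by
      intro s t a hta
      funext b
      by_cases e : b = a
      · subst e; simp [octant, hta]
      · simp [octant, e]
    set t := signs (i ^^^ 2 ^ k ^^^ 2 ^ l)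
    have tk : t ⟨k, hk⟩ = !signs i ⟨k, hk⟩ := by rw [e3, e1]; simp [hne]
    have tl : t ⟨l, hl⟩ = !signs i ⟨l, hl⟩ := by rw [e3, e1]; simp [hne.symm]
    have tm : ∀ a, a ≠ ⟨k, hk⟩ → a ≠ ⟨l, hl⟩ → t a = signs i a := fun a ha hb => by
      rw [e3, e1]; simp [ha, hb]
    have := hM.edge _ h1 _ h2 ⟨k, hk⟩ ⟨l, hl⟩ hne (upd _ _ _ tk) (upd _ _ _ tl)
      (fun a ha hb => by simp [octant, tm a ha hb])
    rw [← upd' _ _ _ tk, ← upd' _ _ _ tl, ← e1, ← e2, hmem _ hik, hmem _ hil] at this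
    rcases this with h3 | h3 <;> simp [h3]
  · intro i hi
    rw [List.mem_range] at hi
    rw [Bool.and_eq_true, bne_iff_ne, bne_iff_ne]
    constructor
    · rintro rfl
      refine hM.vertex v (signs i) fun s' => ?_
      rw [h.octant_mem_iff]
      exact (by decide +kernel : ∀ i < 8, ∀ s' : Signs,
        (2 ^ i + 2 ^ (7 - i)).testBit (number s') = true ↔
          (s' = signs i ∨ s' = fun k => !(signs i k))) i hi s'
    · intro hn
      refine hM.vertex_compl v (signs i) fun s' => ?_
      have hn' : n = 255 - (2 ^ i + 2 ^ (7 - i)) := by omega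
      rw [h.octant_mem_iff, hn']
      exact (by decide +kernel : ∀ i < 8, ∀ s' : Signs,
        ¬ (255 - (2 ^ i + 2 ^ (7 - i))).testBit (number s') = true ↔
          (s' = signs i ∨ s' = fun k => !(signs i k))) i hi s'

theorem pt_mem_body_iff : pt v ∈ body M ↔ n ≠ 0 := by
  rw [CubicalMorse.pt_mem_body_iff]
  constructor
  · rintro ⟨s, hs⟩ rfl
    rw [h.octant_mem_iff] at hs
    simp at hs
  · intro h0
    obtain ⟨i, hi⟩ := Nat.exists_testBit_of_ne_zero h0
    have hi8 : i < 8 := by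
      by_contra hcon
      have h256 : (256 : ℕ) ≤ 2 ^ i :=
        (by norm_num : (256 : ℕ) = 2 ^ 8) ▸ Nat.pow_le_pow_right (by norm_num) (not_lt.1 hcon)
      rw [Nat.testBit_lt_two_pow (h.1.trans_le h256)] at hi
      simp at hi
    exact ⟨signs i, (h.octant_mem_iff _).2 (by rwa [number_signs hi8])⟩

theorem nonempty_homeomorph (b : ℝ) :
    Nonempty (sublevel M v (diag (pt v) + b) ≃ₜ part (config n) b) :=
  h.2 ▸ nonempty_homeomorph_sublevel M v b

theorem attachesHandles_iff (m i : ℕ) (ε : ℝ) :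
    AttachesHandles m i (sublevel M v (diag (pt v) - ε)) (sublevel M v (diag (pt v) + ε)) ↔
      AttachesHandles m i (part (config n) (-ε)) (part (config n) ε) := by
  rw [h.2, sub_eq_add_neg, attachesHandles_sublevel_iff]

theorem sublevel_eq_empty_iff (ε : ℝ) :
    sublevel M v (diag (pt v) - ε) = ∅ ↔ part (config n) (-ε) = ∅ := by
  obtain ⟨e⟩ := h.nonempty_homeomorph (-ε)
  rw [sub_eq_add_neg, ← Set.isEmpty_coe_sort, ← Set.isEmpty_coe_sort]
  exact e.toEquiv.isEmpty_congr

end HasConfig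

theorem eventually_small : ∀ᶠ ε : ℝ in 𝓝[>] 0, 0 < ε ∧ ε < 1 / 4 :=
  Ioo_mem_nhdsGT (by norm_num)

/-- Both sublevel sets are balls unless the vertex has one of the fifteen types, and then the upper
one is a ball and the lower one is not. -/
theorem isCritical_iff {M : Set (Fin 3 → ℤ)} (hM : IsUnstacked M) (v : Fin 3 → ℤ) :
    IsCritical M v ↔ ∃ k, HasType M v k := by
  obtain ⟨n, hn⟩ := exists_hasConfig M v
  simp only [hn.hasType_iff]
  constructor
  · rintro ⟨hv, hcrit⟩
    by_contra! hk
    have h0 := hn.pt_mem_body_iff.1 hv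
    obtain ⟨ε, hε, hε1, hε2⟩ := (hcrit.and eventually_small).exists
    obtain ⟨e1⟩ := nonempty_homeomorph_below toCylinder hn.1 h0 (hn.unstacked hM) hk hε1 hε2
    obtain ⟨e2⟩ := nonempty_homeomorph_above toCylinder hn.1 h0 (hn.unstacked hM) hε1
    obtain ⟨f1⟩ := hn.nonempty_homeomorph (-ε)
    obtain ⟨f2⟩ := hn.nonempty_homeomorph ε
    rw [sub_eq_add_neg] at hε
    exact hε.elim ((f1.trans e1).trans (f2.trans e2).symm)
  · rintro ⟨k, rfl⟩
    refine ⟨hn.pt_mem_body_iff.2 (typeCode_ne_zero k), ?_⟩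
    filter_upwards [eventually_small] with ε ⟨hε1, hε2⟩
    obtain ⟨f1⟩ := hn.nonempty_homeomorph (-ε)
    obtain ⟨f2⟩ := hn.nonempty_homeomorph ε
    rw [sub_eq_add_neg]
    exact ⟨fun f => (isEmpty_homeomorph_typeCode k hε1 hε2).elim ((f1.symm.trans f).trans f2)⟩

theorem isNondegenerate_of_hasType {M : Set (Fin 3 → ℤ)} (hM : IsUnstacked M) (v : Fin 3 → ℤ)
    (k : Fin 14) (hk : HasType M v k.castSucc) : IsNondegenerate M v (typeIndex k) := by
  refine ⟨(isCritical_iff hM v).2 ⟨_, hk⟩,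
    (by decide : ∀ k : Fin 14, typeIndex k ≤ 2) k, ?_⟩
  obtain ⟨n, hn⟩ := exists_hasConfig M v
  obtain rfl := (hn.hasType_iff _).1 hk
  filter_upwards [eventually_small] with ε ⟨hε1, hε2⟩
  refine ⟨(hn.attachesHandles_iff _ _ _).2 (attachesHandles_typeCode k hε1 hε2), fun h0 => ?_⟩
  rw [hn.sublevel_eq_empty_iff]
  obtain rfl := (by decide : ∀ k : Fin 14, typeIndex k = 0 → k = 0) k h0
  exact part_typeCode_zero (by linarith)

/-- The three pieces below the level of the vertex are neither empty nor joined by one handle. -/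
theorem isDegenerate_of_hasType {M : Set (Fin 3 → ℤ)} (hM : IsUnstacked M) (v : Fin 3 → ℤ)
    (hk : HasType M v (Fin.last 14)) : IsDegenerate M v := by
  refine ⟨(isCritical_iff hM v).2 ⟨_, hk⟩, fun i hi => ?_⟩
  obtain ⟨n, hn⟩ := exists_hasConfig M v
  obtain rfl : n = typeCode 14 := (hn.hasType_iff _).1 hk
  obtain ⟨-, hi2, hev⟩ := hi
  obtain ⟨ε, ⟨ha, h0⟩, hε1, hε2⟩ := (hev.and eventually_small).exists
  rcases Nat.eq_zero_or_pos i with rfl | hpos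
  · have h0 := (hn.sublevel_eq_empty_iff ε).1 (h0 rfl)
    rw [splits_monkey.part_eq (by linarith)] at h0
    obtain ⟨x, hx⟩ := splits_monkey.nonempty (b := -ε) (by linarith) 0
    exact Set.eq_empty_iff_forall_notMem.1 h0 x (Set.mem_iUnion.2 ⟨0, hx⟩)
  · exact not_attachesHandles_monkey (by omega) hε1 hε2 ((hn.attachesHandles_iff _ _ _).1 ha)

/-! ### Preprocessing -/

/-- The cube of the original body whose stretched copy contains the small cube `c`. -/
def coarse (c : Fin 3 → ℤ) : Fin 3 → ℤ := fun i => c i / 3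

theorem coarse_update (c : Fin 3 → ℤ) (i : Fin 3) (a : ℤ) :
    coarse (Function.update c i a) = Function.update (coarse c) i (a / 3) := by
  funext l
  by_cases h : l = i
  · subst h; simp [coarse]
  · simp [coarse, h]

theorem mem_preprocess_iff {M : Set (Fin 3 → ℤ)} {c : Fin 3 → ℤ} :
    c ∈ preprocess M ↔ coarse c ∈ M ∧ ∀ i,
      Function.update (coarse c) i ((c i + 1) / 3) ∈ M ∧
      Function.update (coarse c) i ((c i - 1) / 3) ∈ M := by
  simp only [preprocess, subdivide, Set.mem_ofPred_eq, ← coarse_update]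
  rfl

/-- Moving a cube of the preprocessed body to the middle third of its big cube in some direction
does not lead out of the body. -/
theorem update_mem_preprocess {M : Set (Fin 3 → ℤ)} {c : Fin 3 → ℤ} (hc : c ∈ preprocess M)
    {i : Fin 3} {a : ℤ} (ha : a % 3 = 1) (hac : a / 3 = c i / 3) :
    Function.update c i a ∈ preprocess M := by
  rw [mem_preprocess_iff] at hc ⊢
  have h0 : Function.update (coarse c) i (a / 3) = coarse c := by
    rw [hac]; exact Function.update_eq_self i (coarse c)
  rw [coarse_update, h0]
  refine ⟨hc.1, fun l => ?_⟩
  by_cases hl : l = i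
  · subst hl
    rw [Function.update_self, show (a + 1) / 3 = a / 3 by omega,
      show (a - 1) / 3 = a / 3 by omega, h0]
    exact ⟨hc.1, hc.1⟩
  · rw [Function.update_of_ne hl]
    exact hc.2 l

/-- A block with opposite corners `p` and `p'` is stacked if it has four cubes in the layer of `p'`
in the direction `k`, and `p` and the cube diagonally opposite to it in the other layer. -/
theorem hasStackedBlock_of_corners {M : Set (Fin 3 → ℤ)} {p p' : Fin 3 → ℤ} (k : Fin 3)
    (hp : ∀ a, |p a - p' a| = 1)
    (h : ∀ x : Fin 3 → ℤ, (∀ a, x a = p a ∨ x a = p' a) →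
      (x ∈ M ↔ x k = p' k ∨ x = p ∨ x = Function.update p' k (p k))) : HasStackedBlock M := by
  have hne : ∀ a, p a ≠ p' a := fun a e => by simpa [e] using hp a
  have ho : ∀ (s' : Signs) (a : Fin 3), octant (fun a => max (p a) (p' a)) s' a =
      if s' a = decide (p' a < p a) then p a else p' a := fun s' a => by
    have h1 := hp a
    rw [abs_eq (by norm_num)] at h1
    by_cases h2 : p' a < p a <;> cases h3 : s' a <;> simp [octant, h2, h3] <;> omega
  refine ⟨fun a => max (p a) (p' a), k, fun a => decide (p' a < p a), fun s' => ?_⟩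
  have key : ∀ (t : Signs) (x : Fin 3 → ℤ),
      (∀ a, x a = if t a = decide (p' a < p a) then p a else p' a) →
      (octant (fun a => max (p a) (p' a)) s' = x ↔ s' = t) := fun t x hx => by
    constructor
    · intro e
      funext a
      have e1 := congrFun e a
      rw [ho, hx] at e1
      have h4 := hne a
      have h5 := hne a |>.symm
      cases h6 : s' a <;> cases h7 : t a <;> cases h8 : decide (p' a < p a) <;>
        simp_all
    · rintro rfl
      funext a
      rw [ho, hx]
  rw [h _ fun a => by rw [ho]; split <;> simp, key (fun a => decide (p' a < p a)) p (by simp),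
    key (fun a => if a = k then decide (p' a < p a) else !decide (p' a < p a)) _ (fun a => by
      by_cases ha : a = k
      · subst ha; simp
      · simp [ha])]
  refine or_congr ?_ Iff.rfl
  rw [ho]
  by_cases h1 : s' k = decide (p' k < p k)
  · simp [h1, hne k]
  · simp [h1]

/-- Let `c` and `d` be two diagonally adjacent cubes of the preprocessed body in diagonally adjacent
big cubes. If one of the two cubes next to both of them is not in the preprocessed body, then this
is because, in the direction of the common edge, a neighbour of its big cube is missing. -/
theorem exists_neighbor_notMem {M : Set (Fin 3 → ℤ)} {c d : Fin 3 → ℤ}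
    (hc : c ∈ preprocess M) (hd : d ∈ preprocess M) {i j k : Fin 3} (hij : i ≠ j) (hki : k ≠ i)
    (hkj : k ≠ j) (hcov : ∀ l, l = i ∨ l = j ∨ l = k) (hi : c i - d i = 1 ∨ c i - d i = -1)
    (hj : c j - d j = 1 ∨ c j - d j = -1) (hk : c k = d k) (qi : c i / 3 ≠ d i / 3)
    (qj : c j / 3 ≠ d j / 3) :
    Function.update (coarse c) i (coarse d i) ∈ M ∧
      (Function.update c i (d i) ∉ preprocess M → ∃ δ : ℤ, (δ = 1 ∨ δ = -1) ∧
        Function.update (Function.update (coarse c) i (coarse d i)) k ((c k + δ) / 3) ∉ M) := by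
  rw [mem_preprocess_iff] at hc hd
  set C := coarse c with hC
  set D := coarse d with hD
  have hCi : C i = c i / 3 := rfl
  have hDi : D i = d i / 3 := rfl
  have hCj : C j = c j / 3 := rfl
  have hDj : D j = d j / 3 := rfl
  have hCD : C k = D k := by simp only [hC, hD, coarse, hk]
  have hE : Function.update C i (D i) ∈ M := by
    rcases (by omega : (c i + 1) / 3 = d i / 3 ∨ (c i - 1) / 3 = d i / 3) with h | h
    · rw [hDi, ← h]; exact (hc.2 i).1
    · rw [hDi, ← h]; exact (hc.2 i).2
  have hDE : Function.update (Function.update C i (D i)) j (D j) = D := by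
    funext l
    rcases hcov l with rfl | rfl | rfl
    · simp [hij]
    · simp
    · simp [hki, hkj, hCD]
  refine ⟨hE, fun hn => ?_⟩
  by_contra! hcon
  refine hn (mem_preprocess_iff.2 ?_)
  rw [coarse_update, ← hDi, ← hC]
  refine ⟨hE, fun l => ?_⟩
  rcases hcov l with rfl | rfl | rfl
  · have : ∀ a : ℤ, a / 3 = d l / 3 ∨ a / 3 = c l / 3 →
        Function.update (Function.update C l (D l)) l (a / 3) ∈ M := by
      rintro a (h | h)
      · rw [h, ← hDi]; simpa using hE
      · rw [h, ← hCi]; simpa using hc.1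
    simp only [Function.update_self]
    exact ⟨this _ (by omega), this _ (by omega)⟩
  · have : ∀ a : ℤ, a / 3 = d l / 3 ∨ a / 3 = c l / 3 →
        Function.update (Function.update C i (D i)) l (a / 3) ∈ M := by
      rintro a (h | h)
      · rw [h, ← hDj, hDE]; exact hd.1
      · have : Function.update (Function.update C i (D i)) l (C l) = Function.update C i (D i) := by
          conv_rhs => rw [← Function.update_eq_self l (Function.update C i (D i))]
          rw [Function.update_of_ne hij.symm]
        rw [h, ← hCj, this]; exact hE
    simp only [Function.update_of_ne hij.symm]
    exact ⟨this _ (by omega), this _ (by omega)⟩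
  · simp only [Function.update_of_ne hki]
    exact ⟨hcon 1 (.inl rfl), hcon (-1) (.inr rfl)⟩

/-- Unless both coordinate planes at the common edge separate big cubes, one of the two cubes in
question lies in the middle third of its big cube. Otherwise both can only be missing if the layer
of big cubes on one side has two diagonally opposite cubes over a full layer. -/
theorem preprocess_edge {M : Set (Fin 3 → ℤ)} (hM : ¬ HasStackedBlock M) {c d : Fin 3 → ℤ}
    (hc : c ∈ preprocess M) (hd : d ∈ preprocess M) {i j : Fin 3} (hij : i ≠ j)
    (hi : |c i - d i| = 1) (hj : |c j - d j| = 1) (hk : ∀ k, k ≠ i → k ≠ j → c k = d k) :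
    Function.update c i (d i) ∈ preprocess M ∨ Function.update c j (d j) ∈ preprocess M := by
  have eij : Function.update d i (c i) = Function.update c j (d j) := by
    funext l
    by_cases h1 : l = i
    · subst h1; simp [hij]
    · by_cases h2 : l = j
      · subst h2; simp [h1]
      · simp [h1, h2, hk l h1 h2]
  have eji : Function.update d j (c j) = Function.update c i (d i) := by
    funext l
    by_cases h1 : l = i
    · subst h1; simp [hij]
    · by_cases h2 : l = j
      · subst h2; simp [h1]
      · simp [h1, h2, hk l h1 h2]
  rw [abs_eq (by norm_num)] at hi hj
  by_cases qi : c i / 3 = d i / 3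
  · have h : c i % 3 = 1 ∨ d i % 3 = 1 := by omega
    rcases h with h | h
    · right; rw [← eij]; exact update_mem_preprocess hd h qi
    · left; exact update_mem_preprocess hc h qi.symm
  by_cases qj : c j / 3 = d j / 3
  · have h : c j % 3 = 1 ∨ d j % 3 = 1 := by omega
    rcases h with h | h
    · left; rw [← eji]; exact update_mem_preprocess hd h qj
    · right; exact update_mem_preprocess hc h qj.symm
  -- Now the four cubes at the edge lie in four different big cubes, all of which are in `M`.
  obtain ⟨k, hki, hkj, hcov⟩ := (by decide : ∀ i j : Fin 3, i ≠ j →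
    ∃ k, k ≠ i ∧ k ≠ j ∧ ∀ l, l = i ∨ l = j ∨ l = k) i j hij
  have hkk := hk k hki hkj
  obtain ⟨hE, redE⟩ := exists_neighbor_notMem hc hd hij hki hkj hcov hi hj hkk qi qj
  obtain ⟨hF, redF⟩ := exists_neighbor_notMem hc hd hij.symm hkj hki
    (fun l => by have := hcov l; tauto) hj hi hkk qj qi
  rw [mem_preprocess_iff] at hc hd
  set C := coarse c with hC
  set D := coarse d with hD
  have hCi : C i = c i / 3 := rfl
  have hDi : D i = d i / 3 := rfl
  have hCj : C j = c j / 3 := rfl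
  have hDj : D j = d j / 3 := rfl
  have hCk : C k = c k / 3 := rfl
  have hCD : C k = D k := by simp only [hC, hD, coarse, hkk]
  by_contra! hcon
  obtain ⟨δ, hδ, hE'⟩ := redE hcon.1
  obtain ⟨δ', hδ', hF'⟩ := redF hcon.2
  have selfE : Function.update (Function.update C i (D i)) k (c k / 3) =
      Function.update C i (D i) := by
    conv_rhs => rw [← Function.update_eq_self k (Function.update C i (D i))]
    rw [Function.update_of_ne hki, hCk]
  have selfF : Function.update (Function.update C j (D j)) k (c k / 3) =
      Function.update C j (D j) := by
    conv_rhs => rw [← Function.update_eq_self k (Function.update C j (D j))]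
    rw [Function.update_of_ne hkj, hCk]
  have h1 : (c k + δ) / 3 ≠ c k / 3 := fun h => hE' (by rw [h, selfE]; exact hE)
  have h2 : (c k + δ') / 3 ≠ c k / 3 := fun h => hF' (by rw [h, selfF]; exact hF)
  obtain rfl : δ = δ' := by omega
  have hC' : Function.update C k ((c k + δ) / 3) ∈ M := by
    rcases hδ with rfl | rfl
    · exact (hc.2 k).1
    · exact (hc.2 k).2
  have hD' : Function.update D k ((c k + δ) / 3) ∈ M := by
    rw [hkk]
    rcases hδ with rfl | rfl
    · exact (hd.2 k).1
    · exact (hd.2 k).2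
  refine hM (hasStackedBlock_of_corners (p := Function.update C k ((c k + δ) / 3)) (p' := D) k
    (fun a => ?_) fun x hx => ?_)
  · rw [abs_eq (by norm_num)]
    rcases hcov a with rfl | rfl | rfl
    · rw [Function.update_of_ne hki.symm]; omega
    · rw [Function.update_of_ne hkj.symm]; omega
    · rw [Function.update_self, ← hCD]; omega
  · have ext_of : ∀ {y : Fin 3 → ℤ}, x i = y i → x j = y j → x k = y k → x = y := by
      intro y h1 h2 h3
      funext l
      rcases hcov l with rfl | rfl | rfl <;> assumption
    have xi := hx i
    have xj := hx j
    have xk := hx k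
    rw [Function.update_of_ne hki.symm] at xi
    rw [Function.update_of_ne hkj.symm] at xj
    rw [Function.update_self] at xk ⊢
    have hKD : (c k + δ) / 3 ≠ D k := by rw [← hCD, hCk]; exact h1
    have hiCD : C i ≠ D i := qi
    have hjCD : C j ≠ D j := qj
    rcases xk with xk | xk
    · have hxD : x k ≠ D k := by rw [xk]; exact hKD
      rcases xi with xi | xi <;> rcases xj with xj | xj
      · have : x = Function.update C k ((c k + δ) / 3) :=
          ext_of (by simp [xi, hki.symm]) (by simp [xj, hkj.symm]) (by simp [xk])
        simp [this, hC']
      · have : x = Function.update (Function.update C j (D j)) k ((c k + δ) / 3) :=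
          ext_of (by simp [xi, hki.symm, hij]) (by simp [xj, hkj.symm]) (by simp [xk])
        refine iff_of_false (this ▸ hF') ?_
        rintro (h | h | h)
        · exact hxD h
        · have := congrFun h j; rw [xj, Function.update_of_ne hkj.symm] at this
          exact hjCD this.symm
        · have := congrFun h i; rw [xi, Function.update_of_ne hki.symm] at this; exact hiCD this
      · have : x = Function.update (Function.update C i (D i)) k ((c k + δ) / 3) :=
          ext_of (by simp [xi, hki.symm]) (by simp [xj, hkj.symm, hij.symm]) (by simp [xk])
        refine iff_of_false (this ▸ hE') ?_
        rintro (h | h | h)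
        · exact hxD h
        · have := congrFun h i; rw [xi, Function.update_of_ne hki.symm] at this
          exact hiCD this.symm
        · have := congrFun h j; rw [xj, Function.update_of_ne hkj.symm] at this; exact hjCD this
      · have : x = Function.update D k ((c k + δ) / 3) :=
          ext_of (by simp [xi, hki.symm]) (by simp [xj, hkj.symm]) (by simp [xk])
        simp [this, hD']
    · refine iff_of_true ?_ (.inl xk)
      rcases xi with xi | xi <;> rcases xj with xj | xj
      · rw [ext_of xi xj (xk.trans hCD.symm)]; exact hc.1
      · rwa [ext_of (y := Function.update C j (D j)) (by simp [xi, hij]) (by simp [xj])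
          (by simp [xk, hkj, hCD])]
      · rwa [ext_of (y := Function.update C i (D i)) (by simp [xi]) (by simp [xj, hij.symm])
          (by simp [xk, hki, hCD])]
      · rw [ext_of xi xj xk]; exact hd.1

theorem octant_update (v : Fin 3 → ℤ) (s : Signs) (i : Fin 3) (b : Bool) :
    octant v (Function.update s i b) =
      Function.update (octant v s) i (if b then v i else v i - 1) := by
  funext l
  by_cases h : l = i
  · subst h; simp [octant]
  · simp [octant, h]

/-- If the planes between the big cubes do not all meet at `v`, then around `v` the preprocessed
body is invariant under a move in some direction. -/
theorem exists_update_octant_mem {M : Set (Fin 3 → ℤ)} {v : Fin 3 → ℤ} {i : Fin 3}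
    (hv : v i % 3 ≠ 0) : ∃ b, ∀ s, octant v s ∈ preprocess M →
      octant v (Function.update s i b) ∈ preprocess M := by
  refine ⟨decide (v i % 3 = 1), fun s hs => ?_⟩
  rw [octant_update]
  refine update_mem_preprocess hs ?_ ?_
  · simp only [decide_eq_true_eq]; split <;> omega
  · simp only [decide_eq_true_eq, octant]; split <;> split <;> omega

/-- At a common vertex of eight big cubes, a small cube remains if its big cube and the three
adjacent ones are there. -/
theorem octant_mem_preprocess_iff {M : Set (Fin 3 → ℤ)} {v : Fin 3 → ℤ} (hv : ∀ i, v i % 3 = 0)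
    (s : Signs) : octant v s ∈ preprocess M ↔ octant (coarse v) s ∈ M ∧
      ∀ i, octant (coarse v) (Function.update s i (!s i)) ∈ M := by
  have h0 : coarse (octant v s) = octant (coarse v) s := by
    funext i
    have := hv i
    simp only [coarse, octant]
    split <;> omega
  rw [mem_preprocess_iff, h0]
  have self : ∀ i, Function.update (octant (coarse v) s) i (octant (coarse v) s i) =
    octant (coarse v) s := fun i => Function.update_eq_self _ _
  have key : ∀ i, (Function.update (octant (coarse v) s) i ((octant v s i + 1) / 3) ∈ M ∧
      Function.update (octant (coarse v) s) i ((octant v s i - 1) / 3) ∈ M) ↔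
      (octant (coarse v) s ∈ M ∧ octant (coarse v) (Function.update s i (!s i)) ∈ M) := fun i => by
    have h := hv i
    rw [octant_update, ← self i]
    cases hs : s i
    · have e1 : (octant v s i + 1) / 3 = coarse v i := by simp [octant, hs, coarse]
      have e2 : (octant v s i - 1) / 3 = octant (coarse v) s i := by
        simp [octant, hs, coarse]; omega
      rw [e1, e2, self, and_comm]; simp
    · have e1 : (octant v s i + 1) / 3 = octant (coarse v) s i := by
        simp [octant, hs, coarse]; omega
      have e2 : (octant v s i - 1) / 3 = coarse v i - 1 := by
        simp [octant, hs, coarse]; omega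
      rw [e1, e2, self]; simp
  simp only [key]
  exact ⟨fun h => ⟨h.1, fun i => (h.2 i).2⟩, fun h => ⟨h.1, fun i => ⟨h.1, h.2 i⟩⟩⟩

/-- Around the common vertex of eight big cubes, two opposite small cubes are present only if all
big cubes are, and then all small cubes are. At other vertices two opposite cubes entail a third
one, to which one of them can be moved. -/
theorem preprocess_vertex (M : Set (Fin 3 → ℤ)) (v : Fin 3 → ℤ) (s : Signs) :
    ¬ ∀ s' : Signs, octant v s' ∈ preprocess M ↔ (s' = s ∨ s' = fun k => !(s k)) := by
  intro h
  by_cases hv : ∀ i, v i % 3 = 0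
  · have hall : ∀ t, octant (coarse v) t ∈ M := fun t => by
      have h1 := (octant_mem_preprocess_iff hv s).1 ((h s).2 (.inl rfl))
      have h2 := (octant_mem_preprocess_iff hv _).1 ((h fun k => !(s k)).2 (.inr rfl))
      rcases (by decide : ∀ s t : Signs, (t = s ∨ ∃ i, t = Function.update s i (!s i)) ∨
        (t = fun k => !s k) ∨ ∃ i, t = Function.update (fun k => !s k) i (!!s i)) s t with
        (rfl | ⟨i, rfl⟩) | rfl | ⟨i, rfl⟩
      exacts [h1.1, h1.2 i, h2.1, h2.2 i]
    have := (h (Function.update s 0 (!s 0))).1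
      ((octant_mem_preprocess_iff hv _).2 ⟨hall _, fun _ => hall _⟩)
    revert this
    exact (by decide : ∀ s : Signs, ¬ (Function.update s 0 (!s 0) = s ∨
      Function.update s 0 (!s 0) = fun k => !s k)) s
  · push Not at hv
    obtain ⟨i, hi⟩ := hv
    obtain ⟨b, hb⟩ := exists_update_octant_mem (M := M) hi
    have h1 := (h _).1 (hb _ ((h s).2 (.inl rfl)))
    have h2 := (h _).1 (hb _ ((h fun k => !(s k)).2 (.inr rfl)))
    exact (by decide : ∀ (s : Signs) (i : Fin 3) (b : Bool),
      ¬ ((Function.update s i b = s ∨ Function.update s i b = fun k => !s k) ∧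
        (Function.update (fun k => !s k) i b = s ∨
          Function.update (fun k => !s k) i b = fun k => !s k))) s i b ⟨h1, h2⟩

/-- Around the common vertex of eight big cubes, all small cubes but two opposite ones are present
only if all big cubes are, and then no small cube is missing. At other vertices a move in some
direction would carry a present cube to one of the two opposite ones. -/
theorem preprocess_vertex_compl (M : Set (Fin 3 → ℤ)) (v : Fin 3 → ℤ) (s : Signs) :
    ¬ ∀ s' : Signs, octant v s' ∉ preprocess M ↔ (s' = s ∨ s' = fun k => !(s k)) := by
  intro h
  have h' : ∀ s', ¬ (s' = s ∨ s' = fun k => !(s k)) → octant v s' ∈ preprocess M :=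
    fun s' hs' => not_not.1 fun hn => hs' ((h s').1 hn)
  by_cases hv : ∀ i, v i % 3 = 0
  · have hall : ∀ t, octant (coarse v) t ∈ M := fun t => by
      obtain ⟨t', ht', rfl | ⟨i, rfl⟩⟩ := (by decide : ∀ s t : Signs, ∃ t' : Signs,
        ¬ (t' = s ∨ t' = fun k => !(s k)) ∧ (t = t' ∨ ∃ i, t = Function.update t' i (!t' i))) s t
      · exact ((octant_mem_preprocess_iff hv _).1 (h' _ ht')).1
      · exact ((octant_mem_preprocess_iff hv _).1 (h' _ ht')).2 i
    exact (h s).2 (.inl rfl) ((octant_mem_preprocess_iff hv _).2 ⟨hall _, fun _ => hall _⟩)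
  · push Not at hv
    obtain ⟨i, hi⟩ := hv
    obtain ⟨b, hb⟩ := exists_update_octant_mem (M := M) hi
    obtain ⟨t, ht, ht'⟩ := (by decide : ∀ (s : Signs) (i : Fin 3) (b : Bool), ∃ t : Signs,
      ¬ (t = s ∨ t = fun k => !(s k)) ∧
      (Function.update t i b = s ∨ Function.update t i b = fun k => !(s k))) s i b
    exact (h _).2 ht' (hb _ (h' t ht))

theorem isUnstacked_preprocess {M : Set (Fin 3 → ℤ)} (hM : ¬ HasStackedBlock M) :
    IsUnstacked (preprocess M) where
  edge _ hc _ hd _ _ hij hi hj hk := preprocess_edge hM hc hd hij hi hj hk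
  vertex := preprocess_vertex M
  vertex_compl := preprocess_vertex_compl M

/-! ### Examples of all types -/

/-- The body formed by the cubes of the cube `[0, 2]³` coded by the bits of `n`. -/
def block (n : ℕ) : Set (Fin 3 → ℤ) :=
  {c | (∀ i, c i = 0 ∨ c i = 1) ∧ n.testBit (number fun i => decide (c i = 1)) = true}

instance (n : ℕ) (c : Fin 3 → ℤ) : Decidable (c ∈ block n) :=
  inferInstanceAs (Decidable (_ ∧ _))

theorem finite_block (n : ℕ) : (block n).Finite := by
  refine (Set.Finite.pi' fun _ : Fin 3 => Set.toFinite ({0, 1} : Set ℤ)).subset fun c hc i => ?_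
  simpa using hc.1 i

theorem octant_one_mem_block_iff {n : ℕ} {s : Signs} :
    octant 1 s ∈ block n ↔ n.testBit (number s) = true := by
  have : (fun i => decide (octant 1 s i = 1)) = s := by
    funext i
    cases h : s i <;> simp [octant, h]
  rw [block, Set.mem_ofPred_eq, this, and_iff_right]
  intro i
  cases h : s i <;> simp [octant, h]

theorem not_hasStackedBlock_block {n : ℕ} (h : ∀ (i : Fin 3) (s : Signs), ∃ s' : Signs,
    ¬ (n.testBit (number s') = true ↔
      (s' i ≠ s i ∨ s' = s ∨ s' = fun k => if k = i then s k else !(s k)))) :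
    ¬ HasStackedBlock (block n) := by
  rintro ⟨v, i, s, hv⟩
  -- A stacked block has cubes in all six layers, so it can only be the cube `[0, 2]³`.
  have key : ∀ (a : Fin 3) (b : Bool), ∃ s', s' a = b ∧ octant v s' ∈ block n := fun a b => by
    obtain ⟨s', hs', hs⟩ := (by decide : ∀ (s : Signs) (i a : Fin 3) (b : Bool), ∃ s' : Signs,
      s' a = b ∧ (s' i ≠ s i ∨ s' = s)) s i a b
    exact ⟨s', hs', (hv s').2 (by tauto)⟩
  obtain rfl : v = 1 := by
    funext a
    obtain ⟨t, ht, htm⟩ := key a true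
    obtain ⟨u, hu, hum⟩ := key a false
    have h1 := htm.1 a
    have h2 := hum.1 a
    simp only [octant, ht, hu, if_true, Bool.false_eq_true, if_false] at h1 h2
    change v a = 1
    omega
  obtain ⟨s', hs'⟩ := h i s
  exact hs' (octant_one_mem_block_iff.symm.trans (hv s'))

/-- The code of a block whose preprocessing has a vertex of the `k`-th type. -/
def exampleCode : Fin 15 → ℕ :=
  ![1, 254, 14, 84, 50, 232, 232, 232, 226, 172, 216, 228, 184, 202, 254]

/-- A vertex of the `k`-th type in the preprocessed example. -/
def exampleVertex : Fin 15 → Fin 3 → ℤ :=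
  ![![1, 1, 1], ![3, 3, 4], ![3, 4, 1], ![1, 3, 4], ![3, 1, 4],
    ![4, 4, 3], ![3, 4, 4], ![4, 3, 4], ![4, 3, 4], ![4, 4, 3],
    ![3, 4, 4], ![3, 4, 4], ![4, 3, 4], ![4, 4, 3], ![3, 3, 3]]

theorem exists_hasType_preprocess (k : Fin 15) : ∃ M₀ : Set (Fin 3 → ℤ), M₀.Finite ∧
    ¬ HasStackedBlock M₀ ∧ ∃ v : Fin 3 → ℤ, HasType (preprocess M₀) v k := by
  refine ⟨block (exampleCode k), finite_block _, not_hasStackedBlock_block ?_, exampleVertex k,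
    fun s => ?_⟩
  · exact (by decide +kernel : ∀ (k : Fin 15) (i : Fin 3) (s : Signs), ∃ s' : Signs,
      ¬ ((exampleCode k).testBit (number s') = true ↔
        (s' i ≠ s i ∨ s' = s ∨ s' = fun k => if k = i then s k else !(s k)))) k
  · rw [mem_preprocess_iff]
    exact (by decide +kernel : ∀ (k : Fin 15) (s : Signs),
      (coarse (octant (exampleVertex k) s) ∈ block (exampleCode k) ∧ ∀ i,
        Function.update (coarse (octant (exampleVertex k) s)) i
          ((octant (exampleVertex k) s i + 1) / 3) ∈ block (exampleCode k) ∧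
        Function.update (coarse (octant (exampleVertex k) s)) i
          ((octant (exampleVertex k) s i - 1) / 3) ∈ block (exampleCode k)) ↔
      entry k s = 1) k s

end CubicalMorse

theorem theorem1 :
    -- preprocessing produces unstacked bodies
    (∀ M₀ : Set (Fin 3 → ℤ), ¬ HasStackedBlock M₀ → IsUnstacked (preprocess M₀)) ∧
    -- the classification of the critical points
    (∀ M : Set (Fin 3 → ℤ), IsUnstacked M → ∀ v : Fin 3 → ℤ,
      (IsCritical M v ↔ ∃ k : Fin 15, HasType M v k) ∧
      (∀ k : Fin 14, HasType M v k.castSucc → IsNondegenerate M v (typeIndex k)) ∧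
      (HasType M v (Fin.last 14) →
        IsDegenerate M v ∧ IsMonkeySaddle M v ∧
        ∀ᶠ ε : ℝ in 𝓝[>] 0,
          AttachesHandles 2 1 (sublevel M v (diag (pt v) - ε))
            (sublevel M v (diag (pt v) + ε)))) ∧
    -- all fifteen types occur in preprocessed bodies
    (∀ k : Fin 15, ∃ M₀ : Set (Fin 3 → ℤ), M₀.Finite ∧ ¬ HasStackedBlock M₀ ∧
      ∃ v : Fin 3 → ℤ, HasType (preprocess M₀) v k) := by
  refine ⟨fun _ => isUnstacked_preprocess, fun M hM v => ⟨isCritical_iff hM v,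
    isNondegenerate_of_hasType hM v, fun hk => ⟨isDegenerate_of_hasType hM v hk, ?_⟩⟩,
    exists_hasType_preprocess⟩
  obtain ⟨n, hn⟩ := exists_hasConfig M v
  obtain rfl : n = typeCode 14 := (hn.hasType_iff _).1 hk
  refine ⟨isMonkeySaddle_of_hasConfig hn, ?_⟩
  filter_upwards [eventually_small] with ε ⟨hε1, hε2⟩
  exact (hn.attachesHandles_iff _ _ _).2 (attachesHandles_monkey hε1 hε2)
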